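/- Theorem (causal (anti)commutators of the $N=2$ hyper-multiplet). Conventions: $g=\mathrm{diag}(1,-1,-1,-1)$; $\sigma^\mu$ are the Pauli matrices with $\sigma^0=\mathbf 1$; $\epsilon_{12}=1$, $\epsilon_{ab}=-\epsilon_{ba}$, $\epsilon^{ab}=-\epsilon_{ab}$, and Weyl indices are raised by $\xi^b=\epsilon^{bc}\xi_c$, $\bar\xi^{\bar b}=\epsilon^{\bar b\bar c}\bar\xi_{\bar c}$; repeated indices are summed. For $m\ge 0$ let $$D_m(x)=\frac{i}{(2\pi)^3}\int\frac{d^3k}{2\omega}\left(e^{-ik\cdot x}-e^{ik\cdot x}\right),\qquad k^0=\omega=\sqrt{m^2+|\mathbf k|^2},$$ be the Pauli–Jordan distribution of mass $m$. Fields are operator-valued distributions, with values in a nonzero complex $*$-algebra of operators, linear on Schwartz test functions on $\mathbb R^4$. A hyper-multiplet consists of scalar fields $\phi_j,f_j$ ($j=1,2$) and spinor fields $\psi_a,\chi_a$ ($a=1,2$), of commuting unitary representations of the universal covering $\mathbb R^4\rtimes SL(2,\mathbb C)$ of the Poincaré group and of $SU(2)$, of self-adjoint $P_\mu$ with $[P_\mu,F]=-i\partial_\mu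 F$ for all fields $F$, of supercharges $Q_{ja}$ with $\bar Q_{j\bar a}=(Q_{ja})^*$, and of a self-adjoint central charge $Z$, such that: $\phi_j,f_j$ are Lorentz scalars and $SU(2)$ doublets ($V_U^{-1}\phi_jV_U=U_{jk}\phi_k$ and likewise for $f_j$), $\psi_a,\chi_a$ are Weyl spinors and $SU(2)$ singlets, $Q_{ja}$ is a Weyl spinor and an $SU(2)$ doublet, $[Q_{ja},P_\mu]=0$, $[Z,Q_{ja}]=0$, $$\{Q_{ja},Q_{kb}\}=2\epsilon_{ab}\epsilon_{jk}Z,\qquad \{Q_{ja},\bar Q_{k\bar b}\}=2\delta_{jk}\sigma^\mu_{a\bar b}P_\mu,$$ and $$i[Q_{ja},\phi_k]=\epsilon_{jk}\psi_a,\quad i[\bar Q_{j\bar a},\phi_k]=\delta_{jk}\bar\chi_{\bar a},\quad [Q_{ja},f_k]=i\epsilon_{jk}\sigma^\mu_{a\bar b}\partial_\mu\bar\chi^{\bar b},\quad [\bar Q_{j\bar a},f_k]=-i\delta_{jk}\sigma^\mu_{b\bar a}\partial_\mu\psi^b,$$ $$\{Q_{ja},\psi_b\}=-2\epsilon_{ab}f_j,\quad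 \{Q_{ja},\bar\psi_{\bar b}\}=2\epsilon_{jk}\sigma^\mu_{a\bar b}\partial_\mu\phi_k^*,\quad \{Q_{ja},\chi_b\}=2\epsilon_{jk}\epsilon_{ab}f_k^*,\quad \{Q_{ja},\bar\chi_{\bar b}\}=2\sigma^\mu_{a\bar b}\partial_\mu\phi_j,$$ $$i[Z,\phi_j]=f_j,\quad i[Z,f_j]=\partial^2\phi_j,\quad [Z,\psi_a]=i\sigma^\mu_{a\bar b}\partial_\mu\bar\chi^{\bar b},\quad [Z,\chi_a]=-i\sigma^\mu_{a\bar b}\partial_\mu\bar\psi^{\bar b}.$$ Let $m\ge0$. Suppose that, for a hyper-multiplet, the causal brackets of any two of the field components $\phi_j,\phi_j^*,f_j,f_j^*,\psi_a,\bar\psi_{\bar a},\chi_a,\bar\chi_{\bar a}$ (anticommutators of two spinor components, commutators otherwise) are c-numbers of the form $-i\,p(\partial)D_m(x-y)$ with $p$ a polynomial with constant coefficients, and that the $\phi_j$ are free complex scalar fields of mass $m$: $(\partial^2+m^2)\phi_j=0$, $[\phi_j(x),\phi_k(y)]=0$, $[\phi_j(x),\phi_k^*(y)]=-i\delta_{jk}D_m(x-y)$.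 Then there are unique $\alpha\in\mathbb C$ and $\beta\in\mathbb R$ such that $$[f_j(x),f_k^*(y)]=-im^2\delta_{jk}D_m(x-y),\quad [\phi_j(x),f_k(y)]=\alpha\,\epsilon_{jk}D_m(x-y),\quad [\phi_j(x),f_k^*(y)]=\beta\,\delta_{jk}D_m(x-y),$$ $$\{\psi_a(x),\psi_b(y)\}=-2i\alpha\,\epsilon_{ab}D_m(x-y),\quad \{\psi_a(x),\bar\psi_{\bar b}(y)\}=2\sigma^\mu_{a\bar b}\partial_\mu D_m(x-y),$$ $$\{\chi_a(x),\chi_b(y)\}=2i\bar\alpha\,\epsilon_{ab}D_m(x-y),\quad \{\chi_a(x),\bar\chi_{\bar b}(y)\}=2\sigma^\mu_{a\bar b}\partial_\mu D_m(x-y),\quad \{\psi_a(x),\chi_b(y)\}=-2i\beta\,\epsilon_{ab}D_m(x-y),$$ and all other (anti)commutators, i.e. those not obtained from these by exchanging the two fields or by taking adjoints, vanish. Moreover $\alpha$ and $\beta$ are free parameters: for all $\alpha\in\mathbb C$, $\beta\in\mathbb R$ there is such a hyper-multiplet, in a nonzero complex $*$-algebra and with fields linearly independent up to equations of motion, whose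 causal (anti)commutators are the listed ones. -/

import Mathlib

open scoped SchwartzMap
open Complex MeasureTheory

namespace Hyper

noncomputable section

/-! ### Minkowski space, Pauli matrices and the action of `SL(2, ℂ)` -/

/-- Minkowski space-time `ℝ⁴`, with coordinates `x⁰, x¹, x², x³`. -/
abbrev Spacetime : Type := EuclideanSpace ℝ (Fin 4)

/-- Complex Schwartz test functions on space-time. -/
abbrev Test : Type := 𝓢(Spacetime, ℂ)

/-- The diagonal of the Minkowski metric `g = diag (1, -1, -1, -1)`. -/
def metric : Fin 4 → ℝ := ![1, -1, -1, -1]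

/-- The Minkowski product `p · x`. -/
def mink (p x : Spacetime) : ℝ := ∑ μ, metric μ * p μ * x μ

/-- The Pauli matrices `σ^μ`, with `σ⁰ = 1`. -/
def pauli : Fin 4 → Matrix (Fin 2) (Fin 2) ℂ :=
  ![1, !![0, 1; 1, 0], !![0, -I; I, 0], !![1, 0; 0, -1]]

/-- The antisymmetric tensor with lower indices, `ε₁₂ = 1`
(used both for Weyl indices and for the internal `SU(2)` index). -/
def eps (a b : Fin 2) : ℂ := !![0, 1; -1, 0] a b

/-- The antisymmetric tensor with upper Weyl indices, `ε^{ab} = - ε_{ab}`. -/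
def epsUp (a b : Fin 2) : ℂ := - eps a b

/-- The Kronecker symbol. -/
def delta (j k : Fin 2) : ℂ := if j = k then 1 else 0

/-- The hermitian matrix `σ^μ x_μ = x⁰ - σ · x` of a space-time point. -/
def slash (x : Spacetime) : Matrix (Fin 2) (Fin 2) ℂ :=
  ∑ μ, ((metric μ * x μ : ℝ) : ℂ) • pauli μ

/-- The Lorentz transformation `Λ_A` of `A`, characterised by `slash (Λ_A x) = A (slash x) A*`
(see `slash_lorentzFun`). -/
def lorentzFun (A : Matrix (Fin 2) (Fin 2) ℂ) (x : Spacetime) : Spacetime :=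
  WithLp.toLp 2 fun μ => metric μ * ((pauli μ * (A * slash x * A.conjTranspose)).trace.re / 2)

theorem slash_isHermitian (x : Spacetime) : (slash x).conjTranspose = slash x := by
  ext i j
  fin_cases i <;> fin_cases j <;>
    simp [slash, Fin.sum_univ_four, metric, pauli]

theorem slash_of_isHermitian (Y : Matrix (Fin 2) (Fin 2) ℂ) (hY : Y.conjTranspose = Y) :
    slash (WithLp.toLp 2 fun μ => metric μ * ((pauli μ * Y).trace.re / 2)) = Y := by
  have h : ∀ i j, (starRingEnd ℂ) (Y j i) = Y i j := fun i j => by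
    have := congrFun (congrFun hY i) j
    simpa [Matrix.conjTranspose_apply] using this
  have h00 := h 0 0
  have h11 := h 1 1
  have h01 := h 0 1
  rw [Complex.ext_iff] at h00 h11 h01
  simp only [Complex.conj_re, Complex.conj_im] at h00 h11 h01
  ext i j
  fin_cases i <;> fin_cases j <;>
    simp [slash, Fin.sum_univ_four, metric, pauli, Matrix.trace_fin_two, Matrix.mul_apply,
      Fin.sum_univ_two, Complex.ext_iff] <;>
    constructor <;> linarith [h00.2, h11.2, h01.1, h01.2]

theorem slash_lorentzFun (A : Matrix (Fin 2) (Fin 2) ℂ) (x : Spacetime) :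
    slash (lorentzFun A x) = A * slash x * A.conjTranspose := by
  apply slash_of_isHermitian
  simp [Matrix.conjTranspose_mul, slash_isHermitian, Matrix.mul_assoc]

theorem slash_injective : Function.Injective slash := by
  intro x y h
  have e := fun i j => congrFun (congrFun h i) j
  have e00 := e 0 0
  have e11 := e 1 1
  have e01 := e 0 1
  simp [slash, Fin.sum_univ_four, metric, pauli, Complex.ext_iff]
    at e00 e11 e01
  ext μ
  fin_cases μ <;> simp <;> linarith [e01.1, e01.2]

theorem slash_add (x y : Spacetime) : slash (x + y) = slash x + slash y := by
  simp [slash, mul_add, add_smul, Finset.sum_add_distrib]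

theorem slash_smul (c : ℝ) (x : Spacetime) : slash (c • x) = (c : ℂ) • slash x := by
  simp [slash, Finset.smul_sum, smul_smul, mul_left_comm]

/-- `Λ_A` as a linear automorphism of `ℝ⁴`, for `A ∈ SL(2, ℂ)`. -/
def lorentz (A : Matrix.SpecialLinearGroup (Fin 2) ℂ) : Spacetime ≃L[ℝ] Spacetime :=
  LinearEquiv.toContinuousLinearEquiv
    { toFun := lorentzFun A.1
      invFun := lorentzFun (A⁻¹).1
      map_add' := fun x y => slash_injective (by
        simp only [slash_lorentzFun, slash_add, Matrix.mul_add, Matrix.add_mul])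
      map_smul' := fun c x => slash_injective (by
        simp only [slash_lorentzFun, slash_smul, RingHom.id_apply, Matrix.mul_smul,
          Matrix.smul_mul])
      left_inv := fun x => slash_injective (by
        have h : (A⁻¹).1 * A.1 = 1 := congrArg Subtype.val (inv_mul_cancel A)
        have h2 : A.1.conjTranspose * (A⁻¹).1.conjTranspose = 1 := by
          rw [← Matrix.conjTranspose_mul, h, Matrix.conjTranspose_one]
        rw [slash_lorentzFun, slash_lorentzFun,
          show (A⁻¹).1 * (A.1 * slash x * A.1.conjTranspose) * (A⁻¹).1.conjTranspose
            = ((A⁻¹).1 * A.1) * slash x * (A.1.conjTranspose * (A⁻¹).1.conjTranspose) by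
            simp only [Matrix.mul_assoc], h, h2, Matrix.one_mul, Matrix.mul_one])
      right_inv := fun x => slash_injective (by
        have h : A.1 * (A⁻¹).1 = 1 := congrArg Subtype.val (mul_inv_cancel A)
        have h2 : (A⁻¹).1.conjTranspose * A.1.conjTranspose = 1 := by
          rw [← Matrix.conjTranspose_mul, h, Matrix.conjTranspose_one]
        rw [slash_lorentzFun, slash_lorentzFun,
          show A.1 * ((A⁻¹).1 * slash x * (A⁻¹).1.conjTranspose) * A.1.conjTranspose
            = (A.1 * (A⁻¹).1) * slash x * ((A⁻¹).1.conjTranspose * A.1.conjTranspose) by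
            simp only [Matrix.mul_assoc], h, h2, Matrix.one_mul, Matrix.mul_one]) }

/-! ### Test functions and the Pauli–Jordan distribution -/

/-- The partial derivative `∂_μ` of test functions. -/
def pd (μ : Fin 4) : Module.End ℂ Test :=
  (LineDeriv.lineDerivOpCLM ℂ Test
    (EuclideanSpace.single μ (1 : ℝ) : Spacetime)).toLinearMap

/-- The constant-coefficient differential operator `p(∂)` of a polynomial `p`. -/
def diffOp (p : MvPolynomial (Fin 4) ℂ) : Module.End ℂ Test :=
  ∑ s ∈ p.support, p.coeff s • (pd 0 ^ s 0 * pd 1 ^ s 1 * pd 2 ^ s 2 * pd 3 ^ s 3)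

/-- The d'Alembertian `∂² = ∂_μ ∂^μ`. -/
def box : Module.End ℂ Test := ∑ μ, (metric μ : ℂ) • (pd μ * pd μ)

/-- The complex conjugate of a test function. -/
def conjTest (g : Test) : Test :=
  SchwartzMap.postcompCLM (𝕜 := ℝ) (Complex.conjCLE : ℂ →L[ℝ] ℂ) g

/-- The test function `x ↦ g (Λ_A x)`. -/
def lorentzTest (A : Matrix.SpecialLinearGroup (Fin 2) ℂ) (g : Test) : Test :=
  SchwartzMap.compCLMOfContinuousLinearEquiv ℂ (lorentz A) g

/-- The test function `x ↦ g (x + a)`. -/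
def translateTest (a : Spacetime) (g : Test) : Test :=
  SchwartzMap.compSubConstCLM ℂ (-a) g

/-- The energy `√(m² + |k|²)`. -/
def energy (m : ℝ) (k : EuclideanSpace ℝ (Fin 3)) : ℝ := √(m ^ 2 + ‖k‖ ^ 2)

/-- The four-momentum `(√(m² + |k|²), k)` on the upper hyperboloid of mass `m`. -/
def onShell (m : ℝ) (k : EuclideanSpace ℝ (Fin 3)) : Spacetime :=
  WithLp.toLp 2 ![energy m k, k 0, k 1, k 2]

/-- `∫ e^{-i p · x} g(x) dx`. -/
def fourierM (g : Test) (p : Spacetime) : ℂ :=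
  ∫ x : Spacetime, Complex.exp (-I * (mink p x : ℂ)) * g x

/-- The Pauli–Jordan causal distribution of mass `m`,
`D_m(z) = i (2π)⁻³ ∫ (e^{-i k·z} - e^{i k·z}) d³k / (2 ω)` with `k⁰ = ω = √(m² + |k|²)`,
smeared as the kernel `D_m(x - y)` with `g(x) h(y)`. -/
def pauliJordan (m : ℝ) (g h : Test) : ℂ :=
  I / (2 * (Real.pi : ℂ)) ^ 3 *
    ∫ k : EuclideanSpace ℝ (Fin 3), (1 / (2 * (energy m k : ℂ))) *
      (fourierM g (onShell m k) * fourierM h (-onShell m k)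
        - fourierM g (-onShell m k) * fourierM h (onShell m k))

/-- The kernel `(p(∂) D_m)(x - y)` smeared with `g(x) h(y)`. As `∂_μ`, acting on the argument
`x - y`, is `-∂/∂y^μ`, integration by parts turns it into `+∂_μ` acting on `h`. -/
def pauliJordanD (m : ℝ) (p : MvPolynomial (Fin 4) ℂ) (g h : Test) : ℂ :=
  pauliJordan m g (diffOp p h)

/-- The polynomial of the first-order operator `σ^μ_{a ḃ} ∂_μ`. -/
def sigmaD (a b : Fin 2) : MvPolynomial (Fin 4) ℂ :=
  ∑ μ, MvPolynomial.C (pauli μ a b) * MvPolynomial.X μ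

/-! ### Fields as operator-valued distributions

The operators form a complex `*`-algebra `𝒜` (for instance, the operators on a common invariant
dense domain whose adjoints have the same domain); `star` is the adjoint. -/

section Fields

variable {𝒜 : Type*} [Ring 𝒜] [StarRing 𝒜] [Algebra ℂ 𝒜] [StarModule ℂ 𝒜]

/-- The commutator. -/
def comm (x y : 𝒜) : 𝒜 := x * y - y * x

/-- The anticommutator. -/
def acomm (x y : 𝒜) : 𝒜 := x * y + y * x

/-- The adjoint field: `F*(g) = (F(ḡ))*`. -/
def adj (F : Test →ₗ[ℂ] 𝒜) : Test →ₗ[ℂ] 𝒜 where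
  toFun g := star (F (conjTest g))
  map_add' g h := by
    simp [conjTest]
  map_smul' c g := by
    have : conjTest (c • g) = (starRingEnd ℂ c) • conjTest g := by
      ext x
      simp [conjTest]
    simp [this]

/-- The derivative `∂_μ F` of a field: `(∂_μ F)(g) = -F(∂_μ g)`. -/
def fieldD (μ : Fin 4) (F : Test →ₗ[ℂ] 𝒜) : Test →ₗ[ℂ] 𝒜 := -(F ∘ₗ pd μ)

/-- For a spinor field with components `ξ̄_ḃ`, the field `σ^μ_{a ḃ} ∂_μ ξ̄^ḃ`,
where `ξ̄^ḃ = ε^{ḃ ċ} ξ̄_ċ`. -/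
def diracDotted (ξ : Fin 2 → (Test →ₗ[ℂ] 𝒜)) (a : Fin 2) : Test →ₗ[ℂ] 𝒜 :=
  ∑ μ, ∑ b, ∑ c, (pauli μ a b * epsUp b c) • fieldD μ (ξ c)

/-- For a spinor field with components `ξ_b`, the field `σ^μ_{b ȧ} ∂_μ ξ^b`,
where `ξ^b = ε^{b c} ξ_c`. -/
def diracUndotted (ξ : Fin 2 → (Test →ₗ[ℂ] 𝒜)) (a : Fin 2) : Test →ₗ[ℂ] 𝒜 :=
  ∑ μ, ∑ b, ∑ c, (pauli μ b a * epsUp b c) • fieldD μ (ξ c)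

/-- `σ^μ_{a ḃ} ∂_μ F` for a scalar field `F`. -/
def sigmaField (F : Test →ₗ[ℂ] 𝒜) (a b : Fin 2) : Test →ₗ[ℂ] 𝒜 :=
  ∑ μ, pauli μ a b • fieldD μ F

end Fields

/-- The components of the fields of the hyper-multiplet and of their adjoints. -/
inductive Comp : Type
  | phi (j : Fin 2)
  | phiStar (j : Fin 2)
  | f (j : Fin 2)
  | fStar (j : Fin 2)
  | psi (a : Fin 2)
  | psiBar (a : Fin 2)
  | chi (a : Fin 2)
  | chiBar (a : Fin 2)

/-- `true` on the components of half-integer spin. -/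
def Comp.isFermi : Comp → Bool
  | .phi _ => false
  | .phiStar _ => false
  | .f _ => false
  | .fStar _ => false
  | .psi _ => true
  | .psiBar _ => true
  | .chi _ => true
  | .chiBar _ => true

/-- The `N = 2` hyper-multiplet with central charge: fields `φ_j, f_j, ψ_a, χ_a` (operator-valued
distributions), unitary representations of the universal covering group of the Poincaré group
and of `SU(2)`, under which they are covariant, and supercharges `Q_{ja}` with central charge
`Z_{jk} = 2 ε_{jk} Z`, acting on the fields in the prescribed way. -/
structure Multiplet (𝒜 : Type*) [Ring 𝒜] [StarRing 𝒜] [Algebra ℂ 𝒜] [StarModule ℂ 𝒜] where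
  /-- the translations -/
  T : Multiplicative Spacetime →* unitary 𝒜
  /-- the representation of `SL(2, ℂ)` -/
  L : Matrix.SpecialLinearGroup (Fin 2) ℂ →* unitary 𝒜
  /-- the representation of the internal symmetry group `SU(2)` -/
  V : Matrix.specialUnitaryGroup (Fin 2) ℂ →* unitary 𝒜
  /-- the generators of the translations -/
  P : Fin 4 → 𝒜
  /-- the supercharges -/
  Q : Fin 2 → Fin 2 → 𝒜
  /-- the central charge -/
  Z : 𝒜
  /-- the scalar fields `φ_j` -/
  φ : Fin 2 → (Test →ₗ[ℂ] 𝒜)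
  /-- the scalar fields `f_j` -/
  f : Fin 2 → (Test →ₗ[ℂ] 𝒜)
  /-- the spinor field `ψ_a` -/
  ψ : Fin 2 → (Test →ₗ[ℂ] 𝒜)
  /-- the spinor field `χ_a` -/
  χ : Fin 2 → (Test →ₗ[ℂ] 𝒜)
  -- the group representations
  L_T : ∀ A a, L A * T (Multiplicative.ofAdd a) = T (Multiplicative.ofAdd (lorentz A a)) * L A
  V_T : ∀ u a, V u * T a = T a * V u
  V_L : ∀ u A, V u * L A = L A * V u
  -- translation covariance: `T_a⁻¹ F(x) T_a = F(x - a)`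
  T_φ : ∀ a j g, star (T (Multiplicative.ofAdd a) : 𝒜) * φ j g * T (Multiplicative.ofAdd a)
    = φ j (translateTest a g)
  T_f : ∀ a j g, star (T (Multiplicative.ofAdd a) : 𝒜) * f j g * T (Multiplicative.ofAdd a)
    = f j (translateTest a g)
  T_ψ : ∀ a b g, star (T (Multiplicative.ofAdd a) : 𝒜) * ψ b g * T (Multiplicative.ofAdd a)
    = ψ b (translateTest a g)
  T_χ : ∀ a b g, star (T (Multiplicative.ofAdd a) : 𝒜) * χ b g * T (Multiplicative.ofAdd a)
    = χ b (translateTest a g)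
  -- Lorentz covariance: `U_A⁻¹ φ(x) U_A = φ(Λ_A⁻¹ x)`, `U_A⁻¹ ψ_a(x) U_A = A_a^b ψ_b(Λ_A⁻¹ x)`
  L_φ : ∀ A j g, star (L A : 𝒜) * φ j g * L A = φ j (lorentzTest A g)
  L_f : ∀ A j g, star (L A : 𝒜) * f j g * L A = f j (lorentzTest A g)
  L_ψ : ∀ A a g, star (L A : 𝒜) * ψ a g * L A = ∑ b, A.1 a b • ψ b (lorentzTest A g)
  L_χ : ∀ A a g, star (L A : 𝒜) * χ a g * L A = ∑ b, A.1 a b • χ b (lorentzTest A g)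
  -- `SU(2)` covariance
  V_φ : ∀ u j g, star (V u : 𝒜) * φ j g * V u = ∑ k, u.1 j k • φ k g
  V_f : ∀ u j g, star (V u : 𝒜) * f j g * V u = ∑ k, u.1 j k • f k g
  V_ψ : ∀ u a g, star (V u : 𝒜) * ψ a g * V u = ψ a g
  V_χ : ∀ u a g, star (V u : 𝒜) * χ a g * V u = χ a g
  -- `[P_μ, F] = -i ∂_μ F`
  P_star : ∀ μ, star (P μ) = P μ
  P_φ : ∀ μ j g, comm (P μ) (φ j g) = -I • fieldD μ (φ j) g
  P_f : ∀ μ j g, comm (P μ) (f j g) = -I • fieldD μ (f j) g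
  P_ψ : ∀ μ a g, comm (P μ) (ψ a g) = -I • fieldD μ (ψ a) g
  P_χ : ∀ μ a g, comm (P μ) (χ a g) = -I • fieldD μ (χ a) g
  -- the supersymmetry algebra
  Z_star : star Z = Z
  Q_P : ∀ j a μ, comm (Q j a) (P μ) = 0
  L_Q : ∀ A j a, star (L A : 𝒜) * Q j a * L A = ∑ b, A.1 a b • Q j b
  V_Q : ∀ u j a, star (V u : 𝒜) * Q j a * V u = ∑ k, u.1 j k • Q k a
  Q_Q : ∀ j k a b, acomm (Q j a) (Q k b) = (2 * eps a b * eps j k) • Z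
  Q_Qbar : ∀ j k a b, acomm (Q j a) (star (Q k b)) = (2 * delta j k) • ∑ μ, pauli μ a b • P μ
  Z_Q : ∀ j a, comm Z (Q j a) = 0
  -- the action of the supercharges on the fields
  Q_φ : ∀ j a k g, I • comm (Q j a) (φ k g) = eps j k • ψ a g
  Qbar_φ : ∀ j a k g, I • comm (star (Q j a)) (φ k g) = delta j k • adj (χ a) g
  Q_f : ∀ j a k g, comm (Q j a) (f k g)
    = (I * eps j k) • diracDotted (fun b => adj (χ b)) a g
  Qbar_f : ∀ j a k g, comm (star (Q j a)) (f k g) = (-I * delta j k) • diracUndotted ψ a g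
  Q_ψ : ∀ j a b g, acomm (Q j a) (ψ b g) = (-2 * eps a b) • f j g
  Q_ψbar : ∀ j a b g, acomm (Q j a) (adj (ψ b) g)
    = (2 : ℂ) • ∑ k, eps j k • sigmaField (adj (φ k)) a b g
  Q_χ : ∀ j a b g, acomm (Q j a) (χ b g) = (2 * eps a b) • ∑ k, eps j k • adj (f k) g
  Q_χbar : ∀ j a b g, acomm (Q j a) (adj (χ b) g) = (2 : ℂ) • sigmaField (φ j) a b g
  -- the action of the central charge on the fields
  Z_φ : ∀ j g, I • comm Z (φ j g) = f j g
  Z_f : ∀ j g, I • comm Z (f j g) = φ j (box g)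
  Z_ψ : ∀ a g, comm Z (ψ a g) = I • diracDotted (fun b => adj (χ b)) a g
  Z_χ : ∀ a g, comm Z (χ a g) = -I • diracDotted (fun b => adj (ψ b)) a g

namespace Multiplet

variable {𝒜 : Type*} [Ring 𝒜] [StarRing 𝒜] [Algebra ℂ 𝒜] [StarModule ℂ 𝒜]

/-- The field with the given component. -/
def field (M : Multiplet 𝒜) : Comp → (Test →ₗ[ℂ] 𝒜)
  | .phi j => M.φ j
  | .phiStar j => adj (M.φ j)
  | .f j => M.f j
  | .fStar j => adj (M.f j)
  | .psi a => M.ψ a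
  | .psiBar a => adj (M.ψ a)
  | .chi a => M.χ a
  | .chiBar a => adj (M.χ a)

/-- The causal (anti)commutator of two field components: the anticommutator if both are
of half-integer spin, and the commutator otherwise. -/
def causal (M : Multiplet 𝒜) (X Y : Comp) (g h : Test) : 𝒜 :=
  if X.isFermi && Y.isFermi then acomm (M.field X g) (M.field Y h)
  else comm (M.field X g) (M.field Y h)

/-- The fields are free fields of mass `m`: every causal (anti)commutator is a c-number of the form
`-i p(∂) D_m(x - y)`, with a polynomial `p` with constant coefficients. -/
def HasCausalBrackets (M : Multiplet 𝒜) (m : ℝ) : Prop :=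
  ∀ X Y : Comp, ∃ p : MvPolynomial (Fin 4) ℂ, ∀ g h : Test,
    M.causal X Y g h = (-I * pauliJordanD m p g h) • (1 : 𝒜)

/-- The `φ_j` are free complex scalar fields of mass `m`: they satisfy the Klein–Gordon equation
and `[φ_j(x), φ_k(y)] = 0`, `[φ_j(x), φ_k*(y)] = -i δ_{jk} D_m(x - y)`. -/
structure FreeScalars (M : Multiplet 𝒜) (m : ℝ) : Prop where
  kleinGordon : ∀ j g, M.φ j (box g + ((m : ℂ) ^ 2) • g) = 0
  phi_phi : ∀ j k g h, comm (M.φ j g) (M.φ k h) = 0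
  phi_phiStar : ∀ j k g h,
    comm (M.φ j g) (adj (M.φ k) h) = (-I * delta j k * pauliJordan m g h) • (1 : 𝒜)

/-- The fields are linearly independent up to equations of motion, and equations of motion do not
connect distinct fields: a relation `∑ p_X(∂) X = 0` holds only if each of its terms is zero. -/
def Independent (M : Multiplet 𝒜) : Prop :=
  ∀ (s : Finset Comp) (p : Comp → MvPolynomial (Fin 4) ℂ),
    (∀ g : Test, ∑ X ∈ s, M.field X (diffOp (p X) g) = 0) →
      ∀ X ∈ s, ∀ g : Test, M.field X (diffOp (p X) g) = 0

/-- The list of the causal (anti)commutators with parameters `α`, `β`, besides those of the `φ_j`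
and `φ_j*` with one another. All those that are not in the list and do not come from it by
exchanging the two fields or by taking adjoints are zero (the last three entries and those of the
`φ_j`). -/
structure CausalRelations (M : Multiplet 𝒜) (m : ℝ) (α : ℂ) (β : ℝ) : Prop where
  f_fStar : ∀ j k g h,
    comm (M.f j g) (adj (M.f k) h) = (-I * (m : ℂ) ^ 2 * delta j k * pauliJordan m g h) • (1 : 𝒜)
  phi_f : ∀ j k g h,
    comm (M.φ j g) (M.f k h) = (α * eps j k * pauliJordan m g h) • (1 : 𝒜)
  phi_fStar : ∀ j k g h,
    comm (M.φ j g) (adj (M.f k) h) = ((β : ℂ) * delta j k * pauliJordan m g h) • (1 : 𝒜)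
  psi_psi : ∀ a b g h,
    acomm (M.ψ a g) (M.ψ b h) = (-2 * I * α * eps a b * pauliJordan m g h) • (1 : 𝒜)
  psi_psiBar : ∀ a b g h,
    acomm (M.ψ a g) (adj (M.ψ b) h) = (2 * pauliJordanD m (sigmaD a b) g h) • (1 : 𝒜)
  chi_chi : ∀ a b g h, acomm (M.χ a g) (M.χ b h)
    = (2 * I * (starRingEnd ℂ) α * eps a b * pauliJordan m g h) • (1 : 𝒜)
  chi_chiBar : ∀ a b g h,
    acomm (M.χ a g) (adj (M.χ b) h) = (2 * pauliJordanD m (sigmaD a b) g h) • (1 : 𝒜)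
  psi_chi : ∀ a b g h,
    acomm (M.ψ a g) (M.χ b h) = (-2 * I * (β : ℂ) * eps a b * pauliJordan m g h) • (1 : 𝒜)
  f_f : ∀ j k g h, comm (M.f j g) (M.f k h) = 0
  psi_chiBar : ∀ a b g h, acomm (M.ψ a g) (adj (M.χ b) h) = 0
  bose_fermi : ∀ X Y : Comp, X.isFermi = false → Y.isFermi = true →
    ∀ g h, comm (M.field X g) (M.field Y h) = 0

end Multiplet

end

end Hyper

/-! Uniqueness rests on Ward identities. Let a supercharge act on a Bose-Fermi commutator, or `Z` on
a Bose-Bose commutator. The result is zero: c-numbers commute with `Z`, and Bose-Fermi commutators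
vanish because `-1 ∈ SL(2, ℂ)` fixes every point of space-time and changes the sign of the fermions
(`bose_fermi_eq_zero`). The super-Jacobi identity then expresses the brackets of the fermions, and
those of the `f_j`, linearly by `[φ, φ]`, `[φ, φ*]`, `[φ, f]` and `[φ, f*]`. The first two are
given. The last two are Lorentz invariant kernels `p(∂) D_m`, hence multiples of `D_m`
(`diffOp_pauliJordan_of_invariant`): the symbol of `p` is constant on each sheet of the mass shell
by transitivity, and both constants agree since a polynomial is continued along a rational curve
from one sheet to the other. The fermionic brackets `{ψ, ψ}` and `{ψ, χ}` carry no `SU(2)` index, so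
the Ward identities leave a single number for each of the two families, `α` and `β`. Reality of `β`
follows from letting `Z` act on `[φ, φ*]` and taking adjoints. Uniqueness of the parameters is `D_m
≠ 0`.

Existence is a Fock construction without an inner product. Test functions modulo the radical of
`D_m` form the symplectic space `ShellSpace`. Eight copies of it, one for each component of `φ_j,
f_j, ψ_a, χ̄_a`, carry the supersymmetry algebra (`qOp_qOp`, `qOp_qbarOp`, `qbarOp_qbarOp`) and an
invariant graded antisymmetric form `cForm`. The natural conjugation `theta` squares to `-1`, so a
real structure `conj` needs two such multiplets, the second one holding the adjoint fields. The
central charge `zOp` commutes with every symmetry and is skew for `cForm`; therefore the form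
`bForm`, whose entries between the two copies are `α`, `β ± zOp` and `-ᾱ`, is invariant whatever `α`
and `β` are (`skew_diag`). The term with `zOp` produces `[φ, φ*]`, and the constants produce the
free parameters.

On the free graded commutative algebra over the one-particle space, creation plus half an
annihilation operator realizes this form as a graded commutator (`op_bracket`), invariant operators
act as graded derivations (`secondQuant_op`), and group elements as automorphisms (`map_op`). The
adjoint comes from the product of the operator algebra with its opposite, where `star` exchanges the
factors. No positivity enters, and so the parameters remain unrestricted. Independence holds because
fields applied to the vacuum give back their one-particle vectors, which lie in different slots. -/

namespace Hyper

open scoped FourierTransform LineDeriv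

/-! ### The Fourier transform of test functions -/

/-- The wave vector at which Mathlib's Fourier transform has to be evaluated. -/
noncomputable def waveVector (p : Spacetime) : Spacetime :=
  WithLp.toLp 2 fun μ => metric μ * p μ / (2 * Real.pi)

theorem metric_mul_self (μ : Fin 4) : metric μ * metric μ = 1 := by
  fin_cases μ <;> simp [metric]

theorem inner_waveVector (x p : Spacetime) :
    inner ℝ x (waveVector p) = mink p x / (2 * Real.pi) := by
  simp [PiLp.inner_apply, waveVector, mink, Finset.sum_div]
  exact Finset.sum_congr rfl fun μ _ => by ring

/-- The signs of the metric and the factor `2π` of Mathlib's kernel are absorbed in `waveVector`.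
This makes the theory of `𝓕` on Schwartz functions available for the Minkowski transform. -/
theorem fourierM_eq_fourier (g : Test) (p : Spacetime) :
    fourierM g p = 𝓕 g (waveVector p) := by
  rw [SchwartzMap.fourier_coe, Real.fourier_eq']
  refine integral_congr_ae (Filter.Eventually.of_forall fun x => ?_)
  simp only [inner_waveVector, smul_eq_mul]
  congr 2
  push_cast
  have : (Real.pi : ℂ) ≠ 0 := by exact_mod_cast Real.pi_ne_zero
  field_simp

theorem fourierM_add (g h : Test) (p : Spacetime) :
    fourierM (g + h) p = fourierM g p + fourierM h p := by
  simp [fourierM_eq_fourier, FourierTransform.fourier_add]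

theorem fourierM_smul (c : ℂ) (g : Test) (p : Spacetime) :
    fourierM (c • g) p = c * fourierM g p := by
  simp [fourierM_eq_fourier, FourierTransform.fourier_smul]

/-- The Fourier transform at a fixed momentum, as a linear functional. -/
noncomputable def fourierMLin (p : Spacetime) : Test →ₗ[ℂ] ℂ where
  toFun g := fourierM g p
  map_add' g h := fourierM_add g h p
  map_smul' c g := fourierM_smul c g p

theorem fourier_pd (μ : Fin 4) (g : Test) (w : Spacetime) :
    𝓕 (pd μ g) w = 2 * Real.pi * I * w μ * 𝓕 g w := by
  have h : pd μ g = ∂_{(EuclideanSpace.single μ (1 : ℝ) : Spacetime)} g := rfl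
  have ht : (fun x : Spacetime => inner ℝ x
      (EuclideanSpace.single μ (1 : ℝ) : Spacetime)).HasTemperateGrowth :=
    Function.hasTemperateGrowth_inner_left _
  have h2 := SchwartzMap.smulLeftCLM_apply_apply (F := ℂ) ht (𝓕 g : Test) w
  rw [h, SchwartzMap.fourier_lineDerivOp_eq, smul_apply, h2, EuclideanSpace.inner_single_right]
  simp [mul_assoc]

theorem fourierM_pd (μ : Fin 4) (g : Test) (p : Spacetime) :
    fourierM (pd μ g) p = (I * metric μ * p μ) * fourierM g p := by
  have hp : (2 * Real.pi : ℂ) ≠ 0 := by exact_mod_cast Real.two_pi_pos.ne'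
  have h : (2 * Real.pi : ℂ) * ((waveVector p μ : ℝ) : ℂ) = metric μ * p μ := by
    rw [waveVector]
    push_cast
    exact mul_div_cancel₀ _ hp
  rw [fourierM_eq_fourier, fourierM_eq_fourier, fourier_pd]
  linear_combination (I * 𝓕 g (waveVector p)) * h

theorem fourierM_pd_pow (μ : Fin 4) (n : ℕ) (g : Test) (p : Spacetime) :
    fourierM ((pd μ ^ n) g) p = (I * metric μ * p μ) ^ n * fourierM g p := by
  induction n with
  | zero => simp
  | succ n ih => rw [pow_succ', Module.End.mul_apply, fourierM_pd, ih, pow_succ']; ring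

/-- The symbol of `p(∂)`: the value of `p` at `∂_μ = i p_μ`. -/
noncomputable def symbol (q : MvPolynomial (Fin 4) ℂ) (p : Spacetime) : ℂ :=
  MvPolynomial.eval (fun μ => I * metric μ * p μ) q

theorem fourierM_diffOp (q : MvPolynomial (Fin 4) ℂ) (g : Test) (p : Spacetime) :
    fourierM (diffOp q g) p = symbol q p * fourierM g p := by
  change fourierMLin p _ = _
  rw [diffOp, LinearMap.sum_apply, map_sum, symbol, MvPolynomial.eval_eq, Finset.sum_mul]
  refine Finset.sum_congr rfl fun s _ => ?_
  rw [LinearMap.smul_apply, map_smul]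
  simp only [Module.End.mul_apply]
  change _ * fourierM _ p = _
  rw [fourierM_pd_pow, fourierM_pd_pow, fourierM_pd_pow, fourierM_pd_pow, ← Finsupp.prod,
    Finsupp.prod_fintype _ _ (fun _ => pow_zero _), Fin.prod_univ_four]
  ring

theorem symbol_add (q r : MvPolynomial (Fin 4) ℂ) (p : Spacetime) :
    symbol (q + r) p = symbol q p + symbol r p := by simp [symbol]

theorem symbol_mul (q r : MvPolynomial (Fin 4) ℂ) (p : Spacetime) :
    symbol (q * r) p = symbol q p * symbol r p := by simp [symbol]

theorem symbol_C (c : ℂ) (p : Spacetime) : symbol (MvPolynomial.C c) p = c := by simp [symbol]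

theorem symbol_X (μ : Fin 4) (p : Spacetime) :
    symbol (MvPolynomial.X μ) p = I * metric μ * p μ := by simp [symbol]

/-- The standard device below: identities between differential operators on test functions are
reduced to identities between their symbols. -/
theorem fourierM_injective {g h : Test} (H : ∀ p, fourierM g p = fourierM h p) : g = h := by
  have : (𝓕 g : Test) = 𝓕 h := by
    ext w
    have hw : w = waveVector (WithLp.toLp 2 fun μ => metric μ * w μ * (2 * Real.pi)) := by
      ext μ
      have := metric_mul_self μ
      have hp := Real.pi_ne_zero
      simp only [waveVector]
      field_simp
      rw [sq, this, mul_one]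
    rw [hw, ← fourierM_eq_fourier, ← fourierM_eq_fourier, H]
  have h2 := congrArg (fun u : Test => (𝓕⁻ u : Test)) this
  simpa [FourierTransform.fourierInv_fourier_eq] using h2

theorem diffOp_add (q r : MvPolynomial (Fin 4) ℂ) (g : Test) :
    diffOp (q + r) g = diffOp q g + diffOp r g :=
  fourierM_injective fun p => by
    rw [fourierM_add, fourierM_diffOp, fourierM_diffOp, fourierM_diffOp, symbol_add, add_mul]

theorem diffOp_mul (q r : MvPolynomial (Fin 4) ℂ) (g : Test) :
    diffOp (q * r) g = diffOp q (diffOp r g) :=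
  fourierM_injective fun p => by
    rw [fourierM_diffOp, fourierM_diffOp, fourierM_diffOp, symbol_mul, mul_assoc]

theorem diffOp_C (c : ℂ) (g : Test) : diffOp (MvPolynomial.C c) g = c • g :=
  fourierM_injective fun p => by rw [fourierM_diffOp, symbol_C, fourierM_smul]

theorem pd_comm (μ ν : Fin 4) (g : Test) : pd μ (pd ν g) = pd ν (pd μ g) :=
  fourierM_injective fun p => by simp only [fourierM_pd]; ring

theorem fourierM_sum {ι : Type*} (s : Finset ι) (g : ι → Test) (p : Spacetime) :
    fourierM (∑ i ∈ s, g i) p = ∑ i ∈ s, fourierM (g i) p := map_sum (fourierMLin p) g s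

theorem fourierM_box (g : Test) (p : Spacetime) :
    fourierM (box g) p = -(mink p p : ℂ) * fourierM g p := by
  rw [box, LinearMap.sum_apply, fourierM_sum]
  simp only [LinearMap.smul_apply, Module.End.mul_apply, fourierM_smul, fourierM_pd, mink,
    Fin.sum_univ_four]
  simp [metric]
  ring_nf
  simp only [I_sq]
  ring

/-! ### Conjugation, translation and decay of test functions in momentum space -/

theorem conjTest_apply (g : Test) (x : Spacetime) : conjTest g x = (starRingEnd ℂ) (g x) := rfl

theorem conjTest_conjTest (g : Test) : conjTest (conjTest g) = g := by
  ext x; simp [conjTest_apply]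

theorem conjTest_add (g h : Test) : conjTest (g + h) = conjTest g + conjTest h := by
  ext x; simp [conjTest_apply]

theorem conjTest_smul (c : ℂ) (g : Test) :
    conjTest (c • g) = (starRingEnd ℂ) c • conjTest g := by
  ext x; simp [conjTest_apply]

theorem mink_neg_left (p x : Spacetime) : mink (-p) x = -mink p x := by
  simp [mink]

theorem fourierM_conjTest (g : Test) (p : Spacetime) :
    fourierM (conjTest g) p = (starRingEnd ℂ) (fourierM g (-p)) := by
  rw [fourierM, fourierM, ← integral_conj]
  refine integral_congr_ae (Filter.Eventually.of_forall fun x => ?_)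
  simp [conjTest_apply, ← exp_conj, mink_neg_left]

theorem conjTest_pd (μ : Fin 4) (g : Test) : conjTest (pd μ g) = pd μ (conjTest g) :=
  fourierM_injective fun p => by
    simp [fourierM_conjTest, fourierM_pd]

theorem fourierM_translateTest (a : Spacetime) (g : Test) (p : Spacetime) :
    fourierM (translateTest a g) p = exp (I * (mink p a : ℂ)) * fourierM g p := by
  have h : ∀ x : Spacetime, exp (-I * (mink p x : ℂ)) * translateTest a g x
      = exp (I * (mink p a : ℂ)) * (exp (-I * (mink p (x + a) : ℂ)) * g (x + a)) := by
    intro x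
    have e : translateTest a g x = g (x + a) := by
      simp [translateTest]
    have e2 : mink p (x + a) = mink p x + mink p a := by
      simp [mink, mul_add, Finset.sum_add_distrib]
    rw [e, ← mul_assoc, ← exp_add, e2]
    congr 2
    push_cast
    ring
  rw [fourierM, integral_congr_ae (Filter.Eventually.of_forall h), integral_const_mul,
    integral_add_right_eq_self (fun x : Spacetime => exp (-I * (mink p x : ℂ)) * g x) a]
  rfl

theorem continuous_waveVector : Continuous waveVector := by
  unfold waveVector
  fun_prop

theorem continuous_fourierM (g : Test) : Continuous (fourierM g) := by
  have : fourierM g = fun p => 𝓕 g (waveVector p) := funext (fourierM_eq_fourier g)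
  rw [this]
  exact (𝓕 g : Test).continuous.comp continuous_waveVector

theorem norm_waveVector (p : Spacetime) : ‖waveVector p‖ = ‖p‖ / (2 * Real.pi) := by
  have h : (2 * Real.pi) ≠ 0 := by positivity
  rw [EuclideanSpace.norm_eq, EuclideanSpace.norm_eq, eq_div_iff h]
  rw [show √(∑ i, ‖(waveVector p).ofLp i‖ ^ 2) * (2 * Real.pi)
      = √(∑ i, ‖(waveVector p).ofLp i‖ ^ 2) * √((2 * Real.pi) ^ 2) by
    rw [Real.sqrt_sq (by positivity)], ← Real.sqrt_mul (by positivity), Finset.sum_mul]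
  congr 1
  refine Finset.sum_congr rfl fun μ _ => ?_
  have := metric_mul_self μ
  simp only [waveVector, Real.norm_eq_abs, sq_abs]
  field_simp
  rw [sq (metric μ), this, one_mul]

/-- Decay of order `4`, enough for integrals over the mass shell. -/
def ShellDecay (H : Spacetime → ℂ) : Prop :=
  ∃ C : ℝ, ∀ p, (1 + ‖p‖) ^ 4 * ‖H p‖ ≤ C

theorem shellDecay_fourierM (g : Test) : ShellDecay (fourierM g) := by
  set c : ℝ := 2 ^ 4 * ((Finset.Iic ((4 : ℕ), (0 : ℕ))).sup
    fun m => SchwartzMap.seminorm ℂ m.1 m.2) (𝓕 g : Test)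
  refine ⟨(2 * Real.pi) ^ 4 * c, fun p => ?_⟩
  have h := SchwartzMap.one_add_le_sup_seminorm_apply (𝕜 := ℂ) (m := (4, 0)) (k := 4) (n := 0)
    le_rfl le_rfl (𝓕 g : Test) (waveVector p)
  rw [norm_iteratedFDeriv_zero, norm_waveVector] at h
  rw [fourierM_eq_fourier]
  have hp : 1 + ‖p‖ ≤ 2 * Real.pi * (1 + ‖p‖ / (2 * Real.pi)) := by
    have h3 := Real.pi_gt_three
    have : 2 * Real.pi * (‖p‖ / (2 * Real.pi)) = ‖p‖ := by field_simp
    rw [mul_add, this]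
    linarith
  calc (1 + ‖p‖) ^ 4 * ‖(𝓕 g : Test) (waveVector p)‖
      ≤ (2 * Real.pi * (1 + ‖p‖ / (2 * Real.pi))) ^ 4 * ‖(𝓕 g : Test) (waveVector p)‖ := by
        gcongr
    _ = (2 * Real.pi) ^ 4 * ((1 + ‖p‖ / (2 * Real.pi)) ^ 4 *
          ‖(𝓕 g : Test) (waveVector p)‖) := by rw [mul_pow]; ring
    _ ≤ _ := by gcongr

theorem ShellDecay.neg {H : Spacetime → ℂ} (h : ShellDecay H) :
    ShellDecay fun p => H (-p) := by
  obtain ⟨C, hC⟩ := h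
  exact ⟨C, fun p => by simpa using hC (-p)⟩

theorem ShellDecay.mul {H K : Spacetime → ℂ} (h : ShellDecay H) (k : ShellDecay K) :
    ShellDecay fun p => H p * K p := by
  obtain ⟨C, hC⟩ := h
  obtain ⟨C', hC'⟩ := k
  refine ⟨C * C', fun p => ?_⟩
  have h1 : ‖K p‖ ≤ C' := by
    refine le_trans ?_ (hC' p)
    exact le_mul_of_one_le_left (norm_nonneg _) (one_le_pow₀ (by linarith [norm_nonneg p]))
  rw [norm_mul, ← mul_assoc]
  exact mul_le_mul (hC p) h1 (norm_nonneg _) (le_trans (by positivity) (hC p))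

/-! ### Integrals over the mass shell -/

theorem continuous_energy (m : ℝ) : Continuous (energy m) := by
  unfold energy
  fun_prop

theorem continuous_onShell (m : ℝ) : Continuous (onShell m) := by
  unfold onShell
  have := continuous_energy m
  refine (PiLp.continuous_toLp 2 _).comp (continuous_pi fun μ => ?_)
  fin_cases μ
  · simpa using this
  all_goals
    simp
    fun_prop

theorem norm_le_energy (m : ℝ) (k : EuclideanSpace ℝ (Fin 3)) : ‖k‖ ≤ energy m k :=
  Real.le_sqrt_of_sq_le (by nlinarith [sq_nonneg m])

theorem energy_nonneg (m : ℝ) (k : EuclideanSpace ℝ (Fin 3)) : 0 ≤ energy m k :=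
  Real.sqrt_nonneg _

theorem energy_sq (m : ℝ) (k : EuclideanSpace ℝ (Fin 3)) :
    energy m k ^ 2 = m ^ 2 + ‖k‖ ^ 2 := Real.sq_sqrt (by positivity)

theorem norm_sq_three (k : EuclideanSpace ℝ (Fin 3)) :
    ‖k‖ ^ 2 = k 0 ^ 2 + k 1 ^ 2 + k 2 ^ 2 := by
  rw [EuclideanSpace.norm_sq_eq, Fin.sum_univ_three]
  simp

theorem norm_le_onShell (m : ℝ) (k : EuclideanSpace ℝ (Fin 3)) : ‖k‖ ≤ ‖onShell m k‖ := by
  refine le_of_sq_le_sq ?_ (norm_nonneg _)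
  rw [norm_sq_three, EuclideanSpace.norm_sq_eq, Fin.sum_univ_four]
  simp [onShell]
  nlinarith [sq_nonneg (energy m k)]

theorem mink_onShell (m : ℝ) (k : EuclideanSpace ℝ (Fin 3)) :
    mink (onShell m k) (onShell m k) = m ^ 2 := by
  have h := energy_sq m k
  rw [norm_sq_three] at h
  simp [mink, Fin.sum_univ_four, metric, onShell]
  nlinarith

/-- The integral over the upper mass shell with the measure `d³k / (2 ω)`. -/
noncomputable def shellInt (m : ℝ) (H : Spacetime → ℂ) : ℂ :=
  ∫ k : EuclideanSpace ℝ (Fin 3), (1 / (2 * (energy m k : ℂ))) * H (onShell m k)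

/-- In polar coordinates the weight `r ^ 2` cancels the singularity `1 / r`, and `r / (1 + r) ^ 4 ≤
(1 + r) ^ (-2)`. This function dominates the integrands on the shell for every mass, so the singular
weight of the massless case needs no separate treatment. -/
theorem integrable_inv_norm_mul :
    Integrable fun k : EuclideanSpace ℝ (Fin 3) => ‖k‖⁻¹ * ((1 + ‖k‖) ^ 4)⁻¹ := by
  rw [integrable_fun_norm_addHaar (volume : Measure (EuclideanSpace ℝ (Fin 3)))
    (f := fun r => r⁻¹ * ((1 + r) ^ 4)⁻¹)]
  have h1 : IntegrableOn (fun r : ℝ => (1 + ‖r‖) ^ (-(2 : ℝ))) (Set.Ioi 0) :=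
    (integrable_one_add_norm (E := ℝ) (μ := volume) (r := 2) (by simp)).integrableOn
  refine Integrable.mono' h1 ?_ ?_
  · refine AEStronglyMeasurable.restrict ?_
    exact Measurable.aestronglyMeasurable (by fun_prop)
  · refine (ae_restrict_iff' measurableSet_Ioi).2 (Filter.Eventually.of_forall fun r hr => ?_)
    have hr : 0 < r := hr
    simp only [finrank_euclideanSpace, Fintype.card_fin, Real.norm_eq_abs, abs_of_pos hr]
    rw [Real.rpow_neg (by positivity), show (2 : ℝ) = ((2 : ℕ) : ℝ) by norm_num,
      Real.rpow_natCast]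
    rw [abs_of_nonneg (by positivity), smul_eq_mul]
    have h : r ^ (3 - 1) * (r⁻¹ * ((1 + r) ^ 4)⁻¹) = r / (1 + r) ^ 4 := by
      norm_num
      field_simp
    rw [h, div_le_iff₀ (by positivity)]
    have : ((1 + r) ^ 2)⁻¹ * (1 + r) ^ 4 = (1 + r) ^ 2 := by field_simp
    rw [this]
    nlinarith

/-- Since `ω ≥ |k|`, the weight is at most `1 / |k|` away from the null set `k = 0`, and decay of
order `4` in the four-momentum gives the same decay in `k`. -/
theorem integrable_shell (m : ℝ) {H : Spacetime → ℂ} (hc : Continuous H) (hd : ShellDecay H) :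
    Integrable fun k : EuclideanSpace ℝ (Fin 3) =>
      (1 / (2 * (energy m k : ℂ))) * H (onShell m k) := by
  obtain ⟨C, hC⟩ := hd
  refine Integrable.mono' (integrable_inv_norm_mul.const_mul C) ?_ ?_
  · refine Measurable.aestronglyMeasurable ?_
    have h1 := (continuous_energy m).measurable
    have h2 := (hc.comp (continuous_onShell m)).measurable
    refine Measurable.mul ?_ h2
    fun_prop
  · have hne : ∀ᵐ k : EuclideanSpace ℝ (Fin 3), k ≠ 0 := by
      simp [ae_iff]
    filter_upwards [hne] with k hk
    have hk : 0 < ‖k‖ := norm_pos_iff.2 hk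
    have hω := norm_le_energy m k
    have h1 := hC (onShell m k)
    have h2 := norm_le_onShell m k
    have h3 : ‖H (onShell m k)‖ ≤ C * ((1 + ‖k‖) ^ 4)⁻¹ := by
      rw [← div_eq_mul_inv, le_div_iff₀ (by positivity), mul_comm]
      refine le_trans ?_ h1
      gcongr
    have h0 : 0 ≤ C := le_trans (by positivity) h1
    have h4 : ‖(1 / (2 * (energy m k : ℂ)))‖ ≤ ‖k‖⁻¹ := by
      rw [norm_div, norm_mul, norm_real, Real.norm_eq_abs, abs_of_nonneg (energy_nonneg m k)]
      simp only [norm_one, norm_ofNat, one_div]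
      gcongr
      linarith
    calc ‖(1 / (2 * (energy m k : ℂ))) * H (onShell m k)‖
        ≤ ‖k‖⁻¹ * (C * ((1 + ‖k‖) ^ 4)⁻¹) := by
          rw [norm_mul]
          gcongr
      _ = _ := by ring

theorem integrable_shell_fourierM (m : ℝ) (g h : Test) :
    Integrable fun k : EuclideanSpace ℝ (Fin 3) => (1 / (2 * (energy m k : ℂ))) *
      (fourierM g (onShell m k) * fourierM h (-onShell m k)) :=
  integrable_shell m (H := fun p => fourierM g p * fourierM h (-p))
    ((continuous_fourierM g).mul ((continuous_fourierM h).comp continuous_neg))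
    ((shellDecay_fourierM g).mul (shellDecay_fourierM h).neg)

/-! ### The Pauli–Jordan distribution as a bilinear form -/

/-- The positive-frequency two-point function, up to a factor. -/
noncomputable def wightman (m : ℝ) (g h : Test) : ℂ :=
  shellInt m fun p => fourierM g p * fourierM h (-p)

/-- The integral may be split because each frequency part converges separately. Bilinearity and
antisymmetry become visible in this form. -/
theorem pauliJordan_eq (m : ℝ) (g h : Test) :
    pauliJordan m g h = I / (2 * (Real.pi : ℂ)) ^ 3 * (wightman m g h - wightman m h g) := by
  rw [pauliJordan, wightman, wightman, shellInt, shellInt,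
    ← integral_sub (integrable_shell_fourierM m g h) (integrable_shell_fourierM m h g)]
  congr 2
  ext k
  ring

theorem wightman_add_left (m : ℝ) (g g' h : Test) :
    wightman m (g + g') h = wightman m g h + wightman m g' h := by
  rw [wightman, wightman, wightman, shellInt, shellInt, shellInt,
    ← integral_add (integrable_shell_fourierM m g h) (integrable_shell_fourierM m g' h)]
  congr 1
  ext k
  rw [fourierM_add]
  ring

theorem wightman_add_right (m : ℝ) (g h h' : Test) :
    wightman m g (h + h') = wightman m g h + wightman m g h' := by
  rw [wightman, wightman, wightman, shellInt, shellInt, shellInt,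
    ← integral_add (integrable_shell_fourierM m g h) (integrable_shell_fourierM m g h')]
  congr 1
  ext k
  rw [fourierM_add]
  ring

theorem wightman_smul_left (m : ℝ) (c : ℂ) (g h : Test) :
    wightman m (c • g) h = c * wightman m g h := by
  rw [wightman, wightman, shellInt, shellInt, ← integral_const_mul]
  congr 1
  ext k
  rw [fourierM_smul]
  ring

theorem wightman_smul_right (m : ℝ) (c : ℂ) (g h : Test) :
    wightman m g (c • h) = c * wightman m g h := by
  rw [wightman, wightman, shellInt, shellInt, ← integral_const_mul]
  congr 1
  ext k
  rw [fourierM_smul]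
  ring

/-- The Pauli–Jordan distribution as a bilinear form on test functions. -/
noncomputable def pjForm (m : ℝ) : Test →ₗ[ℂ] Test →ₗ[ℂ] ℂ :=
  LinearMap.mk₂ ℂ (pauliJordan m)
    (fun g g' h => by
      simp only [pauliJordan_eq, wightman_add_left, wightman_add_right]; ring)
    (fun c g h => by
      simp only [pauliJordan_eq, wightman_smul_left, wightman_smul_right, smul_eq_mul]; ring)
    (fun g h h' => by
      simp only [pauliJordan_eq, wightman_add_left, wightman_add_right]; ring)
    (fun c g h => by
      simp only [pauliJordan_eq, wightman_smul_left, wightman_smul_right, smul_eq_mul]; ring)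

theorem pjForm_apply (m : ℝ) (g h : Test) : pjForm m g h = pauliJordan m g h := rfl

theorem pauliJordan_antisymm (m : ℝ) (g h : Test) :
    pauliJordan m g h = -pauliJordan m h g := by
  rw [pauliJordan_eq, pauliJordan_eq]; ring

/-- Two pairs of test functions with equal products of Fourier transforms on the mass shell have
the same Pauli–Jordan pairing. -/
theorem pauliJordan_congr (m : ℝ) {g h g' h' : Test}
    (H : ∀ p, mink p p = m ^ 2 →
      fourierM g p * fourierM h (-p) = fourierM g' p * fourierM h' (-p)) :
    pauliJordan m g h = pauliJordan m g' h' := by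
  unfold pauliJordan
  congr 2
  ext k
  have h1 := H (onShell m k) (mink_onShell m k)
  have h2 := H (-onShell m k) (by
    rw [mink_neg_left]
    have : ∀ p x : Spacetime, mink p (-x) = -mink p x := fun p x => by simp [mink]
    rw [this, neg_neg, mink_onShell])
  rw [neg_neg] at h2
  rw [h1, h2]

theorem pauliJordan_pd_left (m : ℝ) (μ : Fin 4) (g h : Test) :
    pauliJordan m (pd μ g) h = -pauliJordan m g (pd μ h) := by
  have : -pauliJordan m g (pd μ h) = pauliJordan m g ((-1 : ℂ) • pd μ h) := by
    rw [← pjForm_apply, ← pjForm_apply, map_smul]; simp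
  rw [this]
  refine pauliJordan_congr m fun p _ => ?_
  simp only [fourierM_smul, fourierM_pd]
  simp
  ring

/-- This is the Klein–Gordon equation: only values of the Fourier transforms on the shell `p · p =
m²` enter, and there the symbol of `box` is constant. -/
theorem pauliJordan_box_right (m : ℝ) (g h : Test) :
    pauliJordan m g (box h) = -(m : ℂ) ^ 2 * pauliJordan m g h := by
  have : -(m : ℂ) ^ 2 * pauliJordan m g h = pauliJordan m g ((-(m : ℂ) ^ 2) • h) := by
    rw [← pjForm_apply, ← pjForm_apply, map_smul]; rfl
  rw [this]
  refine pauliJordan_congr m fun p hp => ?_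
  have h2 : mink (-p) (-p) = m ^ 2 := by
    rw [← hp]; simp [mink]
  rw [fourierM_box, fourierM_smul, h2]
  push_cast
  ring

theorem pauliJordan_translateTest (m : ℝ) (a : Spacetime) (g h : Test) :
    pauliJordan m (translateTest a g) (translateTest a h) = pauliJordan m g h := by
  refine pauliJordan_congr m fun p _ => ?_
  rw [fourierM_translateTest, fourierM_translateTest, mink_neg_left]
  have : exp (I * (mink p a : ℂ)) * exp (I * ((-mink p a : ℝ) : ℂ)) = 1 := by
    rw [← exp_add]; simp
  linear_combination (fourierM g p * fourierM h (-p)) * this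

theorem wightman_conjTest (m : ℝ) (g h : Test) :
    wightman m (conjTest g) (conjTest h) = (starRingEnd ℂ) (wightman m h g) := by
  rw [wightman, wightman, shellInt, shellInt, ← integral_conj]
  congr 1
  ext k
  simp only [fourierM_conjTest, map_mul, neg_neg, map_div₀, map_one, conj_ofReal, map_ofNat]
  ring

/-- The distribution is real: conjugation exchanges the arguments of `wightman`, and this sign
cancels the one from the prefactor `I`. -/
theorem pauliJordan_conjTest (m : ℝ) (g h : Test) :
    pauliJordan m (conjTest g) (conjTest h) = (starRingEnd ℂ) (pauliJordan m g h) := by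
  simp only [pauliJordan_eq, wightman_conjTest, map_mul, map_div₀, map_pow, conj_I, conj_ofReal,
    map_ofNat, map_sub]
  ring

end Hyper

namespace Hyper

/-! ### Lorentz transformations -/

theorem det_slash (x : Spacetime) : (slash x).det = (mink x x : ℂ) := by
  simp [slash, Matrix.det_fin_two, Fin.sum_univ_four, metric, pauli, mink]
  ring_nf
  simp only [I_sq]
  ring

theorem mink_add_add (x y : Spacetime) :
    mink (x + y) (x + y) = mink x x + mink y y + 2 * mink x y := by
  simp [mink, Fin.sum_univ_four]; ring

theorem lorentz_apply (A : Matrix.SpecialLinearGroup (Fin 2) ℂ) (x : Spacetime) :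
    lorentz A x = lorentzFun A.1 x := rfl

theorem slash_lorentz (A : Matrix.SpecialLinearGroup (Fin 2) ℂ) (x : Spacetime) :
    slash (lorentz A x) = A.1 * slash x * A.1.conjTranspose := slash_lorentzFun _ _

theorem mink_lorentz_self (A : Matrix.SpecialLinearGroup (Fin 2) ℂ) (x : Spacetime) :
    mink (lorentz A x) (lorentz A x) = mink x x := by
  have h := det_slash (lorentz A x)
  rw [slash_lorentz, Matrix.det_mul, Matrix.det_mul, Matrix.det_conjTranspose, A.2,
    det_slash] at h
  simp at h
  exact_mod_cast h.symm

theorem mink_lorentz (A : Matrix.SpecialLinearGroup (Fin 2) ℂ) (x y : Spacetime) :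
    mink (lorentz A x) (lorentz A y) = mink x y := by
  have h := mink_lorentz_self A (x + y)
  rw [map_add, mink_add_add, mink_add_add, mink_lorentz_self, mink_lorentz_self] at h
  linarith

theorem lorentz_mul (A B : Matrix.SpecialLinearGroup (Fin 2) ℂ) (x : Spacetime) :
    lorentz (A * B) x = lorentz A (lorentz B x) :=
  slash_injective (by
    rw [slash_lorentz, slash_lorentz, slash_lorentz]
    simp [Matrix.conjTranspose_mul, Matrix.mul_assoc])

theorem lorentz_one (x : Spacetime) : lorentz 1 x = x :=
  slash_injective (by rw [slash_lorentz]; simp)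

theorem lorentz_inv_apply (A : Matrix.SpecialLinearGroup (Fin 2) ℂ) (x : Spacetime) :
    lorentz A⁻¹ (lorentz A x) = x := by
  rw [← lorentz_mul, inv_mul_cancel, lorentz_one]

theorem lorentz_apply_inv (A : Matrix.SpecialLinearGroup (Fin 2) ℂ) (x : Spacetime) :
    lorentz A (lorentz A⁻¹ x) = x := by
  rw [← lorentz_mul, mul_inv_cancel, lorentz_one]

/-- The matrix of a Lorentz transformation. -/
noncomputable def lorentzMatrix (A : Matrix.SpecialLinearGroup (Fin 2) ℂ) :
    Matrix (Fin 4) (Fin 4) ℝ :=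
  Matrix.of fun μ ν => lorentz A (EuclideanSpace.single ν 1) μ

theorem lorentz_eq_sum (A : Matrix.SpecialLinearGroup (Fin 2) ℂ) (x : Spacetime) (μ : Fin 4) :
    lorentz A x μ = ∑ ν, lorentzMatrix A μ ν * x ν := by
  have hx : x = ∑ ν, x ν • (EuclideanSpace.single ν (1 : ℝ) : Spacetime) := by
    ext i
    simp [Pi.single_apply]
  conv_lhs => rw [hx]
  simp [map_sum, lorentzMatrix, mul_comm]

theorem mink_single_single (μ ν : Fin 4) :
    mink (EuclideanSpace.single μ 1) (EuclideanSpace.single ν 1)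
      = Matrix.diagonal metric μ ν := by
  fin_cases μ <;> fin_cases ν <;> simp [mink, metric]

theorem lorentzMatrix_orthogonal (A : Matrix.SpecialLinearGroup (Fin 2) ℂ) :
    (lorentzMatrix A).transpose * Matrix.diagonal metric * lorentzMatrix A
      = Matrix.diagonal metric := by
  ext μ ν
  rw [← mink_single_single, ← mink_lorentz A]
  simp [Matrix.mul_apply, Matrix.diagonal_apply, mink, lorentzMatrix]
  exact Finset.sum_congr rfl fun i _ => by ring

theorem det_metric_ne_zero : (Matrix.diagonal metric).det ≠ 0 := by
  simp [Fin.prod_univ_four, metric]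

theorem abs_det_lorentzMatrix (A : Matrix.SpecialLinearGroup (Fin 2) ℂ) :
    |(lorentzMatrix A).det| = 1 := by
  have h := congrArg Matrix.det (lorentzMatrix_orthogonal A)
  rw [Matrix.det_mul, Matrix.det_mul, Matrix.det_transpose] at h
  have h1 : (lorentzMatrix A).det ^ 2 = 1 := by
    apply mul_right_cancel₀ det_metric_ne_zero
    linear_combination h
  rcases sq_eq_one_iff.1 h1 with h | h <;> simp [h]

theorem det_lorentz (A : Matrix.SpecialLinearGroup (Fin 2) ℂ) :
    LinearMap.det ((lorentz A : Spacetime →L[ℝ] Spacetime) : Spacetime →ₗ[ℝ] Spacetime)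
      = (lorentzMatrix A).det := by
  rw [← LinearMap.det_toMatrix (EuclideanSpace.basisFun (Fin 4) ℝ).toBasis]
  congr 1

theorem measurePreserving_lorentz (A : Matrix.SpecialLinearGroup (Fin 2) ℂ) :
    MeasurePreserving (lorentz A : Spacetime → Spacetime) volume volume := by
  refine ⟨(lorentz A).continuous.measurable, ?_⟩
  have hd := abs_det_lorentzMatrix A
  rw [← det_lorentz] at hd
  have h0 : LinearMap.det ((lorentz A : Spacetime →L[ℝ] Spacetime) : Spacetime →ₗ[ℝ] Spacetime)
      ≠ 0 := fun h => by rw [h] at hd; simp at hd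
  have h := Measure.map_linearMap_addHaar_eq_smul_addHaar (volume : Measure Spacetime) h0
  rw [abs_inv, hd] at h
  simpa using h

theorem lorentzTest_apply (A : Matrix.SpecialLinearGroup (Fin 2) ℂ) (g : Test) (x : Spacetime) :
    lorentzTest A g x = g (lorentz A x) := rfl

/-- A change of variables: Lorentz transformations preserve both the Minkowski product and Lebesgue
measure. -/
theorem fourierM_lorentzTest (A : Matrix.SpecialLinearGroup (Fin 2) ℂ) (g : Test)
    (p : Spacetime) : fourierM (lorentzTest A g) p = fourierM g (lorentz A p) := by
  have h := (measurePreserving_lorentz A).integral_comp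
    (lorentz A).toHomeomorph.measurableEmbedding
    (fun x => exp (-I * (mink (lorentz A p) x : ℂ)) * g x)
  rw [fourierM, fourierM, ← h]
  simp only [mink_lorentz, lorentzTest_apply]

/-! ### Lorentz invariance of the measure on the mass shell -/

/-- A hermitian `2 × 2` matrix with diagonal `P, R ≥ 0`, an off-diagonal entry of modulus squared
`b² + c²` and nonnegative determinant is positive semidefinite; the expression is its value on the
vector `(x + iy, u + iv)`. For `P > 0` complete the square, and for `P = 0` the off-diagonal entry
vanishes. -/
theorem quadratic_nonneg {P R b c : ℝ} (hP : 0 ≤ P) (hR : 0 ≤ R) (h : b ^ 2 + c ^ 2 ≤ P * R)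
    (x y u v : ℝ) :
    0 ≤ P * (x ^ 2 + y ^ 2) + R * (u ^ 2 + v ^ 2)
      - 2 * (b * (x * u + y * v) + c * (x * v - y * u)) := by
  rcases hP.eq_or_lt with h0 | h0
  · subst h0
    have hb : b = 0 := by nlinarith [sq_nonneg b, sq_nonneg c]
    have hc : c = 0 := by nlinarith [sq_nonneg b, sq_nonneg c]
    subst hb hc
    simp
    positivity
  · have : 0 ≤ P * (P * (x ^ 2 + y ^ 2) + R * (u ^ 2 + v ^ 2)
      - 2 * (b * (x * u + y * v) + c * (x * v - y * u))) := by
      have e : P * (P * (x ^ 2 + y ^ 2) + R * (u ^ 2 + v ^ 2)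
          - 2 * (b * (x * u + y * v) + c * (x * v - y * u)))
          = (P * x - (b * u + c * v)) ^ 2 + (P * y - (b * v - c * u)) ^ 2
            + (P * R - (b ^ 2 + c ^ 2)) * (u ^ 2 + v ^ 2) := by ring
      rw [e]
      have : 0 ≤ P * R - (b ^ 2 + c ^ 2) := by linarith
      positivity
    exact nonneg_of_mul_nonneg_right this h0

/-- For `p` in the closed forward cone `slash p` is positive semidefinite. Twice the new time
component is the trace of `A (slash p) A*`, a sum of the values of this hermitian form on the two
rows of `A`. -/
theorem lorentz_time_nonneg (A : Matrix.SpecialLinearGroup (Fin 2) ℂ) (p : Spacetime)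
    (h0 : 0 ≤ p 0) (h : 0 ≤ mink p p) : 0 ≤ lorentz A p 0 := by
  simp only [mink, Fin.sum_univ_four, metric] at h
  simp at h
  have hP : 0 ≤ p 0 - p 3 := by nlinarith [sq_nonneg (p 1), sq_nonneg (p 2)]
  have hR : 0 ≤ p 0 + p 3 := by nlinarith [sq_nonneg (p 1), sq_nonneg (p 2)]
  have hs : (p 1) ^ 2 + (p 2) ^ 2 ≤ (p 0 - p 3) * (p 0 + p 3) := by nlinarith
  -- The imaginary part of the off-diagonal entry enters with the opposite sign, so `c = -p 2`.
  rw [← neg_sq (p 2)] at hs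
  have q := fun i => quadratic_nonneg hP hR hs (A.1 i 0).re (A.1 i 0).im (A.1 i 1).re (A.1 i 1).im
  have q0 := q 0
  have q1 := q 1
  simp [lorentz_apply, lorentzFun, slash, Matrix.trace_fin_two, Matrix.mul_apply,
      Fin.sum_univ_two, Fin.sum_univ_four, metric, pauli]
  nlinarith

/-- The action of a Lorentz transformation on the momenta of a mass shell. -/
noncomputable def shellMap (m : ℝ) (A : Matrix.SpecialLinearGroup (Fin 2) ℂ)
    (k : EuclideanSpace ℝ (Fin 3)) : EuclideanSpace ℝ (Fin 3) :=
  WithLp.toLp 2 fun i => lorentz A (onShell m k) i.succ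

theorem onShell_zero (m : ℝ) (k : EuclideanSpace ℝ (Fin 3)) : onShell m k 0 = energy m k := rfl

theorem onShell_succ (m : ℝ) (k : EuclideanSpace ℝ (Fin 3)) (i : Fin 3) :
    onShell m k i.succ = k i := by
  fin_cases i <;> rfl

theorem eq_onShell {m : ℝ} {p : Spacetime} (h0 : 0 ≤ p 0) (h : mink p p = m ^ 2) :
    p = onShell m (WithLp.toLp 2 fun i => p i.succ) := by
  ext μ
  refine Fin.cases ?_ (fun i => ?_) μ
  · rw [onShell_zero, energy, eq_comm, Real.sqrt_eq_iff_mul_self_eq (by positivity) h0,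
      norm_sq_three]
    simp [mink, Fin.sum_univ_four, metric] at h
    simp
    linarith
  · rw [onShell_succ]

theorem onShell_shellMap (m : ℝ) (A : Matrix.SpecialLinearGroup (Fin 2) ℂ)
    (k : EuclideanSpace ℝ (Fin 3)) : onShell m (shellMap m A k) = lorentz A (onShell m k) := by
  refine (eq_onShell (lorentz_time_nonneg A _ ?_ ?_) ?_).symm
  · rw [onShell_zero]; exact energy_nonneg m k
  · rw [mink_onShell]; positivity
  · rw [mink_lorentz, mink_onShell]

theorem onShell_injective (m : ℝ) : Function.Injective (onShell m) := by
  intro k k' h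
  ext i
  rw [← onShell_succ m, ← onShell_succ m, h]

theorem shellMap_inv (m : ℝ) (A : Matrix.SpecialLinearGroup (Fin 2) ℂ)
    (k : EuclideanSpace ℝ (Fin 3)) : shellMap m A⁻¹ (shellMap m A k) = k :=
  onShell_injective m (by rw [onShell_shellMap, onShell_shellMap, lorentz_inv_apply])

theorem energy_eq_zero_iff (m : ℝ) (k : EuclideanSpace ℝ (Fin 3)) :
    energy m k = 0 ↔ onShell m k = 0 := by
  constructor
  · intro h
    have h1 := energy_sq m k
    rw [h] at h1
    have h2 : ‖k‖ = 0 := by nlinarith [sq_nonneg m, norm_nonneg k]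
    have h3 : k = 0 := norm_eq_zero.1 h2
    ext μ
    refine Fin.cases ?_ (fun i => ?_) μ
    · rw [onShell_zero, h]; rfl
    · rw [onShell_succ, h3]; rfl
  · intro h
    rw [← onShell_zero, h]; rfl

theorem energy_shellMap_ne_zero {m : ℝ} (A : Matrix.SpecialLinearGroup (Fin 2) ℂ)
    {k : EuclideanSpace ℝ (Fin 3)} (h : energy m k ≠ 0) : energy m (shellMap m A k) ≠ 0 := by
  intro h1
  rw [energy_eq_zero_iff, onShell_shellMap] at h1
  refine h ((energy_eq_zero_iff m k).2 ?_)
  have := lorentz_inv_apply A (onShell m k)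
  rw [h1, map_zero] at this
  exact this.symm

/-- The derivative of `k ↦ (ω, k)`. -/
noncomputable def onShellDeriv (m : ℝ) (k : EuclideanSpace ℝ (Fin 3)) :
    EuclideanSpace ℝ (Fin 3) →L[ℝ] Spacetime :=
  ((EuclideanSpace.equiv (Fin 4) ℝ).symm : (Fin 4 → ℝ) →L[ℝ] Spacetime) ∘L
    ContinuousLinearMap.pi (Fin.cons ((energy m k)⁻¹ • innerSL ℝ k)
      (fun i => EuclideanSpace.proj i))

theorem hasFDerivAt_energy {m : ℝ} {k : EuclideanSpace ℝ (Fin 3)} (h : energy m k ≠ 0) :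
    HasFDerivAt (energy m) ((energy m k)⁻¹ • innerSL ℝ k) k := by
  have h1 : HasFDerivAt (fun k : EuclideanSpace ℝ (Fin 3) => m ^ 2 + ‖k‖ ^ 2)
      (2 • innerSL ℝ k) k := (hasStrictFDerivAt_norm_sq k).hasFDerivAt.const_add _
  have h2 : m ^ 2 + ‖k‖ ^ 2 ≠ 0 := fun h0 => h (by rw [energy, h0, Real.sqrt_zero])
  have h3 := h1.sqrt h2
  refine h3.congr_fderiv ?_
  have h4 : √(m ^ 2 + ‖k‖ ^ 2) = energy m k := rfl
  rw [h4, ← Nat.cast_smul_eq_nsmul ℝ, smul_smul]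
  congr 1
  push_cast
  field_simp

theorem hasFDerivAt_onShell {m : ℝ} {k : EuclideanSpace ℝ (Fin 3)} (h : energy m k ≠ 0) :
    HasFDerivAt (onShell m) (onShellDeriv m k) k := by
  refine ((EuclideanSpace.equiv (Fin 4) ℝ).symm :
    (Fin 4 → ℝ) →L[ℝ] Spacetime).hasFDerivAt.comp k (f := fun k => ![energy m k, k 0, k 1, k 2]) ?_
  rw [hasFDerivAt_pi']
  intro μ
  fin_cases μ
  · exact hasFDerivAt_energy h
  · exact (EuclideanSpace.proj (0 : Fin 3) : EuclideanSpace ℝ (Fin 3) →L[ℝ] ℝ).hasFDerivAt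
  · exact (EuclideanSpace.proj (1 : Fin 3) : EuclideanSpace ℝ (Fin 3) →L[ℝ] ℝ).hasFDerivAt
  · exact (EuclideanSpace.proj (2 : Fin 3) : EuclideanSpace ℝ (Fin 3) →L[ℝ] ℝ).hasFDerivAt

/-- The spatial part of a four-vector. -/
noncomputable def spatialPart : Spacetime →L[ℝ] EuclideanSpace ℝ (Fin 3) :=
  ((EuclideanSpace.equiv (Fin 3) ℝ).symm : (Fin 3 → ℝ) →L[ℝ] EuclideanSpace ℝ (Fin 3)) ∘L
    ContinuousLinearMap.pi (fun i => EuclideanSpace.proj i.succ)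

/-- The derivative of `shellMap`. -/
noncomputable def shellMapDeriv (m : ℝ) (A : Matrix.SpecialLinearGroup (Fin 2) ℂ)
    (k : EuclideanSpace ℝ (Fin 3)) : EuclideanSpace ℝ (Fin 3) →L[ℝ] EuclideanSpace ℝ (Fin 3) :=
  spatialPart ∘L (lorentz A : Spacetime →L[ℝ] Spacetime) ∘L onShellDeriv m k

theorem hasFDerivAt_shellMap {m : ℝ} (A : Matrix.SpecialLinearGroup (Fin 2) ℂ)
    {k : EuclideanSpace ℝ (Fin 3)} (h : energy m k ≠ 0) :
    HasFDerivAt (shellMap m A) (shellMapDeriv m A k) k := by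
  have h1 := (lorentz A : Spacetime →L[ℝ] Spacetime).hasFDerivAt.comp k (hasFDerivAt_onShell h)
  exact spatialPart.hasFDerivAt.comp k h1

/-- Jacobian of the action of an orthochronous isometry on a mass shell. -/
theorem det_shell_matrix (L : Matrix (Fin 4) (Fin 4) ℝ) (p p' : Fin 4 → ℝ)
    (hL : L.transpose * Matrix.diagonal metric * L = Matrix.diagonal metric)
    (hp : p' = L.mulVec p) (h0 : p 0 ≠ 0) (h0' : p' 0 ≠ 0) :
    p 0 * (Matrix.of fun i j : Fin 3 =>
      L i.succ 0 * (p j.succ / p 0) + L i.succ j.succ).det = p' 0 * L.det := by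
  set S : Matrix (Fin 3) (Fin 3) ℝ := Matrix.of fun i j : Fin 3 =>
      L i.succ 0 * (p j.succ / p 0) + L i.succ j.succ with hS
  -- Two unipotent matrices bring `L` into block form. Column operations `U` turn the spatial block
  -- of `L * U` into the Jacobian `S`; the row operations `R` then clear the first row of `L * U`
  -- except for the entry `p 0 / p' 0`.
  set U : Matrix (Fin 4) (Fin 4) ℝ := !![1, p 1 / p 0, p 2 / p 0, p 3 / p 0;
    0, 1, 0, 0; 0, 0, 1, 0; 0, 0, 0, 1] with hU
  set R : Matrix (Fin 4) (Fin 4) ℝ := !![1, -(p' 1 / p' 0), -(p' 2 / p' 0), -(p' 3 / p' 0);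
    0, 1, 0, 0; 0, 0, 1, 0; 0, 0, 0, 1] with hR
  have dU : U.det = 1 := by
    simp [hU, Matrix.det_succ_row_zero, Fin.sum_univ_succ]
  have dR : R.det = 1 := by
    simp [hR, Matrix.det_succ_row_zero, Fin.sum_univ_succ]
  have orth : ∀ μ ν, L 0 μ * L 0 ν - L 1 μ * L 1 ν - L 2 μ * L 2 ν - L 3 μ * L 3 ν
      = Matrix.diagonal metric μ ν := fun μ ν => by
    rw [← hL]
    simp [Matrix.mul_apply, Fin.sum_univ_four, Matrix.diagonal_apply, metric]
    ring
  have hp' : ∀ μ, p' μ = L μ 0 * p 0 + L μ 1 * p 1 + L μ 2 * p 2 + L μ 3 * p 3 := fun μ => by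
    rw [hp]; simp [Matrix.mulVec, dotProduct, Fin.sum_univ_four]
  -- Orthogonality contracted with `p`: `p'ᵀ g L = pᵀ Lᵀ g L = pᵀ g`.
  have row : ∀ ν, p' 0 * L 0 ν - p' 1 * L 1 ν - p' 2 * L 2 ν - p' 3 * L 3 ν = metric ν * p ν := by
    intro ν
    have e0 := orth 0 ν
    have e1 := orth 1 ν
    have e2 := orth 2 ν
    have e3 := orth 3 ν
    have : metric ν * p ν = ∑ μ, p μ * Matrix.diagonal metric μ ν := by
      simp [Matrix.diagonal_apply, mul_comm]
    rw [this, Fin.sum_univ_four, ← e0, ← e1, ← e2, ← e3]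
    simp only [hp']
    ring
  have key : (R * (L * U)).det = p 0 / p' 0 * S.det := by
    rw [Matrix.det_succ_row_zero, Fin.sum_univ_four]
    have r0 : (R * (L * U)) 0 0 = p 0 / p' 0 := by
      have := row 0
      simp [metric] at this
      simp [hR, hU, Matrix.mul_apply, Fin.sum_univ_four]
      field_simp
      linarith
    have rj : ∀ j : Fin 4, j ≠ 0 → (R * (L * U)) 0 j = 0 := by
      intro j hj
      have w0 := row 0
      have wj := row j
      simp [metric] at w0
      have e : (R * (L * U)) 0 j
          = (p' 0 * L 0 j - p' 1 * L 1 j - p' 2 * L 2 j - p' 3 * L 3 j) / p' 0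
            + (p' 0 * L 0 0 - p' 1 * L 1 0 - p' 2 * L 2 0 - p' 3 * L 3 0) / p' 0 *
              (p j / p 0) := by
        fin_cases j
        · exact absurd rfl hj
        all_goals
          simp [hR, hU, Matrix.mul_apply, Fin.sum_univ_four]
          field_simp
          ring
      rw [e, wj, w0]
      fin_cases j
      · exact absurd rfl hj
      all_goals
        simp [metric]
        field_simp
        ring
    rw [r0, rj 1 (by decide), rj 2 (by decide), rj 3 (by decide)]
    have sub : (R * (L * U)).submatrix Fin.succ (Fin.succAbove 0) = S := by
      ext i j
      simp only [Matrix.submatrix_apply, Fin.zero_succAbove, Matrix.mul_apply, Fin.sum_univ_four]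
      fin_cases i <;> fin_cases j <;> simp [hR, hU, hS]
    rw [sub]
    simp
  rw [Matrix.det_mul, Matrix.det_mul, dU, dR] at key
  field_simp at key
  linarith

theorem det_shellMapDeriv {m : ℝ} (A : Matrix.SpecialLinearGroup (Fin 2) ℂ)
    {k : EuclideanSpace ℝ (Fin 3)} (h : energy m k ≠ 0) :
    |(shellMapDeriv m A k).det| = energy m (shellMap m A k) / energy m k := by
  have hd : (shellMapDeriv m A k).det = (Matrix.of fun i j : Fin 3 =>
      lorentzMatrix A i.succ 0 * (onShell m k j.succ / onShell m k 0)
        + lorentzMatrix A i.succ j.succ).det := by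
    rw [ContinuousLinearMap.det,
      ← LinearMap.det_toMatrix (EuclideanSpace.basisFun (Fin 3) ℝ).toBasis]
    congr 1
    ext i j
    have : (LinearMap.toMatrix (EuclideanSpace.basisFun (Fin 3) ℝ).toBasis
        (EuclideanSpace.basisFun (Fin 3) ℝ).toBasis) (shellMapDeriv m A k) i j
        = lorentz A (onShellDeriv m k (EuclideanSpace.single j 1)) i.succ := by
      simp [LinearMap.toMatrix_apply, shellMapDeriv, spatialPart]
    rw [this, lorentz_eq_sum, Fin.sum_univ_succ]
    have e0 : onShellDeriv m k (EuclideanSpace.single j 1) 0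
        = onShell m k j.succ / onShell m k 0 := by
      rw [onShell_succ, onShell_zero]
      simp [onShellDeriv, EuclideanSpace.inner_single_right]
      ring
    have es : ∀ l : Fin 3, onShellDeriv m k (EuclideanSpace.single j 1) l.succ
        = if l = j then 1 else 0 := fun l => by
      simp [onShellDeriv, Pi.single_apply]
    rw [e0]
    simp [es]
  have h1 := energy_shellMap_ne_zero A h
  have h2 := det_shell_matrix (lorentzMatrix A) (onShell m k) (onShell m (shellMap m A k))
    (lorentzMatrix_orthogonal A)
    (by ext μ; rw [onShell_shellMap, lorentz_eq_sum]; rfl) h h1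
  rw [← hd, onShell_zero, onShell_zero] at h2
  have h3 := congrArg abs h2
  rw [abs_mul, abs_mul, abs_det_lorentzMatrix, abs_of_nonneg (energy_nonneg m k),
    abs_of_nonneg (energy_nonneg m _)] at h3
  rw [eq_div_iff h]
  linarith

/-- The Jacobian of the action on spatial momenta is `ω' / ω`, which exactly compensates the change
of the weight `1 / (2ω)`. -/
theorem shellInt_lorentz (m : ℝ) (A : Matrix.SpecialLinearGroup (Fin 2) ℂ)
    (H : Spacetime → ℂ) : shellInt m (fun p => H (lorentz A p)) = shellInt m H := by
  -- For `m = 0` the energy is not differentiable at the tip of the cone. The tip may be removed,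
  -- since the weight there is `1 / 0 = 0`.
  set s : Set (EuclideanSpace ℝ (Fin 3)) := {k | energy m k ≠ 0}
  have hs : MeasurableSet s :=
    (continuous_energy m).measurable (MeasurableSet.singleton 0).compl
  have red : ∀ H : Spacetime → ℂ, shellInt m H
      = ∫ k in s, (1 / (2 * (energy m k : ℂ))) * H (onShell m k) := fun H => by
    refine (setIntegral_eq_integral_of_forall_compl_eq_zero fun k hk => ?_).symm
    have : energy m k = 0 := by simpa [s] using hk
    simp [this]
  have himg : shellMap m A '' s = s := by
    ext k
    constructor
    · rintro ⟨k', hk', rfl⟩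
      exact energy_shellMap_ne_zero A hk'
    · intro hk
      refine ⟨shellMap m A⁻¹ k, energy_shellMap_ne_zero A⁻¹ hk, ?_⟩
      have := shellMap_inv m A⁻¹ k
      rwa [inv_inv] at this
  have hinj : Set.InjOn (shellMap m A) s := fun k _ k' _ h => by
    rw [← shellMap_inv m A k, h, shellMap_inv]
  rw [red, red H]
  conv_rhs => rw [← himg]
  rw [integral_image_eq_integral_abs_det_fderiv_smul volume hs
    (fun k hk => (hasFDerivAt_shellMap A hk).hasFDerivWithinAt) hinj]
  refine setIntegral_congr_fun hs fun k hk => ?_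
  have hk : energy m k ≠ 0 := hk
  have hk' := energy_shellMap_ne_zero A hk
  simp only [onShell_shellMap, det_shellMapDeriv A hk, real_smul]
  have c1 : (energy m k : ℂ) ≠ 0 := by exact_mod_cast hk
  have c2 : (energy m (shellMap m A k) : ℂ) ≠ 0 := by exact_mod_cast hk'
  push_cast
  field_simp

theorem pauliJordan_lorentzTest (m : ℝ) (A : Matrix.SpecialLinearGroup (Fin 2) ℂ) (g h : Test) :
    pauliJordan m (lorentzTest A g) (lorentzTest A h) = pauliJordan m g h := by
  have key : ∀ g h, wightman m (lorentzTest A g) (lorentzTest A h) = wightman m g h := by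
    intro g h
    rw [wightman, wightman, ← shellInt_lorentz m A (fun p => fourierM g p * fourierM h (-p))]
    simp only [fourierM_lorentzTest, map_neg]
  rw [pauliJordan_eq, pauliJordan_eq, key, key]

end Hyper

namespace Hyper

open scoped FourierTransform

/-! ### Nondegeneracy of the Pauli–Jordan distribution -/

/-- Take the inverse Fourier transform of a bump function centred at the wave vector of `p`. -/
theorem exists_fourierM_ne_zero (p : Spacetime) : ∃ g : Test, fourierM g p ≠ 0 := by
  set b : ContDiffBump (waveVector p) := default
  have hc : HasCompactSupport fun x => ((b x : ℝ) : ℂ) :=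
    b.hasCompactSupport.comp_left (g := fun r : ℝ => (r : ℂ)) rfl
  have hd : ContDiff ℝ ((⊤ : ℕ∞) : WithTop ℕ∞) fun x => ((b x : ℝ) : ℂ) :=
    ofRealCLM.contDiff.comp b.contDiff
  refine ⟨𝓕⁻ (hc.toSchwartzMap hd), ?_⟩
  rw [fourierM_eq_fourier, FourierTransform.fourier_fourierInv_eq]
  change ((b (waveVector p) : ℝ) : ℂ) ≠ 0
  rw [b.one_of_mem_closedBall (Metric.mem_closedBall_self b.rIn_pos.le)]
  simp

theorem ae_energy_ne_zero (m : ℝ) : ∀ᵐ k : EuclideanSpace ℝ (Fin 3), energy m k ≠ 0 := by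
  have hne : ∀ᵐ k : EuclideanSpace ℝ (Fin 3), k ≠ 0 := by simp [ae_iff]
  filter_upwards [hne] with k hk
  exact (lt_of_lt_of_le (norm_pos_iff.2 hk) (norm_le_energy m k)).ne'

/-- Pair `v` with the conjugate of its time derivative. The derivative contributes `±ω` on the two
sheets: this cancels the weight `1 / ω`, and the sign turns the difference of the two frequency
parts into the sum of `|v̂|²` over both sheets. A continuous nonnegative function with integral zero
vanishes everywhere, including the tip of the cone. -/
theorem pauliJordan_nondegenerate (m : ℝ) (v : Test) (H : ∀ g, pauliJordan m g v = 0)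
    (k : EuclideanSpace ℝ (Fin 3)) :
    fourierM v (onShell m k) = 0 ∧ fourierM v (-onShell m k) = 0 := by
  set f : EuclideanSpace ℝ (Fin 3) → ℝ := fun k =>
    normSq (fourierM v (onShell m k)) + normSq (fourierM v (-onShell m k)) with hf
  have hfc : Continuous f := by
    have h1 := (continuous_fourierM v).comp (continuous_onShell m)
    have h2 := (continuous_fourierM v).comp (continuous_onShell m).neg
    exact (continuous_normSq.comp h1).add (continuous_normSq.comp h2)
  set g := conjTest (pd 0 v)
  have hint : Integrable fun k : EuclideanSpace ℝ (Fin 3) => (1 / (2 * (energy m k : ℂ))) *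
      (fourierM g (onShell m k) * fourierM v (-onShell m k)
        - fourierM g (-onShell m k) * fourierM v (onShell m k)) := by
    refine ((integrable_shell_fourierM m g v).sub (integrable_shell_fourierM m v g)).congr ?_
    exact Filter.Eventually.of_forall fun k => by simp only [Pi.sub_apply]; ring
  have hae : (fun k : EuclideanSpace ℝ (Fin 3) => (1 / (2 * (energy m k : ℂ))) *
      (fourierM g (onShell m k) * fourierM v (-onShell m k)
        - fourierM g (-onShell m k) * fourierM v (onShell m k)))
      =ᵐ[volume] fun k => (I / 2) * (f k : ℂ) := by
    filter_upwards [ae_energy_ne_zero m] with k hk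
    have hk : (energy m k : ℂ) ≠ 0 := by exact_mod_cast hk
    have e0 : onShell m k 0 = energy m k := rfl
    simp only [g, fourierM_conjTest, fourierM_pd, hf, neg_neg, map_mul, conj_I, conj_ofReal,
      PiLp.neg_apply, e0, metric, ofReal_add, ← mul_conj]
    simp
    field_simp
    ring
  have hfi : Integrable f := by
    have h1 : Integrable fun k => (2 / I) * ((I / 2) * (f k : ℂ)) := (hint.congr hae).const_mul _
    have h2 := h1.re
    refine h2.congr (Filter.Eventually.of_forall fun k => ?_)
    have : (2 / I) * ((I / 2) * (f k : ℂ)) = f k := by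
      field_simp
    simp only [this]
    exact RCLike.ofReal_re (K := ℂ) (f k)
  have h0 := H g
  rw [pauliJordan, integral_congr_ae hae, integral_const_mul,
    integral_complex_ofReal] at h0
  have hpi : (2 * (Real.pi : ℂ)) ^ 3 ≠ 0 := pow_ne_zero _ (by exact_mod_cast Real.two_pi_pos.ne')
  have h1 : ∫ k, f k = 0 := by
    have : ((∫ k, f k : ℝ) : ℂ) = 0 := by
      rcases mul_eq_zero.1 h0 with h | h
      · exact absurd h (div_ne_zero I_ne_zero hpi)
      · rcases mul_eq_zero.1 h with h | h
        · exact absurd h (div_ne_zero I_ne_zero two_ne_zero)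
        · exact h
    exact_mod_cast this
  have hnn : 0 ≤ f := fun k => add_nonneg (normSq_nonneg _) (normSq_nonneg _)
  have h2 := (integral_eq_zero_iff_of_nonneg hnn hfi).1 h1
  have h3 : f = 0 := (Continuous.ae_eq_iff_eq volume hfc continuous_const).1 h2
  have h4 : normSq (fourierM v (onShell m k)) + normSq (fourierM v (-onShell m k)) = 0 :=
    congrFun h3 k
  have h5 := normSq_nonneg (fourierM v (onShell m k))
  have h6 := normSq_nonneg (fourierM v (-onShell m k))
  exact ⟨normSq_eq_zero.1 (by linarith), normSq_eq_zero.1 (by linarith)⟩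

theorem exists_pauliJordan_ne_zero (m : ℝ) : ∃ g h, pauliJordan m g h ≠ 0 := by
  by_contra! H
  obtain ⟨v, hv⟩ := exists_fourierM_ne_zero (onShell m 0)
  exact hv (pauliJordan_nondegenerate m v (fun g => H g v) 0).1

/-- `pauliJordan_congr`, on the part of the mass shell that carries its measure. -/
theorem pauliJordan_congr_right (m : ℝ) {g h h' : Test}
    (H : ∀ k, energy m k ≠ 0 → fourierM h (onShell m k) = fourierM h' (onShell m k) ∧
      fourierM h (-onShell m k) = fourierM h' (-onShell m k)) :
    pauliJordan m g h = pauliJordan m g h' := by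
  unfold pauliJordan
  congr 2
  ext k
  by_cases hk : energy m k = 0
  · simp [hk]
  · rw [(H k hk).1, (H k hk).2]

/-! ### Lorentz-invariant differential operators on the mass shell -/

/-- The momentum with `p⁰ - p³ = h`, `p¹ = p² = 0` and `p · p = m²`. -/
noncomputable def lightConePoint (m h : ℝ) : Spacetime :=
  WithLp.toLp 2 ![(h + m ^ 2 / h) / 2, 0, 0, (m ^ 2 / h - h) / 2]

theorem lightConePoint_neg (m h : ℝ) : lightConePoint m (-h) = -lightConePoint m h := by
  ext μ
  fin_cases μ <;> simp [lightConePoint] <;> ring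

/-- The coordinates of `lightConePoint m h` are Laurent polynomials in `h` with at most a simple
pole, so a power of `h` clears the denominators. The identity covers both signs of `h`, that is,
both sheets of the shell. -/
theorem exists_polynomial_symbol (m : ℝ) (q : MvPolynomial (Fin 4) ℂ) :
    ∃ (N : ℕ) (P : Polynomial ℂ), ∀ h : ℝ, h ≠ 0 →
      P.eval (h : ℂ) = (h : ℂ) ^ N * symbol q (lightConePoint m h) := by
  induction q using MvPolynomial.induction_on with
  | C a => exact ⟨0, Polynomial.C a, fun h _ => by simp [symbol_C]⟩
  | add q r hq hr =>
    obtain ⟨N, P, hP⟩ := hq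
    obtain ⟨N', P', hP'⟩ := hr
    refine ⟨N + N', Polynomial.X ^ N' * P + Polynomial.X ^ N * P', fun h hh => ?_⟩
    simp [hP h hh, hP' h hh, symbol_add]
    ring
  | mul_X q μ hq =>
    obtain ⟨N, P, hP⟩ := hq
    have key : ∃ R : Polynomial ℂ, ∀ h : ℝ, h ≠ 0 →
        R.eval (h : ℂ) = h * symbol (MvPolynomial.X μ) (lightConePoint m h) := by
      refine ⟨![Polynomial.C (I / 2) * (Polynomial.X ^ 2 + Polynomial.C ((m : ℂ) ^ 2)), 0, 0,
        Polynomial.C (I / 2) * (Polynomial.X ^ 2 - Polynomial.C ((m : ℂ) ^ 2))] μ,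
        fun h hh => ?_⟩
      have hc : (h : ℂ) ≠ 0 := by exact_mod_cast hh
      rw [symbol_X]
      fin_cases μ <;> simp [lightConePoint, metric] <;> field_simp
      ring
    obtain ⟨R, hR⟩ := key
    refine ⟨N + 1, P * R, fun h hh => ?_⟩
    rw [Polynomial.eval_mul, hP h hh, hR h hh, symbol_mul]
    ring

/-- A triangular factorization `slash p = A diag(1, m²) A*` with lower triangular `A` of determinant
one. It exists because the upper left entry `p⁰ - p³` is positive, and it works for `m = 0` too. -/
theorem exists_lorentz_lightConePoint {m : ℝ} {p : Spacetime} (hp : mink p p = m ^ 2)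
    (h0 : 0 < p 0 - p 3) :
    ∃ A : Matrix.SpecialLinearGroup (Fin 2) ℂ, lorentz A (lightConePoint m 1) = p := by
  set s : ℝ := √(p 0 - p 3) with hs
  have hs0 : (s : ℂ) ≠ 0 := by exact_mod_cast (Real.sqrt_pos.2 h0).ne'
  have hs2 : (s : ℂ) * s = p 0 - p 3 := by
    rw [← ofReal_mul, hs, Real.mul_self_sqrt h0.le]; push_cast; rfl
  have hm : (p 0 - p 3 : ℂ) * (p 0 + p 3) = (m : ℂ) ^ 2 + (p 1 + I * p 2) * (p 1 - I * p 2) := by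
    have : p 0 * p 0 - p 1 * p 1 - p 2 * p 2 - p 3 * p 3 = m ^ 2 := by
      rw [← hp]; simp [mink, Fin.sum_univ_four, metric]; ring
    have h2 : (p 0 * p 0 - p 1 * p 1 - p 2 * p 2 - p 3 * p 3 : ℂ) = (m : ℂ) ^ 2 := by
      exact_mod_cast this
    linear_combination h2 + (p 2 : ℂ) ^ 2 * I_sq
  have hdet : (!![(s : ℂ), 0; -(p 1 + I * p 2) / s, 1 / s]).det = 1 := by
    rw [Matrix.det_fin_two_of, zero_mul, sub_zero, mul_one_div_cancel hs0]
  obtain ⟨A, hA⟩ : ∃ A : Matrix.SpecialLinearGroup (Fin 2) ℂ, A.1 =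
    !![(s : ℂ), 0; -(p 1 + I * p 2) / s, 1 / s] := ⟨⟨_, hdet⟩, rfl⟩
  refine ⟨A, slash_injective ?_⟩
  rw [slash_lorentz, hA]
  have hl : slash (lightConePoint m 1) = !![1, 0; 0, (m : ℂ) ^ 2] := by
    ext i j
    fin_cases i <;> fin_cases j <;>
      simp [slash, Fin.sum_univ_four, metric, pauli, lightConePoint] <;> ring
  have hr : slash p = !![(p 0 - p 3 : ℂ), -(p 1 - I * p 2); -(p 1 + I * p 2), p 0 + p 3] := by
    ext i j
    fin_cases i <;> fin_cases j <;>
      simp [slash, Fin.sum_univ_four, metric, pauli] <;> ring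
  rw [hl, hr]
  ext i j
  fin_cases i <;> fin_cases j <;>
    simp [Matrix.mul_apply, Fin.sum_univ_two]
  · exact hs2
  · field_simp; ring
  · field_simp
  · rw [← hs2] at hm
    field_simp
    linear_combination -hm

/-- Conjugation with this matrix exchanges the diagonal entries `p⁰ ∓ p³` of `slash p`. It moves the
light-like momenta with `p⁰ = p³`, out of reach of the triangular factorization, to where that
applies. -/
theorem exists_lorentz_reflect : ∃ w : Matrix.SpecialLinearGroup (Fin 2) ℂ, ∀ p : Spacetime,
    lorentz w p 0 = p 0 ∧ lorentz w p 3 = -p 3 := by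
  have hdet : (!![(0 : ℂ), 1; -1, 0]).det = 1 := by simp [Matrix.det_fin_two_of]
  obtain ⟨w, hw⟩ : ∃ A : Matrix.SpecialLinearGroup (Fin 2) ℂ, A.1 = !![(0 : ℂ), 1; -1, 0] :=
    ⟨⟨_, hdet⟩, rfl⟩
  refine ⟨w, fun p => ?_⟩
  have h00 : w.1 0 0 = 0 := by rw [hw]; rfl
  have h01 : w.1 0 1 = 1 := by rw [hw]; rfl
  have h10 : w.1 1 0 = -1 := by rw [hw]; rfl
  have h11 : w.1 1 1 = 0 := by rw [hw]; rfl
  have e0 := congrFun (congrFun (slash_lorentz w p) 0) 0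
  have e1 := congrFun (congrFun (slash_lorentz w p) 1) 1
  simp only [Matrix.mul_apply, Fin.sum_univ_two, Matrix.conjTranspose_apply, h00, h01, h10,
    h11] at e0 e1
  simp [slash, Fin.sum_univ_four, metric, pauli, Complex.ext_iff] at e0 e1
  constructor <;> linarith

/-- Nondegeneracy turns invariance of the kernel into invariance of the symbol on both sheets of the
shell, and transitivity makes the symbol constant on each. Invariance alone would allow two
different constants; that `q` is a polynomial forces them to be equal. -/
theorem diffOp_pauliJordan_of_invariant (m : ℝ) (q : MvPolynomial (Fin 4) ℂ)
    (hq : ∀ (A : Matrix.SpecialLinearGroup (Fin 2) ℂ) (g h : Test),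
      pauliJordanD m q (lorentzTest A g) (lorentzTest A h) = pauliJordanD m q g h) :
    ∃ c : ℂ, ∀ g h, pauliJordanD m q g h = c * pauliJordan m g h := by
  have inv : ∀ (A : Matrix.SpecialLinearGroup (Fin 2) ℂ) (k : EuclideanSpace ℝ (Fin 3)),
      symbol q (lorentz A⁻¹ (onShell m k)) = symbol q (onShell m k) ∧
      symbol q (lorentz A⁻¹ (-onShell m k)) = symbol q (-onShell m k) := by
    intro A k
    have van : ∀ h : Test, ∀ k,
        (symbol q (lorentz A⁻¹ (onShell m k)) - symbol q (onShell m k)) *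
          fourierM h (onShell m k) = 0 ∧
        (symbol q (lorentz A⁻¹ (-onShell m k)) - symbol q (-onShell m k)) *
          fourierM h (-onShell m k) = 0 := by
      intro h k
      -- The operator `q(∂)` conjugated with the Lorentz transformation; its symbol is the
      -- transformed symbol of `q`. By invariance `u - q(∂) h` lies in the radical of the
      -- Pauli–Jordan form.
      set u := lorentzTest A⁻¹ (diffOp q (lorentzTest A h)) with hu
      have hu' : ∀ p, fourierM u p = symbol q (lorentz A⁻¹ p) * fourierM h p := fun p => by
        rw [hu, fourierM_lorentzTest, fourierM_diffOp, fourierM_lorentzTest, lorentz_apply_inv]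
      have hz : ∀ g, pauliJordan m g (u + (-1 : ℂ) • diffOp q h) = 0 := by
        intro g
        have e1 : lorentzTest A⁻¹ (lorentzTest A g) = g := by
          ext x
          rw [lorentzTest_apply, lorentzTest_apply, lorentz_apply_inv]
        have e2 := pauliJordan_lorentzTest m A⁻¹ (lorentzTest A g) (diffOp q (lorentzTest A h))
        rw [e1] at e2
        have e3 := hq A g h
        rw [pauliJordanD, ← e2] at e3
        rw [← pjForm_apply, map_add, map_smul, pjForm_apply, pjForm_apply, hu, e3, pauliJordanD]
        simp
      have := pauliJordan_nondegenerate m _ hz k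
      simp only [fourierM_add, fourierM_smul, hu', fourierM_diffOp] at this
      constructor
      · linear_combination this.1
      · linear_combination this.2
    obtain ⟨h, hh⟩ := exists_fourierM_ne_zero (onShell m k)
    obtain ⟨h', hh'⟩ := exists_fourierM_ne_zero (-onShell m k)
    exact ⟨sub_eq_zero.1 ((mul_eq_zero.1 (van h k).1).resolve_right hh),
      sub_eq_zero.1 ((mul_eq_zero.1 (van h' k).2).resolve_right hh')⟩
  set c := symbol q (lightConePoint m 1) with hc
  set c' := symbol q (-lightConePoint m 1) with hc'
  have gen : ∀ k, 0 < onShell m k 0 - onShell m k 3 →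
      symbol q (onShell m k) = c ∧ symbol q (-onShell m k) = c' := by
    intro k hk
    obtain ⟨A, hA⟩ := exists_lorentz_lightConePoint (mink_onShell m k) hk
    have h1 := inv A k
    rw [map_neg, ← hA, lorentz_inv_apply] at h1
    rw [← hA]
    exact ⟨h1.1.symm, h1.2.symm⟩
  have line : ∀ h : ℝ, 0 < h → symbol q (lightConePoint m h) = c := by
    intro h hh
    have hm : mink (lightConePoint m h) (lightConePoint m h) = m ^ 2 := by
      simp [mink, lightConePoint, Fin.sum_univ_four, metric]
      field_simp
      ring
    have e := eq_onShell (p := lightConePoint m h) (by simp [lightConePoint]; positivity) hm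
    have := gen (WithLp.toLp 2 fun i : Fin 3 => lightConePoint m h i.succ) (by
      rw [← e]
      simp [lightConePoint]
      linarith)
    rw [← e] at this
    exact this.1
  -- For `h > 0` the curve `lightConePoint m h` runs on the upper sheet, so the polynomial `h ^ N *
  -- symbol` equals `c * h ^ N` there and hence identically. At `h = -1` the curve lies on the lower
  -- sheet.
  have hcc : c' = c := by
    obtain ⟨N, P, hP⟩ := exists_polynomial_symbol m q
    have hPX : P = Polynomial.C c * Polynomial.X ^ N := by
      refine Polynomial.eq_of_infinite_eval_eq _ _ ?_
      refine Set.Infinite.mono (s := (fun r : ℝ => (r : ℂ)) '' Set.Ioi 0) ?_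
        ((Set.Ioi_infinite (0 : ℝ)).image ofReal_injective.injOn)
      rintro _ ⟨h, hh, rfl⟩
      have hh : 0 < h := hh
      change Polynomial.eval _ _ = Polynomial.eval _ _
      rw [hP h hh.ne', line h hh, Polynomial.eval_mul, Polynomial.eval_C, Polynomial.eval_pow,
        Polynomial.eval_X, mul_comm]
    have h1 := hP (-1) (by norm_num)
    rw [hPX, lightConePoint_neg, ← hc'] at h1
    simp only [Polynomial.eval_mul, Polynomial.eval_C, Polynomial.eval_pow,
      Polynomial.eval_X] at h1
    have : (((-1 : ℝ) : ℂ)) ^ N ≠ 0 := pow_ne_zero _ (by norm_num)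
    exact mul_left_cancel₀ this (by linear_combination -h1)
  rw [hcc] at gen
  refine ⟨c, fun g h => ?_⟩
  rw [pauliJordanD]
  have e : c * pauliJordan m g h = pauliJordan m g (c • h) := by
    rw [← pjForm_apply, ← pjForm_apply, map_smul]; rfl
  rw [e]
  refine pauliJordan_congr_right m fun k hk => ?_
  have hkk : symbol q (onShell m k) = c ∧ symbol q (-onShell m k) = c := by
    by_cases hlt : 0 < onShell m k 0 - onShell m k 3
    · exact gen k hlt
    -- Momenta without positive `p⁰ - p³` have `p³ ≥ p⁰ > 0`; after the reflection of `p³` the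
    -- difference becomes `p⁰ + p³ > 0`.
    · obtain ⟨w, hw⟩ := exists_lorentz_reflect
      have h1 := inv w⁻¹ k
      rw [inv_inv, map_neg, ← onShell_shellMap] at h1
      have h0 : 0 < onShell m k 0 := lt_of_le_of_ne (energy_nonneg m k) (Ne.symm hk)
      have h2 := gen (shellMap m w k) (by
        rw [onShell_shellMap]
        rw [(hw _).1, (hw _).2]
        linarith)
      rw [h1.1, h1.2] at h2
      exact h2
  simp only [fourierM_diffOp, fourierM_smul, hkk.1, hkk.2, and_self]

end Hyper

namespace Hyper

/-! ### The operators `σ^μ_{ab} ∂_μ` on test functions -/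

/-- The operator `σ^μ_{ab} ∂_μ` on test functions. -/
noncomputable def sigPd (a b : Fin 2) : Module.End ℂ Test := ∑ μ, pauli μ a b • pd μ

theorem sigPd_apply (a b : Fin 2) (g : Test) : sigPd a b g = ∑ μ, pauli μ a b • pd μ g := by
  rw [sigPd, LinearMap.sum_apply]; rfl

theorem conj_pauli (μ : Fin 4) (a b : Fin 2) :
    (starRingEnd ℂ) (pauli μ a b) = pauli μ b a := by
  fin_cases μ <;> fin_cases a <;> fin_cases b <;> simp [pauli]

theorem conj_eps (a b : Fin 2) : (starRingEnd ℂ) (eps a b) = eps a b := by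
  fin_cases a <;> fin_cases b <;> simp [eps]

theorem conj_delta (a b : Fin 2) : (starRingEnd ℂ) (delta a b) = delta a b := by
  fin_cases a <;> fin_cases b <;> simp [delta]

theorem symbol_sum {ι : Type*} (s : Finset ι) (q : ι → MvPolynomial (Fin 4) ℂ) (p : Spacetime) :
    symbol (∑ i ∈ s, q i) p = ∑ i ∈ s, symbol (q i) p := by simp [symbol]

theorem diffOp_sigmaD (a b : Fin 2) (g : Test) : diffOp (sigmaD a b) g = sigPd a b g :=
  fourierM_injective fun p => by
    rw [fourierM_diffOp, sigmaD, symbol_sum, sigPd_apply, fourierM_sum, Finset.sum_mul]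
    refine Finset.sum_congr rfl fun μ _ => ?_
    rw [symbol_mul, symbol_C, symbol_X, fourierM_smul, fourierM_pd, mul_assoc]

theorem conjTest_sum {ι : Type*} (s : Finset ι) (g : ι → Test) :
    conjTest (∑ i ∈ s, g i) = ∑ i ∈ s, conjTest (g i) := by
  classical
  induction s using Finset.induction_on with
  | empty => simp [conjTest]
  | insert i s hi ih => rw [Finset.sum_insert hi, Finset.sum_insert hi, conjTest_add, ih]

theorem conjTest_sigPd (a b : Fin 2) (g : Test) :
    conjTest (sigPd a b g) = sigPd b a (conjTest g) := by
  rw [sigPd_apply, sigPd_apply, conjTest_sum]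
  exact Finset.sum_congr rfl fun μ _ => by rw [conjTest_smul, conjTest_pd, conj_pauli]

theorem pauliJordan_sigPd_left (m : ℝ) (a b : Fin 2) (g h : Test) :
    pauliJordan m (sigPd a b g) h = -pauliJordan m g (sigPd a b h) := by
  simp only [← pjForm_apply, sigPd_apply, map_sum, LinearMap.sum_apply, map_smul,
    LinearMap.smul_apply]
  rw [← Finset.sum_neg_distrib]
  refine Finset.sum_congr rfl fun μ _ => ?_
  rw [pjForm_apply, pjForm_apply, pauliJordan_pd_left, smul_neg]

theorem conjTest_box (g : Test) : conjTest (box g) = box (conjTest g) :=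
  fourierM_injective fun p => by
    have : mink (-p) (-p) = mink p p := by simp [mink]
    rw [fourierM_conjTest, fourierM_box, fourierM_box, fourierM_conjTest, map_mul, this]
    simp

theorem pauliJordan_smul_right (m : ℝ) (c : ℂ) (g h : Test) :
    pauliJordan m g (c • h) = c * pauliJordan m g h := (pjForm m g).map_smul c h

theorem lorentzTest_neg_one {A : Matrix.SpecialLinearGroup (Fin 2) ℂ} (hA : A.1 = -1)
    (g : Test) : lorentzTest A g = g := by
  ext x
  rw [lorentzTest_apply]
  congr 1
  exact slash_injective (by rw [slash_lorentz, hA]; simp)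

/-! ### Super-Jacobi identities -/

section

variable {𝒜 : Type*} [Ring 𝒜]

theorem acomm_comm_jacobi (q b f : 𝒜) :
    acomm (comm q b) f + comm b (acomm q f) = acomm q (comm b f) := by
  simp only [acomm, comm]; noncomm_ring

theorem comm_comm_jacobi (z a b : 𝒜) :
    comm (comm z a) b + comm a (comm z b) = comm z (comm a b) := by
  simp only [comm]; noncomm_ring

theorem acomm_zero (a : 𝒜) : acomm a 0 = 0 := by simp [acomm]

theorem comm_add_right (a b c : 𝒜) : comm a (b + c) = comm a b + comm a c := by
  simp only [comm]; noncomm_ring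

theorem comm_neg_right (a b : 𝒜) : comm a (-b) = -comm a b := by
  simp only [comm]; noncomm_ring

theorem comm_antisymm (a b : 𝒜) : comm a b = -comm b a := by
  simp only [comm]; noncomm_ring

theorem acomm_symm (a b : 𝒜) : acomm a b = acomm b a := by
  simp only [acomm]; abel

end

section

variable {𝒜 : Type*} [Ring 𝒜] [Algebra ℂ 𝒜]

theorem comm_smul_one (z : 𝒜) (c : ℂ) : comm z (c • (1 : 𝒜)) = 0 := by simp [comm]

theorem comm_smul_left (c : ℂ) (a b : 𝒜) : comm (c • a) b = c • comm a b := by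
  simp [comm, smul_sub]

theorem comm_smul_right (c : ℂ) (a b : 𝒜) : comm a (c • b) = c • comm a b := by
  simp [comm, smul_sub]

theorem acomm_smul_left (c : ℂ) (a b : 𝒜) : acomm (c • a) b = c • acomm a b := by
  simp [acomm]

theorem sigmaField_apply (F : Test →ₗ[ℂ] 𝒜) (a b : Fin 2) (g : Test) :
    sigmaField F a b g = -F (sigPd a b g) := by
  rw [sigmaField, LinearMap.sum_apply, sigPd_apply, map_sum, ← Finset.sum_neg_distrib]
  exact Finset.sum_congr rfl fun μ _ => by simp [fieldD]

theorem smul_one_injective [Nontrivial 𝒜] {c d : ℂ} (h : c • (1 : 𝒜) = d • (1 : 𝒜)) : c = d :=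
  smul_left_injective ℂ (one_ne_zero (α := 𝒜)) h

end

section

variable {𝒜 : Type*} [Ring 𝒜] [StarRing 𝒜]

theorem star_comm (a b : 𝒜) : star (comm a b) = comm (star b) (star a) := by
  simp [comm]

theorem star_acomm (a b : 𝒜) : star (acomm a b) = acomm (star a) (star b) := by
  simp [acomm, add_comm]

/-- Conjugation with a unitary element. -/
theorem conj_comm (U : unitary 𝒜) (a b : 𝒜) :
    star (U : 𝒜) * comm a b * U
      = comm (star (U : 𝒜) * a * U) (star (U : 𝒜) * b * U) := by
  have h : (U : 𝒜) * star (U : 𝒜) = 1 := Unitary.mul_star_self_of_mem U.2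
  have e : ∀ a b : 𝒜, star (U : 𝒜) * a * U * (star (U : 𝒜) * b * U)
      = star (U : 𝒜) * (a * b) * U := fun a b => by
    calc _ = star (U : 𝒜) * a * ((U : 𝒜) * star (U : 𝒜)) * b * U := by simp only [mul_assoc]
      _ = _ := by rw [h, mul_one]; simp only [mul_assoc]
  simp only [comm]
  rw [e, e, mul_sub, sub_mul]

theorem star_conj (U : unitary 𝒜) (a : 𝒜) :
    star (star (U : 𝒜) * a * U) = star (U : 𝒜) * star a * U := by
  simp [mul_assoc]

end

section

variable {𝒜 : Type*} [Ring 𝒜] [StarRing 𝒜] [Algebra ℂ 𝒜]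

theorem conj_smul_one (U : unitary 𝒜) (c : ℂ) :
    star (U : 𝒜) * (c • (1 : 𝒜)) * U = c • (1 : 𝒜) := by
  have h : star (U : 𝒜) * (U : 𝒜) = 1 := Unitary.star_mul_self_of_mem U.2
  simp [h]

end

section

variable {𝒜 : Type*} [Ring 𝒜] [StarRing 𝒜] [Algebra ℂ 𝒜] [StarModule ℂ 𝒜]

theorem star_smul_one (c : ℂ) : star (c • (1 : 𝒜)) = (starRingEnd ℂ) c • (1 : 𝒜) := by simp

theorem adj_apply (F : Test →ₗ[ℂ] 𝒜) (g : Test) : adj F g = star (F (conjTest g)) := rfl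

theorem star_adj (F : Test →ₗ[ℂ] 𝒜) (g : Test) : star (adj F g) = F (conjTest g) := by
  rw [adj_apply, star_star]

theorem star_field (F : Test →ₗ[ℂ] 𝒜) (g : Test) : star (F g) = adj F (conjTest g) := by
  rw [adj_apply, conjTest_conjTest]

end

/-! ### Ward identities and determination of the causal brackets -/

namespace Multiplet

variable {𝒜 : Type*} [Ring 𝒜] [StarRing 𝒜] [Algebra ℂ 𝒜] [StarModule ℂ 𝒜] (M : Multiplet 𝒜)

/-- The element `-1` lies in the kernel of the covering map, so it does not move test functions and
acts only on spinor indices. -/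
theorem conj_field_neg_one {A : Matrix.SpecialLinearGroup (Fin 2) ℂ} (hA : A.1 = -1)
    (X : Comp) (g : Test) :
    star (M.L A : 𝒜) * M.field X g * M.L A
      = if X.isFermi then -M.field X g else M.field X g := by
  have hs : ∀ (ξ : Fin 2 → (Test →ₗ[ℂ] 𝒜)) (a : Fin 2) (g : Test),
      ∑ b, A.1 a b • ξ b g = -ξ a g := fun ξ a g => by
    rw [hA]
    fin_cases a <;> simp
  have hst : ∀ F : Test →ₗ[ℂ] 𝒜, ∀ g, star (M.L A : 𝒜) * adj F g * M.L A
      = star (star (M.L A : 𝒜) * F (conjTest g) * M.L A) := fun F g => by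
    rw [star_conj]; rfl
  cases X <;> simp only [field, Comp.isFermi, hst, M.L_φ, M.L_f, M.L_ψ, M.L_χ, hs,
    lorentzTest_neg_one hA] <;> simp [adj_apply]

/-- Conjugation with the unitary of `-1` fixes c-numbers but reverses this commutator, so the
c-number equals its negative. -/
theorem bose_fermi_eq_zero {m : ℝ} (hM : M.HasCausalBrackets m) {X Y : Comp}
    (hX : X.isFermi = false) (hY : Y.isFermi = true) (g h : Test) :
    comm (M.field X g) (M.field Y h) = 0 := by
  obtain ⟨A, hA⟩ : ∃ A : Matrix.SpecialLinearGroup (Fin 2) ℂ, A.1 = -1 :=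
    ⟨⟨-1, by simp [Matrix.det_neg]⟩, rfl⟩
  obtain ⟨p, hp⟩ := hM X Y
  have h1 := hp g h
  simp only [causal, hX, hY, Bool.false_and, Bool.false_eq_true, if_false] at h1
  have h2 := conj_comm (M.L A) (M.field X g) (M.field Y h)
  rw [M.conj_field_neg_one hA, M.conj_field_neg_one hA, h1, conj_smul_one, hX, hY] at h2
  simp only [Bool.false_eq_true, if_false, if_true, comm_neg_right] at h2
  rw [h1] at h2 ⊢
  have h3 : (2 : ℂ) • ((-I * pauliJordanD m p g h) • (1 : 𝒜)) = 0 := by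
    rw [two_smul]
    nth_rewrite 1 [h2]
    exact neg_add_cancel _
  exact (smul_eq_zero.1 h3).resolve_left two_ne_zero

theorem comm_Q_φ (j a k : Fin 2) (g : Test) :
    comm (M.Q j a) (M.φ k g) = (-I * eps j k) • M.ψ a g := by
  have h := M.Q_φ j a k g
  have h2 := congrArg (fun x => (-I) • x) h
  simpa [smul_smul] using h2

theorem comm_Qbar_φ (j a k : Fin 2) (g : Test) :
    comm (star (M.Q j a)) (M.φ k g) = (-I * delta j k) • adj (M.χ a) g := by
  have h := M.Qbar_φ j a k g
  have h2 := congrArg (fun x => (-I) • x) h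
  simpa [smul_smul] using h2

theorem comm_Z_φ (j : Fin 2) (g : Test) : comm M.Z (M.φ j g) = (-I) • M.f j g := by
  have h2 := congrArg (fun x => (-I) • x) (M.Z_φ j g)
  simpa [smul_smul] using h2

theorem comm_Z_f (j : Fin 2) (g : Test) : comm M.Z (M.f j g) = (-I) • M.φ j (box g) := by
  have h2 := congrArg (fun x => (-I) • x) (M.Z_f j g)
  simpa [smul_smul] using h2

/-- The coefficient is again `-I`: conjugating it and reversing the commutator with the self-adjoint
`Z` give two signs. The operator `T` is the identity for `φ_j` and `box` for `f_j`. -/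
theorem comm_Z_adj {F G : Test →ₗ[ℂ] 𝒜} {T : Test → Test}
    (hT : ∀ g, conjTest (T g) = T (conjTest g))
    (h : ∀ g, comm M.Z (F g) = (-I) • G (T g)) (g : Test) :
    comm M.Z (adj F g) = (-I) • adj G (T g) := by
  have h1 := congrArg star (h (conjTest g))
  rw [star_comm, M.Z_star, comm_antisymm, ← adj_apply] at h1
  rw [neg_eq_iff_eq_neg.1 h1, ← hT, star_smul, ← adj_apply]
  simp

theorem acomm_Qbar_ψ (j a b : Fin 2) (g : Test) :
    acomm (star (M.Q j a)) (M.ψ b g) = -∑ k, (2 * eps j k) • M.φ k (sigPd b a g) := by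
  have h := congrArg star (M.Q_ψbar j a b (conjTest g))
  rw [star_acomm, star_adj, conjTest_conjTest] at h
  rw [h]
  simp only [LinearMap.smul_apply, star_smul, star_sum, sigmaField_apply, star_neg, star_adj,
    conjTest_sigPd, conjTest_conjTest]
  simp only [RCLike.star_def, conj_eps, map_ofNat, smul_neg, Finset.sum_neg_distrib,
    Finset.smul_sum, smul_smul]

theorem acomm_Qbar_χ (j a b : Fin 2) (g : Test) :
    acomm (star (M.Q j a)) (M.χ b g) = -((2 : ℂ) • adj (M.φ j) (sigPd b a g)) := by
  have h := congrArg star (M.Q_χbar j a b (conjTest g))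
  rw [star_acomm, star_adj, conjTest_conjTest] at h
  rw [h]
  simp only [star_smul, sigmaField_apply, star_neg, star_field, conjTest_sigPd,
    conjTest_conjTest]
  simp

theorem acomm_Qbar_χbar (j a b : Fin 2) (g : Test) :
    acomm (star (M.Q j a)) (adj (M.χ b) g) = ∑ k, (2 * eps a b * eps j k) • M.f k g := by
  have h := congrArg star (M.Q_χ j a b (conjTest g))
  rw [star_acomm, star_field, conjTest_conjTest] at h
  rw [h]
  simp only [star_smul, star_sum, star_adj, conjTest_conjTest]
  simp only [RCLike.star_def, conj_eps, map_mul, map_ofNat, Finset.smul_sum, smul_smul]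

/-- A c-number commutator of two Lorentz scalars is a multiple of the Pauli–Jordan distribution. -/
theorem comm_scalar [Nontrivial 𝒜] {m : ℝ} {F G : Test →ₗ[ℂ] 𝒜}
    (hF : ∀ A g, star (M.L A : 𝒜) * F g * M.L A = F (lorentzTest A g))
    (hG : ∀ A g, star (M.L A : 𝒜) * G g * M.L A = G (lorentzTest A g))
    (h : ∃ p : MvPolynomial (Fin 4) ℂ, ∀ g h : Test,
      comm (F g) (G h) = (-I * pauliJordanD m p g h) • (1 : 𝒜)) :
    ∃ c : ℂ, ∀ g h, comm (F g) (G h) = (c * pauliJordan m g h) • (1 : 𝒜) := by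
  obtain ⟨p, hp⟩ := h
  obtain ⟨c, hc⟩ := diffOp_pauliJordan_of_invariant m p fun A g h => by
    have h1 := conj_comm (M.L A) (F g) (G h)
    rw [hF, hG, hp, hp, conj_smul_one] at h1
    exact (mul_left_cancel₀ (neg_ne_zero.2 I_ne_zero) (smul_one_injective h1)).symm
  exact ⟨-I * c, fun g h => by rw [hp, hc, mul_assoc]⟩

theorem eq_smul_one_of_smul_eq {a r : ℂ} (s : ℂ) {x : 𝒜} (ha : a ≠ 0) (h : a • x = r • (1 : 𝒜))
    (e : r = a * s) : x = s • (1 : 𝒜) := by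
  rw [e, mul_smul] at h
  exact smul_right_injective 𝒜 ha h

variable {M}

theorem CausalRelations.ext_params [Nontrivial 𝒜] {m : ℝ} {α α' : ℂ} {β β' : ℝ}
    (h : M.CausalRelations m α β) (h' : M.CausalRelations m α' β') : α = α' ∧ β = β' := by
  obtain ⟨g, k, hg⟩ := exists_pauliJordan_ne_zero m
  constructor
  · have h1 := smul_one_injective ((h.phi_f 0 1 g k).symm.trans (h'.phi_f 0 1 g k))
    simpa [eps, hg] using h1
  · have h1 := smul_one_injective ((h.phi_fStar 0 0 g k).symm.trans (h'.phi_fStar 0 0 g k))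
    simpa [delta, hg] using h1

/-- In the super-Jacobi identity for a supercharge, a scalar and a spinor the right-hand side is
zero, so each bracket of spinors is a multiple of brackets of scalars. Commuting with `Z` relates
the brackets of scalars among themselves. -/
theorem exists_causalRelations [Nontrivial 𝒜] {m : ℝ} (hM : M.HasCausalBrackets m)
    (hF : M.FreeScalars m) : ∃ (α : ℂ) (β : ℝ), M.CausalRelations m α β := by
  have hbf := fun X Y hX hY => M.bose_fermi_eq_zero hM (X := X) (Y := Y) hX hY
  have hfs : ∀ A k g, star (M.L A : 𝒜) * adj (M.f k) g * M.L A = adj (M.f k) (lorentzTest A g) :=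
    fun A k g => by
      have : conjTest (lorentzTest A g) = lorentzTest A (conjTest g) := by ext x; rfl
      rw [adj_apply, ← star_conj, M.L_f, adj_apply, this]
  -- Lorentz invariance is needed for only two brackets; the Ward identities spread these two
  -- numbers over all internal indices.
  obtain ⟨α, hα⟩ := M.comm_scalar (m := m) (M.L_φ · 0) (M.L_f · 1) (hM (.phi 0) (.f 1))
  obtain ⟨b, hb⟩ := M.comm_scalar (m := m) (M.L_φ · 1) (hfs · 1) (hM (.phi 1) (.fStar 1))
  -- Ward identities
  have w1 : ∀ j k a b g h, (-I * eps j k) • acomm (M.ψ a g) (M.ψ b h)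
      + (-2 * eps a b) • comm (M.φ k g) (M.f j h) = 0 := fun j k a b g h => by
    have := acomm_comm_jacobi (M.Q j a) (M.φ k g) (M.ψ b h)
    rwa [show comm (M.φ k g) (M.ψ b h) = 0 from
        hbf (.phi k) (.psi b) rfl rfl g h, acomm_zero, M.comm_Q_φ, M.Q_ψ, acomm_smul_left,
      comm_smul_right] at this
  have w2 : ∀ j k a b g h, (-I * eps j k) • acomm (M.ψ a g) (M.χ b h)
      + (2 * eps a b) • ∑ l, eps j l • comm (M.φ k g) (adj (M.f l) h) = 0 :=
    fun j k a b g h => by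
      have := acomm_comm_jacobi (M.Q j a) (M.φ k g) (M.χ b h)
      rw [show comm (M.φ k g) (M.χ b h) = 0 from
        hbf (.phi k) (.chi b) rfl rfl g h, acomm_zero, M.comm_Q_φ, M.Q_χ, acomm_smul_left,
        comm_smul_right] at this
      simpa [comm_add_right, comm_smul_right] using this
  have w3 : ∀ j k a b g h, (-I * eps j k) • acomm (M.ψ a g) (adj (M.ψ b) h)
      - (2 : ℂ) • ∑ l, eps j l • comm (M.φ k g) (adj (M.φ l) (sigPd a b h)) = 0 :=
    fun j k a b g h => by
      have := acomm_comm_jacobi (M.Q j a) (M.φ k g) (adj (M.ψ b) h)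
      rw [show comm (M.φ k g) (adj (M.ψ b) h) = 0 from
        hbf (.phi k) (.psiBar b) rfl rfl g h, acomm_zero, M.comm_Q_φ, M.Q_ψbar, acomm_smul_left,
        comm_smul_right] at this
      simp only [LinearMap.smul_apply, sigmaField_apply, Fin.sum_univ_two, comm_add_right,
        comm_smul_right, comm_neg_right] at this ⊢
      rw [← this]
      module
  have w4 : ∀ j k a b g h, (-I * delta j k) • acomm (adj (M.χ a) g) (M.χ b h)
      - (2 : ℂ) • comm (M.φ k g) (adj (M.φ j) (sigPd b a h)) = 0 := fun j k a b g h => by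
    have := acomm_comm_jacobi (star (M.Q j a)) (M.φ k g) (M.χ b h)
    rw [show comm (M.φ k g) (M.χ b h) = 0 from
        hbf (.phi k) (.chi b) rfl rfl g h, acomm_zero, M.comm_Qbar_φ, M.acomm_Qbar_χ,
      acomm_smul_left, comm_neg_right, comm_smul_right] at this
    rw [← this]
    module
  have w5 : ∀ j k a b g h, (-I * delta j k) • acomm (adj (M.χ a) g) (M.ψ b h) = 0 :=
    fun j k a b g h => by
      have := acomm_comm_jacobi (star (M.Q j a)) (M.φ k g) (M.ψ b h)
      rw [show comm (M.φ k g) (M.ψ b h) = 0 from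
        hbf (.phi k) (.psi b) rfl rfl g h, acomm_zero, M.comm_Qbar_φ, M.acomm_Qbar_ψ,
        acomm_smul_left] at this
      simpa [comm_neg_right, comm_add_right, comm_smul_right, hF.phi_phi] using this
  have w6 : ∀ j k a b g h, (-I * delta j k) • acomm (adj (M.χ a) g) (adj (M.χ b) h)
      + (2 * eps a b) • ∑ l, eps j l • comm (M.φ k g) (M.f l h) = 0 := fun j k a b g h => by
    have := acomm_comm_jacobi (star (M.Q j a)) (M.φ k g) (adj (M.χ b) h)
    rw [show comm (M.φ k g) (adj (M.χ b) h) = 0 from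
        hbf (.phi k) (.chiBar b) rfl rfl g h, acomm_zero, M.comm_Qbar_φ, M.acomm_Qbar_χbar,
      acomm_smul_left] at this
    rw [← this]
    simp [comm_add_right, comm_smul_right, smul_smul]
  have zφ := fun j => M.comm_Z_adj (F := M.φ j) (G := M.f j) (T := id) (fun _ => rfl)
    (M.comm_Z_φ j)
  have zf := fun j => M.comm_Z_adj (F := M.f j) (G := M.φ j) (T := box) conjTest_box
    (M.comm_Z_f j)
  -- the two families of brackets of the scalars
  have hS : ∀ g h, acomm (M.ψ 0 g) (M.ψ 1 h) = (-2 * I * α * pauliJordan m g h) • (1 : 𝒜) :=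
    fun g h => by
      have := w1 1 0 0 1 g h
      rw [hα] at this
      refine eq_smul_one_of_smul_eq (a := I) (r := 2 * (α * pauliJordan m g h)) _ I_ne_zero ?_
        (by linear_combination (2 * α * pauliJordan m g h) * I_sq)
      simp [eps] at this
      linear_combination (norm := module) this
  -- The bracket of `ψ 0` and `ψ 1` has no internal index, so the Ward identity determines all four
  -- `[φ_j, f_k]` by this single bracket.
  have phi_f : ∀ j k g h,
      comm (M.φ j g) (M.f k h) = (α * eps j k * pauliJordan m g h) • (1 : 𝒜) := fun j k g h => by
    have := w1 k j 0 1 g h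
    rw [hS] at this
    refine eq_smul_one_of_smul_eq (a := 2) (r := -I * eps k j * (-2 * I * α * pauliJordan m g h))
      _ two_ne_zero ?_ ?_
    · simp only [eps] at this ⊢
      simp at this ⊢
      linear_combination (norm := module) (-1 : ℂ) • this
    · have : eps k j = -eps j k := by fin_cases j <;> fin_cases k <;> simp [eps]
      rw [this]
      linear_combination (-2 * eps j k * α * pauliJordan m g h) * I_sq
  have hS' : ∀ g h, acomm (M.ψ 0 g) (M.χ 1 h) = (-2 * I * b * pauliJordan m g h) • (1 : 𝒜) :=
    fun g h => by
      have := w2 0 1 0 1 g h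
      rw [Fin.sum_univ_two, hb] at this
      refine eq_smul_one_of_smul_eq (a := I) (r := 2 * (b * pauliJordan m g h)) _ I_ne_zero ?_
        (by linear_combination (2 * b * pauliJordan m g h) * I_sq)
      simp [eps] at this
      linear_combination (norm := module) (-1 : ℂ) • this
  -- The sum over `l` contains `eps j l`, so each of the two values of `j` isolates one `f_l*`;
  -- again the bracket of spinors is blind to the internal index.
  have phi_fStar : ∀ j k g h,
      comm (M.φ j g) (adj (M.f k) h) = (b * delta j k * pauliJordan m g h) • (1 : 𝒜) :=
    fun j k g h => by
      have h0 := w2 0 j 0 1 g h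
      have h1 := w2 1 j 0 1 g h
      rw [hS', Fin.sum_univ_two] at h0 h1
      refine eq_smul_one_of_smul_eq (a := 2) (r := 2 * (b * delta j k * pauliJordan m g h))
        _ two_ne_zero ?_ rfl
      fin_cases j <;> fin_cases k <;> simp [eps, delta, smul_smul] at h0 h1 ⊢
      · linear_combination (norm := module) (-1 : ℂ) • h1 - (2 * b * pauliJordan m g h * I_sq) • (1 : 𝒜)
      · exact h0
      · exact h1
      · linear_combination (norm := module) h0 - (2 * b * pauliJordan m g h * I_sq) • (1 : 𝒜)
  -- Since `[φ, φ*]` is a c-number, commuting it with `Z` gives `[f, φ*] + [φ, f*] = 0`.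
  have z3 : ∀ g h, comm (M.f 1 g) (adj (M.φ 1) h) = (-b * pauliJordan m g h) • (1 : 𝒜) :=
    fun g h => by
      have := comm_comm_jacobi M.Z (M.φ 1 g) (adj (M.φ 1) h)
      rw [hF.phi_phiStar, comm_smul_one, M.comm_Z_φ, zφ, comm_smul_left, comm_smul_right] at this
      simp only [id] at this
      rw [hb, ← smul_add] at this
      have := (smul_eq_zero.1 this).resolve_left (neg_ne_zero.2 I_ne_zero)
      rw [eq_neg_of_add_eq_zero_left this, ← neg_smul]
      congr 1
      ring
  -- The adjoint of `[φ, f*]` is `[f, φ*]`. Comparison with `z3`, by reality and antisymmetry of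
  -- `D_m`, yields `b̄ = b`.
  obtain ⟨β, rfl⟩ : ∃ β : ℝ, (β : ℂ) = b := by
    obtain ⟨g, h, hD⟩ := exists_pauliJordan_ne_zero m
    have e := congrArg star (hb (conjTest g) (conjTest h))
    rw [star_comm, star_adj, conjTest_conjTest, star_field, conjTest_conjTest, z3, star_smul_one,
      pauliJordan_conjTest, pauliJordan_antisymm] at e
    have e := smul_one_injective e
    simp only [map_mul, conj_conj] at e
    have : (starRingEnd ℂ) b = b := mul_right_cancel₀ hD (by linear_combination -e)
    exact conj_eq_iff_real.1 this |>.imp fun _ h => h.symm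
  refine ⟨α, β, ?_⟩
  exact
  { f_fStar := fun j k g h => by
      -- Commuting the c-number `[φ, f*]` with `Z` gives `[f, f*] = -[φ, box φ*]`, and `box` acts on
      -- `D_m` as `-m²`.
      have := comm_comm_jacobi M.Z (M.φ j g) (adj (M.f k) h)
      rw [phi_fStar, comm_smul_one, M.comm_Z_φ, zf, comm_smul_left, comm_smul_right,
        hF.phi_phiStar, ← smul_add] at this
      have := (smul_eq_zero.1 this).resolve_left (neg_ne_zero.2 I_ne_zero)
      rw [eq_neg_of_add_eq_zero_left this, ← neg_smul, pauliJordan_box_right]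
      congr 1
      ring
    phi_f := phi_f
    phi_fStar := phi_fStar
    psi_psi := fun a b g h => by
      have := w1 1 0 a b g h
      rw [hα] at this
      refine eq_smul_one_of_smul_eq (a := I) (r := 2 * eps a b * (α * pauliJordan m g h)) _
        I_ne_zero ?_ (by linear_combination (2 * eps a b * α * pauliJordan m g h) * I_sq)
      have e : eps 1 0 = -1 := by simp [eps]
      rw [e] at this
      linear_combination (norm := module) this
    psi_psiBar := fun a b g h => by
      have := w3 1 0 a b g h
      rw [Fin.sum_univ_two, hF.phi_phiStar, hF.phi_phiStar] at this
      refine eq_smul_one_of_smul_eq (a := I) (r := 2 * I * pauliJordan m g (sigPd a b h)) _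
        I_ne_zero ?_ (by rw [pauliJordanD, diffOp_sigmaD]; ring)
      simp [eps, delta] at this
      linear_combination (norm := module) this
    chi_chi := fun a b g h => by
      -- The Ward identity determines the bracket of `χ̄` with itself by `α`; the adjoint introduces
      -- the conjugate of `α`.
      have := w6 0 0 a b (conjTest g) (conjTest h)
      rw [Fin.sum_univ_two, phi_f, phi_f] at this
      have e : acomm (adj (M.χ a) (conjTest g)) (adj (M.χ b) (conjTest h))
          = (-2 * I * α * eps a b * pauliJordan m (conjTest g) (conjTest h)) • (1 : 𝒜) := by
        refine eq_smul_one_of_smul_eq (a := I)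
          (r := 2 * eps a b * (α * pauliJordan m (conjTest g) (conjTest h))) _
          I_ne_zero ?_ (by
            linear_combination (2 * eps a b * α *
              pauliJordan m (conjTest g) (conjTest h)) * I_sq)
        have e1 : eps 0 0 = 0 := by simp [eps]
        have e2 : eps 0 1 = 1 := by simp [eps]
        have e3 : delta 0 0 = 1 := by simp [delta]
        rw [e1, e2, e3] at this
        linear_combination (norm := module) (-1 : ℂ) • this
      have e := congrArg star e
      rw [star_acomm, star_adj, star_adj, conjTest_conjTest, conjTest_conjTest, star_smul_one,
        pauliJordan_conjTest] at e
      rw [e]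
      congr 1
      simp only [map_mul, map_neg, conj_I, map_ofNat, conj_conj, conj_eps]
      ring
    chi_chiBar := fun a b g h => by
      have := w4 0 0 b a h g
      rw [hF.phi_phiStar] at this
      rw [acomm_symm]
      refine eq_smul_one_of_smul_eq (a := I) (r := 2 * I * pauliJordan m h (sigPd a b g)) _
        I_ne_zero ?_ ?_
      · simp [delta] at this
        linear_combination (norm := module) (-1 : ℂ) • this
      · rw [pauliJordanD, diffOp_sigmaD, pauliJordan_antisymm, pauliJordan_sigPd_left]
        ring
    psi_chi := fun a b g h => by
      have := w2 0 1 a b g h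
      rw [Fin.sum_univ_two, hb] at this
      refine eq_smul_one_of_smul_eq (a := I) (r := 2 * eps a b * (β * pauliJordan m g h)) _
        I_ne_zero ?_ (by linear_combination (2 * eps a b * β * pauliJordan m g h) * I_sq)
      have e1 : eps 0 0 = 0 := by simp [eps]
      have e2 : eps 0 1 = 1 := by simp [eps]
      rw [e1, e2] at this
      linear_combination (norm := module) (-1 : ℂ) • this
    f_f := fun j k g h => by
      have := comm_comm_jacobi M.Z (M.φ j g) (M.f k h)
      rw [phi_f, comm_smul_one, M.comm_Z_φ, M.comm_Z_f, comm_smul_left, comm_smul_right,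
        hF.phi_phi, smul_zero, add_zero] at this
      exact (smul_eq_zero.1 this).resolve_left (neg_ne_zero.2 I_ne_zero)
    psi_chiBar := fun a b g h => by
      have := w5 0 0 b a h g
      rw [acomm_symm]
      refine (smul_eq_zero.1 this).resolve_left ?_
      simp [delta]
    bose_fermi := hbf }

theorem existsUnique_causalRelations [Nontrivial 𝒜] {m : ℝ} (hM : M.HasCausalBrackets m)
    (hF : M.FreeScalars m) : ∃! p : ℂ × ℝ, M.CausalRelations m p.1 p.2 := by
  obtain ⟨α, β, h⟩ := exists_causalRelations hM hF
  exact ⟨(α, β), h, fun p hp => Prod.ext (hp.ext_params h).1 (hp.ext_params h).2⟩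

end Multiplet

end Hyper

namespace Hyper

/-! ### Supersymmetric Fock space -/

/-- The sign `(-1)^b`. -/
def sgn (b : Bool) : ℂ := if b then -1 else 1

@[simp] theorem sgn_true : sgn true = -1 := rfl

@[simp] theorem sgn_false : sgn false = 1 := rfl

theorem sgn_mul_self (b : Bool) : sgn b * sgn b = 1 := by cases b <;> simp

/-- A `ℤ/2`-graded complex vector space; `proj q` is the projection to the part of parity `q`
(`true` is odd). -/
structure SuperSpace (E : Type) [AddCommGroup E] [Module ℂ E] where
  part : Bool → Submodule ℂ E
  proj : Bool → Module.End ℂ E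
  proj_mem : ∀ q x, proj q x ∈ part q
  proj_of_mem : ∀ q x, x ∈ part q → ∀ r, proj r x = if r = q then x else 0
  proj_add : ∀ x, proj false x + proj true x = x

namespace SuperSpace

variable {E : Type} [AddCommGroup E] [Module ℂ E] (G : SuperSpace E)

/-- The relations of graded commutativity. -/
inductive Rel : TensorAlgebra ℂ E → TensorAlgebra ℂ E → Prop
  | swap (q r : Bool) (x y : E) (hx : x ∈ G.part q) (hy : y ∈ G.part r) :
      Rel (TensorAlgebra.ι ℂ x * TensorAlgebra.ι ℂ y)
        (sgn (q && r) • (TensorAlgebra.ι ℂ y * TensorAlgebra.ι ℂ x))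

/-- The free graded commutative algebra on a graded vector space. -/
def Sym : Type := RingQuot G.Rel

noncomputable instance : Ring G.Sym := inferInstanceAs (Ring (RingQuot G.Rel))

noncomputable instance : Algebra ℂ G.Sym := inferInstanceAs (Algebra ℂ (RingQuot G.Rel))

/-- The projection from the tensor algebra. -/
noncomputable def ofTensor : TensorAlgebra ℂ E →ₐ[ℂ] G.Sym := RingQuot.mkAlgHom ℂ G.Rel

theorem ofTensor_surjective : Function.Surjective G.ofTensor := RingQuot.mkAlgHom_surjective ℂ G.Rel

/-- The inclusion of the generators. -/
noncomputable def gen : E →ₗ[ℂ] G.Sym :=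
  G.ofTensor.toLinearMap ∘ₗ TensorAlgebra.ι ℂ

theorem gen_mul_gen {q r : Bool} {x y : E} (hx : x ∈ G.part q) (hy : y ∈ G.part r) :
    G.gen x * G.gen y = sgn (q && r) • (G.gen y * G.gen x) := by
  have : G.ofTensor _ = G.ofTensor _ := RingQuot.mkAlgHom_rel ℂ (Rel.swap (G := G) q r x y hx hy)
  simpa [gen] using this

/-- Graded commutative algebras receive maps from `Sym`. -/
noncomputable def lift {R : Type} [Ring R] [Algebra ℂ R] (f : E →ₗ[ℂ] R)
    (hf : ∀ q r x y, x ∈ G.part q → y ∈ G.part r → f x * f y = sgn (q && r) • (f y * f x)) :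
    G.Sym →ₐ[ℂ] R :=
  RingQuot.liftAlgHom ℂ ⟨TensorAlgebra.lift ℂ f, fun _ _ h => by
    induction h with
    | swap q r x y hx hy => simpa using hf q r x y hx hy⟩

@[simp] theorem lift_gen {R : Type} [Ring R] [Algebra ℂ R] (f : E →ₗ[ℂ] R)
    (hf : ∀ q r x y, x ∈ G.part q → y ∈ G.part r → f x * f y = sgn (q && r) • (f y * f x))
    (x : E) : G.lift f hf (G.gen x) = f x := by
  refine (RingQuot.liftAlgHom_mkAlgHom_apply ℂ _ _ _).trans ?_
  simp

theorem part_induction {P : E → Prop} (hadd : ∀ x y, P x → P y → P (x + y))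
    (h : ∀ q, ∀ x ∈ G.part q, P x) (x : E) : P x := by
  rw [← G.proj_add x]
  exact hadd _ _ (h _ _ (G.proj_mem _ _)) (h _ _ (G.proj_mem _ _))

/-- The vacuum and left multiplications by homogeneous generators exhaust the algebra. This is the
induction principle for everything defined on `Sym`. -/
theorem eq_top_of_gen_mul_mem (N : Submodule ℂ G.Sym) (one : 1 ∈ N)
    (mul : ∀ q, ∀ e ∈ G.part q, ∀ a ∈ N, G.gen e * a ∈ N) : N = ⊤ := by
  have mul' : ∀ e, ∀ a ∈ N, G.gen e * a ∈ N := fun e a ha => by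
    refine G.part_induction (P := fun e => G.gen e * a ∈ N) (fun x y hx hy => ?_)
      (fun q x hx => mul q x hx a ha) e
    rw [map_add, add_mul]
    exact N.add_mem hx hy
  have key : ∀ b : TensorAlgebra ℂ E, ∀ a ∈ N, G.ofTensor b * a ∈ N := fun b => by
    induction b using TensorAlgebra.induction with
    | algebraMap r =>
      intro a ha
      rw [AlgHom.commutes, ← Algebra.smul_def]
      exact N.smul_mem _ ha
    | ι x => exact fun a ha => mul' x a ha
    | mul x y hx hy =>
      intro a ha
      rw [map_mul, mul_assoc]
      exact hx _ (hy _ ha)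
    | add x y hx hy =>
      intro a ha
      rw [map_add, add_mul]
      exact N.add_mem (hx _ ha) (hy _ ha)
  refine eq_top_iff.2 fun a _ => ?_
  obtain ⟨b, rfl⟩ := G.ofTensor_surjective a
  simpa using key b 1 one

/-- Applied to a difference of two operators: if they agree on the vacuum and pass a generator by
the same rule, they are equal. All operator identities on Fock space are reduced in this way to one
generator. -/
theorem end_eq_zero {O : Module.End ℂ G.Sym} (one : O 1 = 0)
    (mul : ∀ q, ∀ e ∈ G.part q, ∃ b : G.Sym, ∀ a, O (G.gen e * a) = b * O a) : O = 0 := by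
  refine LinearMap.ker_eq_top.1 (G.eq_top_of_gen_mul_mem _ one fun q e he a ha => ?_)
  obtain ⟨b, hb⟩ := mul q e he
  rw [LinearMap.mem_ker] at ha ⊢
  rw [hb, ha, mul_zero]

/-! #### Graded derivations -/

/-- The condition under which `d` extends to a graded derivation of parity `p`. -/
def Compat (p : Bool) (d : E →ₗ[ℂ] G.Sym) : Prop :=
  ∀ q r x y, x ∈ G.part q → y ∈ G.part r →
    d x * G.gen y + sgn (p && q) • (G.gen x * d y)
      = sgn (q && r) • (d y * G.gen x + sgn (p && r) • (G.gen y * d x))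

/-- The sign `(-1)^p` on the odd part. -/
noncomputable def twist (p : Bool) : Module.End ℂ E := G.proj false + sgn p • G.proj true

theorem twist_of_mem (p : Bool) {q : Bool} {x : E} (hx : x ∈ G.part q) :
    G.twist p x = sgn (p && q) • x := by
  cases q <;> simp [twist, G.proj_of_mem _ x hx]

/-- The matrices `[[±x, d x], [0, x]]`. -/
noncomputable def derMatrix (p : Bool) (d : E →ₗ[ℂ] G.Sym) :
    E →ₗ[ℂ] Matrix (Fin 2) (Fin 2) G.Sym where
  toFun x := !![G.gen (G.twist p x), d x; 0, G.gen x]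
  map_add' x y := by
    ext i j; fin_cases i <;> fin_cases j <;> simp
  map_smul' c x := by
    ext i j; fin_cases i <;> fin_cases j <;> simp

/-- A graded derivation `D` is the same as an algebra homomorphism of the form `a ↦ [[±a, D a], [0,
a]]`. The condition `Compat` says that the matrices of the generators satisfy the defining
relations, so the universal property supplies the homomorphism, and `D` is its upper right entry. -/
theorem exists_der {p : Bool} {d : E →ₗ[ℂ] G.Sym} (h : G.Compat p d) :
    ∃ D : Module.End ℂ G.Sym, D 1 = 0 ∧ ∀ q, ∀ e ∈ G.part q, ∀ a,
      D (G.gen e * a) = d e * a + sgn (p && q) • (G.gen e * D a) := by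
  let F := G.lift (G.derMatrix p d) (fun q r x y hx hy => by
    have h1 := G.gen_mul_gen hx hy
    have h2 := h q r x y hx hy
    simp only [derMatrix, LinearMap.coe_mk, AddHom.coe_mk, G.twist_of_mem p hx,
      G.twist_of_mem p hy, Matrix.mul_fin_two, map_smul, zero_mul, mul_zero, add_zero, zero_add,
      smul_mul_assoc, mul_smul_comm]
    ext i j
    fin_cases i <;> fin_cases j <;> simp
    · rw [h1, smul_comm (sgn (p && r)), smul_comm (sgn (q && r)), smul_comm (sgn (q && r))]
    · rw [add_comm, h2, add_comm (d y * G.gen x), smul_add]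
    · exact h1)
  have hF : ∀ e, F (G.gen e) = G.derMatrix p d e := fun e => G.lift_gen _ _ e
  -- The lower row keeps its form under products, so it suffices to look at the unit and at
  -- multiplication by a generator.
  have key : ∀ a, F a 1 0 = 0 ∧ F a 1 1 = a := by
    let N : Submodule ℂ G.Sym :=
      { carrier := {a | F a 1 0 = 0 ∧ F a 1 1 = a}
        add_mem' := fun {a b} ha hb => by simp [ha.1, ha.2, hb.1, hb.2]
        zero_mem' := by simp
        smul_mem' := fun c a ha => by simp [ha.1, ha.2] }
    have hN : N = ⊤ := G.eq_top_of_gen_mul_mem N (by simp [N]) fun q e he a ha => by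
      have h0 : F a 1 0 = 0 := ha.1
      have h1 : F a 1 1 = a := ha.2
      simp [N, hF, derMatrix, Matrix.mul_apply, Fin.sum_univ_two, h0, h1]
    exact fun a => (hN ▸ Submodule.mem_top : a ∈ N)
  refine ⟨{ toFun := fun a => F a 0 1
            map_add' := fun a b => by simp
            map_smul' := fun c a => by simp }, by simp, fun q e he a => ?_⟩
  simp only [LinearMap.coe_mk, AddHom.coe_mk, map_mul, hF, Matrix.mul_apply, Fin.sum_univ_two,
    (key a).2]
  simp [derMatrix, G.twist_of_mem p he, add_comm]

open Classical in
/-- The graded derivation of parity `p` with the given values on the generators. -/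
noncomputable def der (p : Bool) (d : E →ₗ[ℂ] G.Sym) : Module.End ℂ G.Sym :=
  if h : G.Compat p d then (G.exists_der h).choose else 0

theorem der_one (p : Bool) (d : E →ₗ[ℂ] G.Sym) : G.der p d 1 = 0 := by
  unfold der
  split_ifs with h
  · exact (G.exists_der h).choose_spec.1
  · rfl

theorem der_gen_mul {p : Bool} {d : E →ₗ[ℂ] G.Sym} (h : G.Compat p d) {q : Bool} {e : E}
    (he : e ∈ G.part q) (a : G.Sym) :
    G.der p d (G.gen e * a) = d e * a + sgn (p && q) • (G.gen e * G.der p d a) := by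
  unfold der
  rw [dif_pos h]
  exact (G.exists_der h).choose_spec.2 q e he a

theorem eq_of_gen_mul {p : Bool} {d : E → G.Sym} {D D' : Module.End ℂ G.Sym}
    (h1 : D 1 = 0) (h1' : D' 1 = 0)
    (h : ∀ q, ∀ e ∈ G.part q, ∀ a, D (G.gen e * a) = d e * a + sgn (p && q) • (G.gen e * D a))
    (h' : ∀ q, ∀ e ∈ G.part q, ∀ a,
      D' (G.gen e * a) = d e * a + sgn (p && q) • (G.gen e * D' a)) : D = D' := by
  refine sub_eq_zero.1 (G.end_eq_zero (by simp [h1, h1']) fun q e he =>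
    ⟨sgn (p && q) • G.gen e, fun a => ?_⟩)
  simp [h q e he, h' q e he, mul_sub, smul_sub]

theorem compat_add {p : Bool} {d d' : E →ₗ[ℂ] G.Sym} (h : G.Compat p d) (h' : G.Compat p d') :
    G.Compat p (d + d') := fun q r x y hx hy => by
  have := congrArg₂ (· + ·) (h q r x y hx hy) (h' q r x y hx hy)
  simp only [← smul_add] at this
  simp only [LinearMap.add_apply, add_mul, mul_add]
  convert this using 1
  · simp only [smul_add]; abel
  · simp only [smul_add]; abel

theorem compat_smul {p : Bool} {d : E →ₗ[ℂ] G.Sym} (c : ℂ) (h : G.Compat p d) :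
    G.Compat p (c • d) := fun q r x y hx hy => by
  have := congrArg (c • ·) (h q r x y hx hy)
  simp only [smul_add, LinearMap.smul_apply, smul_mul_assoc, mul_smul_comm] at this ⊢
  simpa only [smul_comm c] using this

theorem der_add {p : Bool} {d d' : E →ₗ[ℂ] G.Sym} (h : G.Compat p d) (h' : G.Compat p d') :
    G.der p (d + d') = G.der p d + G.der p d' :=
  G.eq_of_gen_mul (p := p) (d := d + d') (G.der_one _ _) (by simp [G.der_one])
    (fun q e he a => G.der_gen_mul (G.compat_add h h') he a) fun q e he a => by
      simp [G.der_gen_mul h he, G.der_gen_mul h' he, add_mul, mul_add, smul_add]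
      abel

theorem der_smul {p : Bool} {d : E →ₗ[ℂ] G.Sym} (c : ℂ) (h : G.Compat p d) :
    G.der p (c • d) = c • G.der p d :=
  G.eq_of_gen_mul (p := p) (d := c • d) (G.der_one _ _) (by simp [G.der_one])
    (fun q e he a => G.der_gen_mul (G.compat_smul c h) he a) fun q e he a => by
      simp [G.der_gen_mul h he, smul_comm c]

/-- Linear operators of parity `p`. -/
def endPart (p : Bool) : Submodule ℂ (Module.End ℂ E) where
  carrier := {δ | ∀ q, ∀ x ∈ G.part q, δ x ∈ G.part (p ^^ q)}
  add_mem' h h' q x hx := add_mem (h q x hx) (h' q x hx)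
  zero_mem' _ _ _ := zero_mem _
  smul_mem' c _ h q x hx := Submodule.smul_mem _ c (h q x hx)

theorem compat_end {p : Bool} {δ : Module.End ℂ E} (h : δ ∈ G.endPart p) :
    G.Compat p (G.gen ∘ₗ δ) := fun q r x y hx hy => by
  simp only [LinearMap.comp_apply]
  rw [G.gen_mul_gen (h q x hx) hy, G.gen_mul_gen hx (h r y hy), add_comm]
  cases p <;> cases q <;> cases r <;> simp

/-- The second quantization of an operator of parity `p`. -/
noncomputable def secondQuant (p : Bool) (δ : Module.End ℂ E) : Module.End ℂ G.Sym :=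
  G.der p (G.gen ∘ₗ δ)

theorem secondQuant_one (p : Bool) (δ : Module.End ℂ E) : G.secondQuant p δ 1 = 0 :=
  G.der_one _ _

theorem secondQuant_gen_mul {p : Bool} {δ : Module.End ℂ E} (h : δ ∈ G.endPart p) {q : Bool}
    {e : E} (he : e ∈ G.part q) (a : G.Sym) : G.secondQuant p δ (G.gen e * a)
      = G.gen (δ e) * a + sgn (p && q) • (G.gen e * G.secondQuant p δ a) :=
  G.der_gen_mul (G.compat_end h) he a

theorem secondQuant_add {p : Bool} {δ δ' : Module.End ℂ E} (h : δ ∈ G.endPart p)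
    (h' : δ' ∈ G.endPart p) :
    G.secondQuant p (δ + δ') = G.secondQuant p δ + G.secondQuant p δ' := by
  rw [secondQuant, LinearMap.comp_add, G.der_add (G.compat_end h) (G.compat_end h')]
  rfl

theorem secondQuant_smul {p : Bool} {δ : Module.End ℂ E} (c : ℂ) (h : δ ∈ G.endPart p) :
    G.secondQuant p (c • δ) = c • G.secondQuant p δ := by
  rw [secondQuant, LinearMap.comp_smul, G.der_smul c (G.compat_end h)]
  rfl

theorem secondQuant_zero (p : Bool) : G.secondQuant p 0 = 0 := by
  simpa using G.secondQuant_smul (p := p) 0 (zero_mem _)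

/-- A graded commutator of graded derivations is a graded derivation, hence determined by its values
on generators, where it is the one-particle commutator. -/
theorem secondQuant_bracket {p r : Bool} {δ ε η : Module.End ℂ E} (hδ : δ ∈ G.endPart p)
    (hε : ε ∈ G.endPart r) (hη : η ∈ G.endPart (p ^^ r)) (h : δ * ε - sgn (p && r) • (ε * δ) = η) :
    G.secondQuant p δ * G.secondQuant r ε - sgn (p && r) • (G.secondQuant r ε * G.secondQuant p δ)
      = G.secondQuant (p ^^ r) η := by
  refine G.eq_of_gen_mul (p := p ^^ r) (d := fun e => G.gen (η e)) ?_ (G.secondQuant_one _ _) ?_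
    fun q e he a => G.secondQuant_gen_mul hη he a
  · simp [secondQuant_one]
  · intro q e he a
    have hη' : η e = δ (ε e) - sgn (p && r) • ε (δ e) := by rw [← h]; rfl
    simp only [LinearMap.sub_apply, LinearMap.smul_apply, Module.End.mul_apply,
      G.secondQuant_gen_mul hδ he, G.secondQuant_gen_mul hε he, map_add, map_smul,
      G.secondQuant_gen_mul hδ (hε q e he), G.secondQuant_gen_mul hε (hδ q e he), hη', map_sub,
      sub_mul, mul_sub, mul_smul_comm, smul_mul_assoc]
    cases p <;> cases q <;> cases r <;> simp <;> module

/-! #### Creation and annihilation operators -/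

/-- An even graded antisymmetric bilinear form. -/
structure Form where
  form : E →ₗ[ℂ] E →ₗ[ℂ] ℂ
  even : ∀ q r x y, x ∈ G.part q → y ∈ G.part r → q ≠ r → form x y = 0
  symm : ∀ q x y, x ∈ G.part q → y ∈ G.part q → form y x = -sgn q * form x y

/-- The creation operators. -/
noncomputable def create : E →ₗ[ℂ] Module.End ℂ G.Sym := LinearMap.mul ℂ G.Sym ∘ₗ G.gen

@[simp] theorem create_apply (x : E) (a : G.Sym) : G.create x a = G.gen x * a := rfl

variable {G} (B : G.Form)

namespace Form

/-- The values of annihilation operators on generators. -/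
noncomputable def contract (p : Bool) : E →ₗ[ℂ] E →ₗ[ℂ] G.Sym :=
  (B.form.compr₂ (Algebra.linearMap ℂ G.Sym)) ∘ₗ G.proj p

theorem contract_apply (p : Bool) (x e : E) :
    B.contract p x e = algebraMap ℂ G.Sym (B.form (G.proj p x) e) := rfl

/-- The values are scalars and vanish off parity `p`, because the form is even; what remains is
bookkeeping of signs. -/
theorem compat_contract (p : Bool) (x : E) : G.Compat p (B.contract p x) :=
  fun q r y z hy hz => by
    simp only [contract_apply, ← Algebra.commutes, ← Algebra.smul_def, smul_smul]
    have hp := G.proj_mem p x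
    by_cases h1 : p = q
    · by_cases h2 : p = r
      · subst h1; subst h2
        simp only [smul_add, smul_smul, Bool.and_self]
        rw [← mul_assoc, sgn_mul_self, one_mul, add_comm]
      · subst h1
        rw [B.even _ _ _ _ hp hz h2]
        cases p <;> cases r <;> first | exact absurd rfl h2 | simp
    · rw [B.even _ _ _ _ hp hy h1]
      by_cases h2 : p = r
      · subst h2
        cases p <;> cases q <;> first | exact absurd rfl h1 | simp
      · rw [B.even _ _ _ _ hp hz h2]
        simp

/-- The annihilation operators. -/
noncomputable def ann (p : Bool) : E →ₗ[ℂ] Module.End ℂ G.Sym where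
  toFun x := G.der p (B.contract p x)
  map_add' x y := by
    rw [map_add, G.der_add (B.compat_contract p x) (B.compat_contract p y)]
  map_smul' c x := by
    rw [map_smul, G.der_smul c (B.compat_contract p x), RingHom.id_apply]

theorem ann_apply (p : Bool) (x : E) : B.ann p x = G.der p (B.contract p x) := rfl

theorem ann_of_mem {q : Bool} {x : E} (hx : x ∈ G.part q) (p : Bool) :
    B.ann p x = if p = q then B.ann q x else 0 := by
  split_ifs with h
  · rw [h]
  · have h0 : B.ann p 0 = 0 := map_zero _
    rw [ann_apply] at h0 ⊢
    rw [show B.contract p x = B.contract p 0 by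
      ext e
      simp [contract_apply, G.proj_of_mem _ _ hx, h], h0]

theorem ann_one (p : Bool) (x : E) : B.ann p x 1 = 0 := G.der_one _ _

theorem ann_gen_mul {p q : Bool} {x e : E} (hx : x ∈ G.part p) (he : e ∈ G.part q) (a : G.Sym) :
    B.ann p x (G.gen e * a) = B.form x e • a + sgn (p && q) • (G.gen e * B.ann p x a) := by
  rw [ann_apply, G.der_gen_mul (B.compat_contract p x) he, contract_apply, ← Algebra.smul_def,
    G.proj_of_mem _ _ hx, if_pos rfl]

/-- The field operators. -/
noncomputable def op : E →ₗ[ℂ] Module.End ℂ G.Sym :=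
  G.create + (2⁻¹ : ℂ) • (B.ann false + B.ann true)

theorem op_of_mem {q : Bool} {x : E} (hx : x ∈ G.part q) :
    B.op x = G.create x + (2⁻¹ : ℂ) • B.ann q x := by
  simp only [op, LinearMap.add_apply, LinearMap.smul_apply]
  rw [B.ann_of_mem hx false, B.ann_of_mem hx true]
  cases q <;> simp

theorem op_apply_one (x : E) : B.op x 1 = G.gen x := by
  simp [op, ann_one]

theorem ann_bracket {q r : Bool} {x y : E} (hx : x ∈ G.part q) (hy : y ∈ G.part r) :
    B.ann q x * B.ann r y = sgn (q && r) • (B.ann r y * B.ann q x) := by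
  refine sub_eq_zero.1 (G.end_eq_zero (O := _ - _) (by simp [ann_one]) fun t e he =>
    ⟨(sgn (q && t) * sgn (r && t)) • G.gen e, fun a => ?_⟩)
  simp only [LinearMap.sub_apply, LinearMap.smul_apply, Module.End.mul_apply,
    B.ann_gen_mul hx he, B.ann_gen_mul hy he, map_add, map_smul, smul_mul_assoc, mul_sub,
    mul_smul_comm]
  by_cases h1 : q = t
  · by_cases h2 : r = t
    · subst h1; subst h2
      cases r <;> simp <;> module
    · rw [B.even _ _ _ _ hy he h2]
      cases q <;> cases r <;> cases t <;>
        first | exact absurd h1 (by decide) | exact absurd rfl h2 | simp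
  · rw [B.even _ _ _ _ hx he h1]
    by_cases h2 : r = t
    · cases q <;> cases r <;> cases t <;>
        first | exact absurd rfl h1 | exact absurd h2 (by decide) | simp
    · rw [B.even _ _ _ _ hy he h2]
      cases q <;> cases r <;> cases t <;>
        first | exact absurd rfl h1 | exact absurd rfl h2 | simp

theorem create_ann {p q : Bool} {x e : E} (hx : x ∈ G.part p) (he : e ∈ G.part q) :
    B.ann p x * G.create e = B.form x e • 1 + sgn (p && q) • (G.create e * B.ann p x) := by
  ext a
  exact B.ann_gen_mul hx he a

theorem create_mul_create {q r : Bool} {x y : E} (hx : x ∈ G.part q) (hy : y ∈ G.part r) :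
    G.create x * G.create y = sgn (q && r) • (G.create y * G.create x) := by
  ext a
  simp only [Module.End.mul_apply, create_apply, LinearMap.smul_apply, ← mul_assoc]
  rw [G.gen_mul_gen hx hy, smul_mul_assoc]

/-- Creation operators graded commute among themselves, and so do annihilation operators. The two
mixed terms contribute `½ form x y` and `-½ (±form y x)`, which add up to `form x y` by graded
antisymmetry. This explains the factor `½` and avoids any splitting into positive and negative
frequencies. -/
theorem op_bracket {q r : Bool} {x y : E} (hx : x ∈ G.part q) (hy : y ∈ G.part r) :
    B.op x * B.op y - sgn (q && r) • (B.op y * B.op x) = B.form x y • 1 := by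
  have h1 := create_mul_create (G := G) hx hy
  have h2 := B.create_ann hx hy
  have h3 := B.create_ann hy hx
  have h4 := B.ann_bracket hx hy
  rw [B.op_of_mem hx, B.op_of_mem hy]
  simp only [add_mul, mul_add, smul_mul_assoc, mul_smul_comm, h1, h2, h3, h4]
  have hs : q = r → B.form y x = -sgn q * B.form x y := fun h => B.symm q x y hx (h ▸ hy)
  have h5 : q ≠ r → B.form x y = 0 := B.even _ _ _ _ hx hy
  have h6 : r ≠ q → B.form y x = 0 := B.even _ _ _ _ hy hx
  cases q <;> cases r <;> simp at hs h5 h6 ⊢ <;> simp [*] <;> module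

/-- Operators of parity `p` that preserve the form. -/
def Skew (p : Bool) (δ : Module.End ℂ E) : Prop :=
  ∀ q, ∀ x ∈ G.part q, ∀ y, B.form (δ x) y + sgn (p && q) * B.form x (δ y) = 0

/-- Both sides are graded derivations. On a generator `e` the left side gives `∓form x (δ e)`, and
skewness turns this into `form (δ x) e`. -/
theorem secondQuant_ann {p q : Bool} {δ : Module.End ℂ E} (hδ : δ ∈ G.endPart p)
    (hs : B.Skew p δ) {x : E} (hx : x ∈ G.part q) :
    G.secondQuant p δ * B.ann q x - sgn (p && q) • (B.ann q x * G.secondQuant p δ)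
      = B.ann (p ^^ q) (δ x) := by
  refine G.eq_of_gen_mul (p := p ^^ q) (d := fun e => algebraMap ℂ _ (B.form (δ x) e)) ?_
    (B.ann_one _ _) ?_ fun t e he a => by rw [B.ann_gen_mul (hδ q x hx) he, Algebra.smul_def]
  · simp [secondQuant_one, ann_one]
  · intro t e he a
    have h1 := hs q x hx e
    rw [← Algebra.smul_def, eq_neg_of_add_eq_zero_left h1]
    simp only [LinearMap.sub_apply, LinearMap.smul_apply, Module.End.mul_apply,
      B.ann_gen_mul hx he, G.secondQuant_gen_mul hδ he, map_add, map_smul,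
      B.ann_gen_mul hx (hδ t e he), mul_sub, mul_smul_comm]
    by_cases h : q = t
    · subst h
      cases p <;> cases q <;> simp <;> module
    · rw [B.even _ _ _ _ hx he h]
      cases p <;> cases q <;> cases t <;> first | exact absurd rfl h | (simp <;> module)

theorem secondQuant_op {p q : Bool} {δ : Module.End ℂ E} (hδ : δ ∈ G.endPart p)
    (hs : B.Skew p δ) {x : E} (hx : x ∈ G.part q) :
    G.secondQuant p δ * B.op x - sgn (p && q) • (B.op x * G.secondQuant p δ) = B.op (δ x) := by
  rw [B.op_of_mem hx, B.op_of_mem (hδ q x hx), ← B.secondQuant_ann hδ hs hx]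
  have h : G.secondQuant p δ * G.create x
      = G.create (δ x) + sgn (p && q) • (G.create x * G.secondQuant p δ) := by
    ext a
    exact G.secondQuant_gen_mul hδ hx a
  simp only [mul_add, add_mul, mul_smul_comm, smul_mul_assoc, h]
  module

end Form

/-! #### Automorphisms -/

variable (G) in
/-- The automorphism of `Sym` induced by an even operator. -/
noncomputable def map (u : Module.End ℂ E) (hu : u ∈ G.endPart false) : G.Sym →ₐ[ℂ] G.Sym :=
  G.lift (G.gen ∘ₗ u) fun q r x y hx hy => by
    have h1 : u x ∈ G.part q := by simpa using hu q x hx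
    have h2 : u y ∈ G.part r := by simpa using hu r y hy
    exact G.gen_mul_gen h1 h2

@[simp] theorem map_gen (u : Module.End ℂ E) (hu : u ∈ G.endPart false) (x : E) :
    G.map u hu (G.gen x) = G.gen (u x) := by
  simp [map]

theorem algHom_eq {f g : G.Sym →ₐ[ℂ] G.Sym} (h : ∀ x, f (G.gen x) = g (G.gen x)) : f = g := by
  have : f.toLinearMap - g.toLinearMap = 0 := by
    have hN := G.eq_top_of_gen_mul_mem (LinearMap.ker (f.toLinearMap - g.toLinearMap))
      (by simp) fun q e he a ha => by
        simp only [LinearMap.mem_ker, LinearMap.sub_apply, AlgHom.toLinearMap_apply,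
          sub_eq_zero, map_mul] at ha ⊢
        rw [h, ha]
    exact LinearMap.ker_eq_top.1 hN
  exact DFunLike.ext _ _ fun a => sub_eq_zero.1 (DFunLike.congr_fun this a)

theorem map_comp (u v : Module.End ℂ E) (hu : u ∈ G.endPart false) (hv : v ∈ G.endPart false)
    (huv : u * v ∈ G.endPart false) : (G.map u hu).comp (G.map v hv) = G.map (u * v) huv :=
  algHom_eq fun x => by simp

theorem map_one (h : (1 : Module.End ℂ E) ∈ G.endPart false) :
    G.map 1 h = AlgHom.id ℂ G.Sym :=
  algHom_eq fun x => by simp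

theorem map_secondQuant {p : Bool} {u δ δ' : Module.End ℂ E} (hu : u ∈ G.endPart false)
    (hδ : δ ∈ G.endPart p) (hδ' : δ' ∈ G.endPart p) (h : u * δ = δ' * u) :
    (G.map u hu).toLinearMap * G.secondQuant p δ
      = G.secondQuant p δ' * (G.map u hu).toLinearMap := by
  refine sub_eq_zero.1 (G.end_eq_zero (by simp [secondQuant_one]) fun q e he =>
    ⟨sgn (p && q) • G.gen (u e), fun a => ?_⟩)
  have hue : u e ∈ G.part q := by simpa using hu q e he
  have h' : u (δ e) = δ' (u e) := DFunLike.congr_fun h e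
  simp [G.secondQuant_gen_mul hδ he, G.secondQuant_gen_mul hδ' hue, h', mul_sub, smul_sub]

/-- Creation operators are transported by any even map; annihilation operators are, because the map
preserves the form. -/
theorem Form.map_op {u : Module.End ℂ E} (hu : u ∈ G.endPart false)
    (hB : ∀ x y, B.form (u x) (u y) = B.form x y) (x : E) :
    (G.map u hu).toLinearMap * B.op x = B.op (u x) * (G.map u hu).toLinearMap := by
  induction x using G.part_induction with
  | hadd x y hx hy => simp only [map_add, mul_add, add_mul, hx, hy]
  | h p x hx =>
    have hux : u x ∈ G.part p := by simpa using hu p x hx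
    rw [B.op_of_mem hx, B.op_of_mem hux, mul_add, add_mul, mul_smul_comm, smul_mul_assoc]
    congr 1
    · ext a
      simp
    · congr 1
      refine sub_eq_zero.1 (G.end_eq_zero (by simp [Form.ann_one]) fun q e he =>
        ⟨sgn (p && q) • G.gen (u e), fun a => ?_⟩)
      have hue : u e ∈ G.part q := by simpa using hu q e he
      simp [B.ann_gen_mul hx he, B.ann_gen_mul hux hue, hB, mul_sub, smul_sub]

/-! #### Injectivity of the inclusion of the generators -/

/-- Let `x` act on `ℂ × E` by `(c, v) ↦ (0, c • x)`. Any two such operators have product zero, so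
the relations hold trivially, and `x` is recovered from its action on `(1, 0)`. -/
theorem gen_injective : Function.Injective G.gen := by
  let f : E →ₗ[ℂ] Module.End ℂ (ℂ × E) :=
    { toFun := fun x => LinearMap.inr ℂ ℂ E ∘ₗ (LinearMap.fst ℂ ℂ E).smulRight x
      map_add' := fun x y => by ext <;> simp
      map_smul' := fun c x => by ext <;> simp [smul_comm c] }
  have h : ∀ q r x y, x ∈ G.part q → y ∈ G.part r →
      f x * f y = sgn (q && r) • (f y * f x) := by
    intros
    ext <;> simp [f]
  intro x y hxy
  have := congrArg (fun a => (G.lift f h a (1, 0)).2) hxy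
  simpa [f] using this

/-- Sending all generators to zero maps the algebra onto `ℂ`. -/
instance : Nontrivial G.Sym := by
  have h : ∀ q r x y, x ∈ G.part q → y ∈ G.part r → (0 : E →ₗ[ℂ] ℂ) x * (0 : E →ₗ[ℂ] ℂ) y
      = sgn (q && r) • ((0 : E →ₗ[ℂ] ℂ) y * (0 : E →ₗ[ℂ] ℂ) x) := by
    intros
    simp
  exact (G.lift (0 : E →ₗ[ℂ] ℂ) h).toRingHom.domain_nontrivial

end SuperSpace

end Hyper

namespace Hyper

/-! ### Test functions modulo the radical of the Pauli–Jordan form -/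

/-- Test functions, modulo those that vanish on the mass shell. -/
abbrev ShellSpace (m : ℝ) : Type := Test ⧸ LinearMap.ker (pjForm m)

namespace ShellSpace

variable {m : ℝ}

theorem mem_ker {g : Test} : g ∈ LinearMap.ker (pjForm m) ↔ ∀ h, pauliJordan m g h = 0 := by
  simp [LinearMap.ext_iff, pjForm_apply]

/-- The class of a test function. -/
noncomputable def mk : Test →ₗ[ℂ] ShellSpace m := Submodule.mkQ _

theorem mk_surjective : Function.Surjective (mk (m := m)) := Submodule.mkQ_surjective _

theorem mk_eq_zero {g : Test} : mk (m := m) g = 0 ↔ ∀ h, pauliJordan m g h = 0 :=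
  (Submodule.Quotient.mk_eq_zero _).trans mem_ker

/-- The nondegenerate form induced by the Pauli–Jordan distribution. -/
noncomputable def form : ShellSpace m →ₗ[ℂ] ShellSpace m →ₗ[ℂ] ℂ :=
  (Submodule.liftQ _ ((Submodule.liftQ _ (pjForm m) le_rfl).flip) fun g hg => by
    refine LinearMap.mem_ker.2 (LinearMap.ext fun x => ?_)
    obtain ⟨h, rfl⟩ := mk_surjective x
    change pauliJordan m h g = 0
    rw [pauliJordan_antisymm, mem_ker.1 hg, neg_zero]).flip

@[simp] theorem form_mk (g h : Test) : form (m := m) (mk g) (mk h) = pauliJordan m g h := rfl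

theorem form_antisymm (x y : ShellSpace m) : form x y = -form y x := by
  obtain ⟨g, rfl⟩ := mk_surjective x
  obtain ⟨h, rfl⟩ := mk_surjective y
  exact pauliJordan_antisymm m g h

/-- The operator induced by an operator that has a left adjoint. -/
noncomputable def induced (T T' : Module.End ℂ Test)
    (h : ∀ f g, pauliJordan m (T f) g = pauliJordan m f (T' g)) : Module.End ℂ (ShellSpace m) :=
  Submodule.mapQ _ _ T fun f hf => mem_ker.2 fun g => by rw [h, mem_ker.1 hf]

/-- The derivative `∂_μ`. -/
noncomputable def pdK (μ : Fin 4) : Module.End ℂ (ShellSpace m) :=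
  induced (pd μ) (-pd μ) fun f g => by
    rw [pauliJordan_pd_left]
    exact ((pjForm m f).map_neg _).symm

@[simp] theorem pdK_mk (μ : Fin 4) (g : Test) : pdK (m := m) μ (mk g) = mk (pd μ g) := rfl

theorem form_pdK (μ : Fin 4) (x y : ShellSpace m) : form (pdK μ x) y = -form x (pdK μ y) := by
  obtain ⟨g, rfl⟩ := mk_surjective x
  obtain ⟨h, rfl⟩ := mk_surjective y
  exact pauliJordan_pd_left m μ g h

theorem pdK_comm (μ ν : Fin 4) (x : ShellSpace m) : pdK μ (pdK ν x) = pdK ν (pdK μ x) := by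
  obtain ⟨g, rfl⟩ := mk_surjective x
  simp [pd_comm]

/-- The operator `σ^μ_{a ḃ} ∂_μ`. -/
noncomputable def sigK (a b : Fin 2) : Module.End ℂ (ShellSpace m) := ∑ μ, pauli μ a b • pdK μ

theorem sigK_mk (a b : Fin 2) (g : Test) : sigK (m := m) a b (mk g) = mk (sigPd a b g) := by
  simp [sigK, sigPd_apply]

theorem form_sigK (a b : Fin 2) (x y : ShellSpace m) :
    form (sigK a b x) y = -form x (sigK a b y) := by
  simp [sigK, form_pdK]

theorem pdK_sigK (μ : Fin 4) (a b : Fin 2) (x : ShellSpace m) :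
    pdK μ (sigK a b x) = sigK a b (pdK μ x) := by
  simp [sigK, pdK_comm μ]

theorem fourierM_sigPd (a b : Fin 2) (g : Test) (p : Spacetime) :
    fourierM (sigPd a b g) p = I * slash p a b * fourierM g p := by
  rw [sigPd_apply, fourierM_sum, slash, Matrix.sum_apply, Finset.mul_sum, Finset.sum_mul]
  refine Finset.sum_congr rfl fun μ _ => ?_
  rw [fourierM_smul, fourierM_pd]
  simp
  ring

theorem sigK_comm (a b c d : Fin 2) (x : ShellSpace m) :
    sigK a b (sigK c d x) = sigK c d (sigK a b x) := by
  obtain ⟨g, rfl⟩ := mk_surjective x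
  simp only [sigK_mk]
  congr 1
  refine fourierM_injective fun p => ?_
  simp only [fourierM_sigPd]
  ring

theorem fourierM_sub (g h : Test) (p : Spacetime) :
    fourierM (g - h) p = fourierM g p - fourierM h p := (fourierMLin p).map_sub g h

/-- The determinant of `slash p` is `p · p`, and the two factors `I` of the symbols give the sign.
Consequently whatever commutes with the `σ^μ ∂_μ` commutes with `box`. -/
theorem box_eq_sigPd (g : Test) : box g = sigPd 0 0 (sigPd 1 1 g) - sigPd 0 1 (sigPd 1 0 g) := by
  refine fourierM_injective fun p => ?_
  rw [fourierM_sub, fourierM_box, ← det_slash, Matrix.det_fin_two]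
  simp only [fourierM_sigPd]
  linear_combination (fourierM g p * (slash p 0 1 * slash p 1 0 - slash p 0 0 * slash p 1 1)) * I_sq

/-- The d'Alembertian. -/
noncomputable def boxK : Module.End ℂ (ShellSpace m) := sigK 0 0 * sigK 1 1 - sigK 0 1 * sigK 1 0

theorem boxK_apply (x : ShellSpace m) :
    boxK x = sigK 0 0 (sigK 1 1 x) - sigK 0 1 (sigK 1 0 x) := rfl

theorem boxK_mk (g : Test) : boxK (m := m) (mk g) = mk (box g) := by
  simp [boxK_apply, sigK_mk, box_eq_sigPd]

/-- The passage to the quotient imposes the Klein–Gordon equation, because `box + m²` maps test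
functions into the radical. -/
theorem mk_box (g : Test) : mk (m := m) (box g) = -((m : ℂ) ^ 2) • mk g := by
  rw [← map_smul, ← sub_eq_zero, ← map_sub, mk_eq_zero]
  intro h
  have h1 := (pjForm m h).map_sub (box g) (-(m : ℂ) ^ 2 • g)
  rw [(pjForm m h).map_smul] at h1
  simp only [pjForm_apply, pauliJordan_box_right] at h1
  rw [pauliJordan_antisymm, h1]
  simp

theorem mk_conjTest_eq_zero {g : Test} (h : mk (m := m) g = 0) : mk (m := m) (conjTest g) = 0 := by
  rw [mk_eq_zero] at h ⊢
  intro f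
  rw [← conjTest_conjTest f, pauliJordan_conjTest, h, map_zero]

/-- Invertible symmetries of the Pauli–Jordan distribution have a left adjoint. -/
theorem form_symmetry_left {T T' : Module.End ℂ Test} (h : ∀ g, T (T' g) = g)
    (hT : ∀ f g, pauliJordan m (T f) (T g) = pauliJordan m f g) (f g : Test) :
    pauliJordan m (T f) g = pauliJordan m f (T' g) := by
  rw [← hT f, h]

/-- The translation `g ↦ g (· + a)`, as a linear operator. -/
noncomputable def translateLin (a : Spacetime) : Module.End ℂ Test :=
  (SchwartzMap.compSubConstCLM ℂ (-a)).toLinearMap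

theorem translateLin_apply (a : Spacetime) (g : Test) : translateLin a g = translateTest a g := rfl

theorem translateTest_apply (a : Spacetime) (g : Test) (x : Spacetime) :
    translateTest a g x = g (x + a) := by
  simp [translateTest]

theorem translateTest_translateTest (a b : Spacetime) (g : Test) :
    translateTest a (translateTest b g) = translateTest (a + b) g := by
  ext x
  simp [translateTest_apply, add_assoc]

theorem translateTest_zero (g : Test) : translateTest 0 g = g := by
  ext x
  simp [translateTest_apply]

/-- Translations of the mass shell. -/
noncomputable def transK (a : Spacetime) : Module.End ℂ (ShellSpace m) :=
  induced (translateLin a) (translateLin (-a)) <| form_symmetry_left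
    (fun g => by simp [translateLin_apply, translateTest_translateTest, translateTest_zero])
    (fun f g => pauliJordan_translateTest m a f g)

@[simp] theorem transK_mk (a : Spacetime) (g : Test) :
    transK (m := m) a (mk g) = mk (translateTest a g) := rfl

theorem transK_transK (a b : Spacetime) (x : ShellSpace m) :
    transK a (transK b x) = transK (a + b) x := by
  obtain ⟨g, rfl⟩ := mk_surjective x
  simp [translateTest_translateTest]

theorem transK_zero (x : ShellSpace m) : transK 0 x = x := by
  obtain ⟨g, rfl⟩ := mk_surjective x
  simp [translateTest_zero]

theorem form_transK (a : Spacetime) (x y : ShellSpace m) :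
    form (transK a x) (transK a y) = form x y := by
  obtain ⟨g, rfl⟩ := mk_surjective x
  obtain ⟨h, rfl⟩ := mk_surjective y
  exact pauliJordan_translateTest m a g h

theorem translateTest_pd (a : Spacetime) (μ : Fin 4) (g : Test) :
    translateTest a (pd μ g) = pd μ (translateTest a g) := by
  refine fourierM_injective fun p => ?_
  rw [fourierM_translateTest, fourierM_pd, fourierM_pd, fourierM_translateTest]
  ring

theorem transK_sigK (a : Spacetime) (b c : Fin 2) (x : ShellSpace m) :
    transK a (sigK b c x) = sigK b c (transK a x) := by
  obtain ⟨g, rfl⟩ := mk_surjective x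
  simp [sigK, translateTest_pd]

/-- The Lorentz transformation `g ↦ g ∘ Λ_A`, as a linear operator. -/
noncomputable def lorentzLin (A : Matrix.SpecialLinearGroup (Fin 2) ℂ) : Module.End ℂ Test :=
  (SchwartzMap.compCLMOfContinuousLinearEquiv ℂ (lorentz A)).toLinearMap

theorem lorentzLin_apply (A : Matrix.SpecialLinearGroup (Fin 2) ℂ) (g : Test) :
    lorentzLin A g = lorentzTest A g := rfl

theorem lorentzTest_lorentzTest (A B : Matrix.SpecialLinearGroup (Fin 2) ℂ) (g : Test) :
    lorentzTest A (lorentzTest B g) = lorentzTest (B * A) g := by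
  ext x
  simp [lorentzTest_apply, lorentz_mul]

theorem lorentzTest_one (g : Test) : lorentzTest 1 g = g := by
  ext x
  simp [lorentzTest_apply, lorentz_one]

/-- Lorentz transformations of the mass shell. -/
noncomputable def lorK (A : Matrix.SpecialLinearGroup (Fin 2) ℂ) : Module.End ℂ (ShellSpace m) :=
  induced (lorentzLin A) (lorentzLin A⁻¹) <| form_symmetry_left
    (fun g => by simp [lorentzLin_apply, lorentzTest_lorentzTest, lorentzTest_one])
    (fun f g => pauliJordan_lorentzTest m A f g)

@[simp] theorem lorK_mk (A : Matrix.SpecialLinearGroup (Fin 2) ℂ) (g : Test) :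
    lorK (m := m) A (mk g) = mk (lorentzTest A g) := rfl

theorem lorK_lorK (A B : Matrix.SpecialLinearGroup (Fin 2) ℂ) (x : ShellSpace m) :
    lorK A (lorK B x) = lorK (B * A) x := by
  obtain ⟨g, rfl⟩ := mk_surjective x
  simp [lorentzTest_lorentzTest]

theorem lorK_one (x : ShellSpace m) : lorK 1 x = x := by
  obtain ⟨g, rfl⟩ := mk_surjective x
  simp [lorentzTest_one]

theorem form_lorK (A : Matrix.SpecialLinearGroup (Fin 2) ℂ) (x y : ShellSpace m) :
    form (lorK A x) (lorK A y) = form x y := by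
  obtain ⟨g, rfl⟩ := mk_surjective x
  obtain ⟨h, rfl⟩ := mk_surjective y
  exact pauliJordan_lorentzTest m A g h

theorem lorK_transK (A : Matrix.SpecialLinearGroup (Fin 2) ℂ) (a : Spacetime)
    (x : ShellSpace m) : lorK A (transK (lorentz A a) x) = transK a (lorK A x) := by
  obtain ⟨g, rfl⟩ := mk_surjective x
  simp only [transK_mk, lorK_mk]
  congr 1
  ext x
  simp [lorentzTest_apply, translateTest_apply]

/-- On symbols this is `slash (Λ_A p) = A (slash p) A*`. -/
theorem lorK_sigK (A : Matrix.SpecialLinearGroup (Fin 2) ℂ) (a b : Fin 2) (x : ShellSpace m) :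
    lorK A (sigK a b x)
      = ∑ c, ∑ d, (A.1 a c * (starRingEnd ℂ) (A.1 b d)) • sigK c d (lorK A x) := by
  obtain ⟨g, rfl⟩ := mk_surjective x
  simp only [lorK_mk, sigK_mk, ← (mk (m := m)).map_smul, ← map_sum]
  congr 1
  refine fourierM_injective fun p => ?_
  simp only [fourierM_lorentzTest, fourierM_sigPd, fourierM_add, fourierM_smul, slash_lorentz,
    Matrix.mul_apply, Fin.sum_univ_two, Matrix.conjTranspose_apply, RCLike.star_def]
  ring

end ShellSpace

end Hyper

namespace Hyper

/-! ### The off-shell hyper-multiplet of test functions -/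

/-- The components of an irreducible multiplet: those of `φ_j, f_j, ψ_a, χ̄_ȧ`. -/
inductive Slot : Type
  | phi (j : Fin 2)
  | f (j : Fin 2)
  | psi (a : Fin 2)
  | chib (a : Fin 2)
deriving DecidableEq

/-- `true` on the fermionic slots. -/
def Slot.isFermi : Slot → Bool
  | .phi _ => false
  | .f _ => false
  | .psi _ => true
  | .chib _ => true

/-- One-particle vectors of an irreducible multiplet. -/
abbrev Multi (m : ℝ) : Type := Slot → ShellSpace m

namespace Multi

open ShellSpace

variable {m : ℝ}

/-- The supercharges. -/
noncomputable def qOp (j a : Fin 2) : Module.End ℂ (Multi m) where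
  toFun x
    | .phi k => (2 * I * delta j k) • ∑ b, sigK a b (x (.chib b))
    | .f k => (2 * I * delta j k) • ∑ b, eps a b • x (.psi b)
    | .psi b => delta a b • ∑ k, eps j k • x (.phi k)
    | .chib c => ∑ k, ∑ b, (eps j k * epsUp b c) • sigK a b (x (.f k))
  map_add' x y := by
    ext s
    cases s <;> simp <;> module
  map_smul' c x := by
    ext s
    cases s <;> simp <;> module

/-- The adjoint supercharges. -/
noncomputable def qbarOp (j a : Fin 2) : Module.End ℂ (Multi m) where
  toFun x
    | .phi k => (2 * I * eps j k) • ∑ b, sigK b a (x (.psi b))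
    | .f k => (-2 * I * eps j k) • ∑ b, eps a b • x (.chib b)
    | .psi c => -∑ b, epsUp b c • sigK b a (x (.f j))
    | .chib b => delta a b • x (.phi j)
  map_add' x y := by
    ext s
    cases s <;> simp <;> module
  map_smul' c x := by
    ext s
    cases s <;> simp <;> module

/-- The central charge. -/
noncomputable def zOp : Module.End ℂ (Multi m) where
  toFun x
    | .phi k => -I • boxK (x (.f k))
    | .f k => -I • x (.phi k)
    | .psi c => I • ∑ a, ∑ b, epsUp b c • sigK b a (x (.chib a))
    | .chib c => -I • ∑ a, ∑ b, epsUp b c • sigK a b (x (.psi a))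
  map_add' x y := by
    ext s
    cases s <;> simp <;> module
  map_smul' c x := by
    ext s
    cases s <;> simp <;> module

/-- The componentwise action of an operator. -/
noncomputable def each (T : Module.End ℂ (ShellSpace m)) : Module.End ℂ (Multi m) :=
  T.compLeft Slot

@[simp] theorem each_apply (T : Module.End ℂ (ShellSpace m)) (x : Multi m) (s : Slot) :
    each T x s = T (x s) := rfl

section

variable (x : Multi m) (j a k : Fin 2)

theorem qOp_phi : qOp j a x (.phi k)
    = (2 * I * delta j k) • (sigK a 0 (x (.chib 0)) + sigK a 1 (x (.chib 1))) := by
  simp [qOp, Fin.sum_univ_two]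

theorem qOp_f : qOp j a x (.f k)
    = (2 * I * delta j k) • (eps a 0 • x (.psi 0) + eps a 1 • x (.psi 1)) := by
  simp [qOp, Fin.sum_univ_two]

theorem qOp_psi : qOp j a x (.psi k)
    = delta a k • (eps j 0 • x (.phi 0) + eps j 1 • x (.phi 1)) := by
  simp [qOp, Fin.sum_univ_two]

theorem qOp_chib : qOp j a x (.chib k)
    = (eps j 0 * epsUp 0 k) • sigK a 0 (x (.f 0)) + (eps j 0 * epsUp 1 k) • sigK a 1 (x (.f 0))
      + ((eps j 1 * epsUp 0 k) • sigK a 0 (x (.f 1))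
        + (eps j 1 * epsUp 1 k) • sigK a 1 (x (.f 1))) := by
  simp [qOp, Fin.sum_univ_two]

theorem qbarOp_phi : qbarOp j a x (.phi k)
    = (2 * I * eps j k) • (sigK 0 a (x (.psi 0)) + sigK 1 a (x (.psi 1))) := by
  simp [qbarOp, Fin.sum_univ_two]

theorem qbarOp_f : qbarOp j a x (.f k)
    = (-2 * I * eps j k) • (eps a 0 • x (.chib 0) + eps a 1 • x (.chib 1)) := by
  simp [qbarOp, Fin.sum_univ_two]

theorem qbarOp_psi : qbarOp j a x (.psi k)
    = -(epsUp 0 k • sigK 0 a (x (.f j)) + epsUp 1 k • sigK 1 a (x (.f j))) := by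
  simp [qbarOp, Fin.sum_univ_two]

theorem qbarOp_chib : qbarOp j a x (.chib k) = delta a k • x (.phi j) := rfl

theorem zOp_phi : zOp x (.phi k)
    = -I • (sigK 0 0 (sigK 1 1 (x (.f k))) - sigK 0 1 (sigK 1 0 (x (.f k)))) := rfl

theorem zOp_f : zOp x (.f k) = -I • x (.phi k) := rfl

theorem zOp_psi : zOp x (.psi k)
    = I • (epsUp 0 k • sigK 0 0 (x (.chib 0)) + epsUp 1 k • sigK 1 0 (x (.chib 0))
      + (epsUp 0 k • sigK 0 1 (x (.chib 1)) + epsUp 1 k • sigK 1 1 (x (.chib 1)))) := by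
  simp [zOp, Fin.sum_univ_two]

theorem zOp_chib : zOp x (.chib k)
    = -I • (epsUp 0 k • sigK 0 0 (x (.psi 0)) + epsUp 1 k • sigK 0 1 (x (.psi 0))
      + (epsUp 0 k • sigK 1 0 (x (.psi 1)) + epsUp 1 k • sigK 1 1 (x (.psi 1)))) := by
  simp [zOp, Fin.sum_univ_two]

end

/-- An element of square zero commutes with its anticommutators. -/
theorem commute_of_acomm {A : Type*} [Ring A] [Algebra ℂ A] {q d z : A} {c : ℂ} (hc : c ≠ 0)
    (hq : q * q + q * q = 0) (h : q * d + d * q = c • z) : z * q = q * z := by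
  have hq' : q * q = 0 := by
    rw [← two_smul ℂ] at hq
    exact (smul_eq_zero.1 hq).resolve_left two_ne_zero
  have e : c • (z * q) = c • (q * z) := by
    rw [← smul_mul_assoc, ← mul_smul_comm, ← h, add_mul, mul_add, mul_assoc d, hq', ← mul_assoc q q,
      hq', mul_zero, zero_mul, mul_assoc, add_zero, zero_add]
  exact smul_right_injective A hc e

theorem fin_two_eq (i : Fin 2) : i = 0 ∨ i = 1 := by fin_cases i <;> simp

theorem eps_values : eps 0 0 = 0 ∧ eps 0 1 = 1 ∧ eps 1 0 = -1 ∧ eps 1 1 = 0 := by simp [eps]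

theorem epsUp_values : epsUp 0 0 = 0 ∧ epsUp 0 1 = -1 ∧ epsUp 1 0 = 1 ∧ epsUp 1 1 = 0 := by
  simp [epsUp, eps]

theorem delta_values : delta 0 0 = 1 ∧ delta 0 1 = 0 ∧ delta 1 0 = 0 ∧ delta 1 1 = 1 := by
  simp [delta]

-- A finite check over all indices. It uses only that the operators `sigK` commute, so the algebra
-- closes with `boxK` in place of `-m²`, without the field equations.
set_option maxHeartbeats 4000000 in
theorem qOp_qOp (j a k b : Fin 2) :
    qOp (m := m) j a * qOp k b + qOp k b * qOp j a = (2 * eps a b * eps j k) • zOp := by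
  refine LinearMap.ext fun x => funext fun s => ?_
  rw [LinearMap.add_apply, Module.End.mul_apply, Module.End.mul_apply, LinearMap.smul_apply,
    Pi.add_apply, Pi.smul_apply]
  have h1 := sigK_comm (m := m) 0 1 0 0
  have h2 := sigK_comm (m := m) 1 0 0 0
  have h3 := sigK_comm (m := m) 1 1 0 0
  have h4 := sigK_comm (m := m) 1 0 0 1
  have h5 := sigK_comm (m := m) 1 1 0 1
  have h6 := sigK_comm (m := m) 1 1 1 0
  obtain ⟨e1, e2, e3, e4⟩ := eps_values
  obtain ⟨u1, u2, u3, u4⟩ := epsUp_values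
  obtain ⟨d1, d2, d3, d4⟩ := delta_values
  cases s <;> rename_i l <;> rcases fin_two_eq j with rfl | rfl <;>
    rcases fin_two_eq k with rfl | rfl <;> rcases fin_two_eq a with rfl | rfl <;>
    rcases fin_two_eq b with rfl | rfl <;> rcases fin_two_eq l with rfl | rfl <;>
    simp only [qOp_phi, qOp_f, qOp_psi, qOp_chib, zOp_phi, zOp_f, zOp_psi, zOp_chib, e1, e2, e3,
      e4, u1, u2, u3, u4, d1, d2, d3, d4, h1, h2, h3, h4, h5, h6, mul_zero, zero_mul, zero_smul,
      smul_zero, add_zero, zero_add, map_add, map_smul, map_zero] <;>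
    module

set_option maxHeartbeats 4000000 in
theorem qOp_qbarOp (j a k b : Fin 2) :
    qOp (m := m) j a * qbarOp k b + qbarOp k b * qOp j a
      = (2 * I * delta j k) • each (sigK a b) := by
  refine LinearMap.ext fun x => funext fun s => ?_
  rw [LinearMap.add_apply, Module.End.mul_apply, Module.End.mul_apply, LinearMap.smul_apply,
    Pi.add_apply, Pi.smul_apply]
  have h1 := sigK_comm (m := m) 0 1 0 0
  have h2 := sigK_comm (m := m) 1 0 0 0
  have h3 := sigK_comm (m := m) 1 1 0 0
  have h4 := sigK_comm (m := m) 1 0 0 1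
  have h5 := sigK_comm (m := m) 1 1 0 1
  have h6 := sigK_comm (m := m) 1 1 1 0
  obtain ⟨e1, e2, e3, e4⟩ := eps_values
  obtain ⟨u1, u2, u3, u4⟩ := epsUp_values
  obtain ⟨d1, d2, d3, d4⟩ := delta_values
  cases s <;> rename_i l <;> rcases fin_two_eq j with rfl | rfl <;>
    rcases fin_two_eq k with rfl | rfl <;> rcases fin_two_eq a with rfl | rfl <;>
    rcases fin_two_eq b with rfl | rfl <;> rcases fin_two_eq l with rfl | rfl <;>
    simp only [qOp_phi, qOp_f, qOp_psi, qOp_chib, qbarOp_phi, qbarOp_f, qbarOp_psi,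
      qbarOp_chib, each_apply, e1, e2, e3,
      e4, u1, u2, u3, u4, d1, d2, d3, d4, h1, h2, h3, h4, h5, h6, mul_zero, zero_mul, zero_smul,
      smul_zero, add_zero, zero_add, map_add, map_smul, map_neg, neg_zero, map_zero] <;>
    module

/-- Centrality follows from the anticommutators: `q_{ja}` squares to zero, and its anticommutator
with the charge of opposite indices `1 - j`, `1 - a` is a nonzero multiple of `zOp`. -/
theorem zOp_qOp (j a : Fin 2) : zOp (m := m) * qOp j a = qOp j a * zOp :=
  commute_of_acomm (c := 2 * eps a (1 - a) * eps j (1 - j))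
    (by fin_cases j <;> fin_cases a <;> simp [eps])
    ((qOp_qOp j a j a).trans (by fin_cases a <;> simp [eps])) (qOp_qOp j a (1 - j) (1 - a))

/-- Operators that commute with derivatives commute with the multiplet operators. -/
theorem each_qOp {T : Module.End ℂ (ShellSpace m)}
    (hT : ∀ a b x, T (sigK a b x) = sigK a b (T x)) (j a : Fin 2) :
    each T * qOp j a = qOp j a * each T := by
  refine LinearMap.ext fun x => funext fun s => ?_
  cases s <;> simp [qOp, hT]

theorem each_qbarOp {T : Module.End ℂ (ShellSpace m)}
    (hT : ∀ a b x, T (sigK a b x) = sigK a b (T x)) (j a : Fin 2) :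
    each T * qbarOp j a = qbarOp j a * each T := by
  refine LinearMap.ext fun x => funext fun s => ?_
  cases s <;> simp [qbarOp, hT]

theorem each_zOp {T : Module.End ℂ (ShellSpace m)}
    (hT : ∀ a b x, T (sigK a b x) = sigK a b (T x)) :
    each T * zOp = zOp * each T := by
  refine LinearMap.ext fun x => funext fun s => ?_
  cases s <;> simp [zOp, hT, boxK_apply]

/-- The generators of the translations. -/
noncomputable def pOp (μ : Fin 4) : Module.End ℂ (Multi m) := each (I • pdK μ)

theorem pOp_qOp (μ : Fin 4) (j a : Fin 2) : pOp (m := m) μ * qOp j a = qOp j a * pOp μ :=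
  each_qOp (fun a b x => by simp [pdK_sigK]) j a

theorem pOp_qbarOp (μ : Fin 4) (j a : Fin 2) :
    pOp (m := m) μ * qbarOp j a = qbarOp j a * pOp μ :=
  each_qbarOp (fun a b x => by simp [pdK_sigK]) j a

theorem pOp_zOp (μ : Fin 4) : pOp (m := m) μ * zOp = zOp * pOp μ :=
  each_zOp (fun a b x => by simp [pdK_sigK])

theorem sum_pOp (a b : Fin 2) :
    ∑ μ, pauli μ a b • pOp (m := m) μ = I • each (sigK a b) := by
  refine LinearMap.ext fun x => funext fun s => ?_
  simp [pOp, sigK, Finset.smul_sum, smul_comm I, LinearMap.sum_apply]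

end Multi

end Hyper

namespace Hyper

/-! ### Parity, the invariant form and the group actions -/

namespace Multi

open ShellSpace

variable {m : ℝ}

/-- Vectors with components of one parity only. -/
def HasParity (q : Bool) (x : Multi m) : Prop := ∀ s : Slot, s.isFermi ≠ q → x s = 0

theorem HasParity.phi {x : Multi m} (h : HasParity true x) (k : Fin 2) : x (.phi k) = 0 :=
  h _ (by simp [Slot.isFermi])

theorem HasParity.f {x : Multi m} (h : HasParity true x) (k : Fin 2) : x (.f k) = 0 :=
  h _ (by simp [Slot.isFermi])

theorem HasParity.psi {x : Multi m} (h : HasParity false x) (a : Fin 2) : x (.psi a) = 0 :=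
  h _ (by simp [Slot.isFermi])

theorem HasParity.chib {x : Multi m} (h : HasParity false x) (a : Fin 2) : x (.chib a) = 0 :=
  h _ (by simp [Slot.isFermi])

theorem HasParity.qOp {q : Bool} {x : Multi m} (h : HasParity q x) (j a : Fin 2) :
    HasParity (!q) (qOp j a x) := by
  intro s hs
  cases q <;> cases s <;> simp [Slot.isFermi] at hs
  · simp [qOp_phi, h.chib]
  · simp [qOp_f, h.psi]
  · simp [qOp_psi, h.phi]
  · simp [qOp_chib, h.f]

theorem HasParity.qbarOp {q : Bool} {x : Multi m} (h : HasParity q x) (j a : Fin 2) :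
    HasParity (!q) (qbarOp j a x) := by
  intro s hs
  cases q <;> cases s <;> simp [Slot.isFermi] at hs
  · simp [qbarOp_phi, h.psi]
  · simp [qbarOp_f, h.chib]
  · simp [qbarOp_psi, h.f]
  · simp [qbarOp_chib, h.phi]

theorem HasParity.zOp {q : Bool} {x : Multi m} (h : HasParity q x) : HasParity q (zOp x) := by
  intro s hs
  cases q <;> cases s <;> simp [Slot.isFermi] at hs
  · simp [zOp_psi, h.chib]
  · simp [zOp_chib, h.psi]
  · simp [zOp_phi, h.f]
  · simp [zOp_f, h.phi]

theorem HasParity.each {q : Bool} {x : Multi m} (h : HasParity q x)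
    (T : Module.End ℂ (ShellSpace m)) : HasParity q (each T x) := fun s hs => by
  simp [h s hs]

/-- The invariant form on an irreducible multiplet. -/
noncomputable def cForm : Multi m →ₗ[ℂ] Multi m →ₗ[ℂ] ℂ :=
  LinearMap.mk₂ ℂ (fun x y =>
    form (x (.phi 0)) (y (.f 1)) - form (x (.phi 1)) (y (.f 0))
      - form (x (.f 0)) (y (.phi 1)) + form (x (.f 1)) (y (.phi 0))
      + 2 * I * (form (x (.psi 0)) (y (.psi 1)) - form (x (.psi 1)) (y (.psi 0))
        + form (x (.chib 0)) (y (.chib 1)) - form (x (.chib 1)) (y (.chib 0))))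
    (fun x y z => by simp; ring) (fun c x y => by simp; ring)
    (fun x y z => by simp; ring) (fun c x y => by simp; ring)

theorem cForm_apply (x y : Multi m) : cForm x y =
    form (x (.phi 0)) (y (.f 1)) - form (x (.phi 1)) (y (.f 0))
      - form (x (.f 0)) (y (.phi 1)) + form (x (.f 1)) (y (.phi 0))
      + 2 * I * (form (x (.psi 0)) (y (.psi 1)) - form (x (.psi 1)) (y (.psi 0))
        + form (x (.chib 0)) (y (.chib 1)) - form (x (.chib 1)) (y (.chib 0))) := rfl

theorem cForm_even {q r : Bool} {x y : Multi m} (hx : HasParity q x) (hy : HasParity r y)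
    (h : q ≠ r) : cForm x y = 0 := by
  rw [cForm_apply]
  cases q <;> cases r <;> first | exact absurd rfl h | skip
  · simp [hx.psi, hx.chib, hy.phi, hy.f]
  · simp [hy.psi, hy.chib, hx.phi, hx.f]

theorem cForm_symm {q : Bool} {x y : Multi m} (hx : HasParity q x) (hy : HasParity q y) :
    cForm y x = -sgn q * cForm x y := by
  rw [cForm_apply, cForm_apply]
  cases q
  · simp only [hx.psi, hx.chib, hy.psi, hy.chib, map_zero, sgn_false]
    rw [form_antisymm (y (.phi 0)), form_antisymm (y (.phi 1)), form_antisymm (y (.f 0)),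
      form_antisymm (y (.f 1))]
    ring
  · simp only [hx.phi, hx.f, hy.phi, hy.f, map_zero, sgn_true]
    rw [form_antisymm (y (.psi 0)), form_antisymm (y (.psi 1)), form_antisymm (y (.chib 0)),
      form_antisymm (y (.chib 1))]
    ring

/-- Derivatives are moved across by skewness of `sigK`. The weight `2 * I` of the spinor slots in
`cForm` matches the factor `2 * I` with which `qOp` sends spinors to scalars. -/
theorem cForm_qOp {q : Bool} {x : Multi m} (hx : HasParity q x) (j a : Fin 2) (y : Multi m) :
    cForm (qOp j a x) y + sgn q * cForm x (qOp j a y) = 0 := by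
  rw [cForm_apply, cForm_apply]
  simp only [qOp_phi, qOp_f, qOp_psi, qOp_chib]
  cases q
  · simp only [hx.psi, hx.chib]
    fin_cases j <;> fin_cases a <;> simp [eps, epsUp, delta, form_sigK] <;> ring
  · simp only [hx.phi, hx.f]
    fin_cases j <;> fin_cases a <;> simp [eps, epsUp, delta, form_sigK] <;> ring

theorem cForm_qbarOp {q : Bool} {x : Multi m} (hx : HasParity q x) (j a : Fin 2) (y : Multi m) :
    cForm (qbarOp j a x) y + sgn q * cForm x (qbarOp j a y) = 0 := by
  rw [cForm_apply, cForm_apply]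
  simp only [qbarOp_phi, qbarOp_f, qbarOp_psi, qbarOp_chib]
  cases q
  · simp only [hx.psi, hx.chib]
    fin_cases j <;> fin_cases a <;> simp [eps, epsUp, delta, form_sigK] <;> ring
  · simp only [hx.phi, hx.f]
    fin_cases j <;> fin_cases a <;> simp [eps, epsUp, delta, form_sigK] <;> ring

/-- By this skewness `cForm x (zOp y)` is a form of the opposite graded symmetry to `cForm`. Hence
it can enter `bForm` antisymmetrically in the two copies, beside the symmetric entry `β`. -/
theorem cForm_zOp (x y : Multi m) : cForm (zOp x) y = -cForm x (zOp y) := by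
  rw [cForm_apply, cForm_apply]
  simp only [zOp_phi, zOp_f, zOp_psi, zOp_chib]
  have h4 := sigK_comm (m := m) 1 0 0 1
  have h3 := sigK_comm (m := m) 1 1 0 0
  simp [eps, epsUp, form_sigK, h3, h4]
  ring

theorem cForm_each {T : Module.End ℂ (ShellSpace m)}
    (hT : ∀ x y, form (T x) y = -form x (T y)) (x y : Multi m) :
    cForm (each T x) y = -cForm x (each T y) := by
  simp only [cForm_apply, each_apply, hT]
  ring

theorem cForm_each_each {T : Module.End ℂ (ShellSpace m)}
    (hT : ∀ x y, form (T x) (T y) = form x y) (x y : Multi m) :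
    cForm (each T x) (each T y) = cForm x y := by
  simp only [cForm_apply, each_apply, hT]

/-! #### Lorentz transformations and internal rotations -/

/-- The action of `SL(2, ℂ)`. -/
noncomputable def lorOp (A : Matrix.SpecialLinearGroup (Fin 2) ℂ) : Module.End ℂ (Multi m) where
  toFun x
    | .phi k => lorK A (x (.phi k))
    | .f k => lorK A (x (.f k))
    | .psi b => ∑ a, A.1 a b • lorK A (x (.psi a))
    | .chib b => ∑ a, (starRingEnd ℂ) (A.1 a b) • lorK A (x (.chib a))
  map_add' x y := by
    ext s
    cases s <;> simp [Finset.sum_add_distrib]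
  map_smul' c x := by
    ext s
    cases s <;> simp <;> module

/-- The action of `SU(2)`. -/
noncomputable def suOp (u : Matrix.specialUnitaryGroup (Fin 2) ℂ) : Module.End ℂ (Multi m) where
  toFun x
    | .phi k => ∑ j, u.1 j k • x (.phi j)
    | .f k => ∑ j, u.1 j k • x (.f j)
    | .psi b => x (.psi b)
    | .chib b => x (.chib b)
  map_add' x y := by
    ext s
    cases s <;> simp [Finset.sum_add_distrib]
  map_smul' c x := by
    ext s
    cases s <;> simp <;> module

section

variable (x : Multi m) (A : Matrix.SpecialLinearGroup (Fin 2) ℂ)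
  (u : Matrix.specialUnitaryGroup (Fin 2) ℂ) (k : Fin 2)

theorem lorOp_phi : lorOp A x (.phi k) = lorK A (x (.phi k)) := rfl

theorem lorOp_f : lorOp A x (.f k) = lorK A (x (.f k)) := rfl

theorem lorOp_psi : lorOp A x (.psi k)
    = A.1 0 k • lorK A (x (.psi 0)) + A.1 1 k • lorK A (x (.psi 1)) := by
  simp [lorOp, Fin.sum_univ_two]

theorem lorOp_chib : lorOp A x (.chib k) = (starRingEnd ℂ) (A.1 0 k) • lorK A (x (.chib 0))
    + (starRingEnd ℂ) (A.1 1 k) • lorK A (x (.chib 1)) := by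
  simp [lorOp, Fin.sum_univ_two]

theorem suOp_phi : suOp u x (.phi k) = u.1 0 k • x (.phi 0) + u.1 1 k • x (.phi 1) := by
  simp [suOp, Fin.sum_univ_two]

theorem suOp_f : suOp u x (.f k) = u.1 0 k • x (.f 0) + u.1 1 k • x (.f 1) := by
  simp [suOp, Fin.sum_univ_two]

theorem suOp_psi : suOp u x (.psi k) = x (.psi k) := rfl

theorem suOp_chib : suOp u x (.chib k) = x (.chib k) := rfl

end

theorem HasParity.lorOp {q : Bool} {x : Multi m} (h : HasParity q x)
    (A : Matrix.SpecialLinearGroup (Fin 2) ℂ) : HasParity q (lorOp A x) := by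
  intro s hs
  cases q <;> cases s <;> simp [Slot.isFermi] at hs
  · simp [lorOp_psi, h.psi]
  · simp [lorOp_chib, h.chib]
  · simp [lorOp_phi, h.phi]
  · simp [lorOp_f, h.f]

theorem HasParity.suOp {q : Bool} {x : Multi m} (h : HasParity q x)
    (u : Matrix.specialUnitaryGroup (Fin 2) ℂ) : HasParity q (suOp u x) := by
  intro s hs
  cases q <;> cases s <;> simp [Slot.isFermi] at hs
  · simp [suOp_psi, h.psi]
  · simp [suOp_chib, h.chib]
  · simp [suOp_phi, h.phi]
  · simp [suOp_f, h.f]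

theorem lorOp_mul (A B : Matrix.SpecialLinearGroup (Fin 2) ℂ) :
    lorOp (m := m) A * lorOp B = lorOp (B * A) := by
  refine LinearMap.ext fun x => funext fun s => ?_
  cases s <;> simp [lorOp_phi, lorOp_f, lorOp_psi, lorOp_chib, lorK_lorK, Matrix.mul_apply,
    Fin.sum_univ_two] <;> module

theorem lorOp_one : lorOp (m := m) 1 = 1 := by
  refine LinearMap.ext fun x => funext fun s => ?_
  cases s <;> rename_i k <;> try fin_cases k
  all_goals simp [lorOp_phi, lorOp_f, lorOp_psi, lorOp_chib, lorK_one]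

theorem suOp_mul (u v : Matrix.specialUnitaryGroup (Fin 2) ℂ) :
    suOp (m := m) u * suOp v = suOp (v * u) := by
  refine LinearMap.ext fun x => funext fun s => ?_
  cases s <;> simp [suOp_phi, suOp_f, suOp_psi, suOp_chib, Matrix.mul_apply,
    Fin.sum_univ_two] <;> module

theorem suOp_one : suOp (m := m) 1 = 1 := by
  refine LinearMap.ext fun x => funext fun s => ?_
  cases s <;> rename_i k <;> try fin_cases k
  all_goals simp [suOp_phi, suOp_f, suOp_psi, suOp_chib]

theorem suOp_lorOp (u : Matrix.specialUnitaryGroup (Fin 2) ℂ)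
    (A : Matrix.SpecialLinearGroup (Fin 2) ℂ) :
    suOp (m := m) u * lorOp A = lorOp A * suOp u := by
  refine LinearMap.ext fun x => funext fun s => ?_
  cases s <;> simp [suOp_phi, suOp_f, suOp_psi, suOp_chib, lorOp_phi, lorOp_f, lorOp_psi,
    lorOp_chib]

theorem suOp_each (u : Matrix.specialUnitaryGroup (Fin 2) ℂ)
    (T : Module.End ℂ (ShellSpace m)) : suOp (m := m) u * each T = each T * suOp u := by
  refine LinearMap.ext fun x => funext fun s => ?_
  cases s <;> simp [suOp_phi, suOp_f, suOp_psi, suOp_chib]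

theorem lorOp_transK (A : Matrix.SpecialLinearGroup (Fin 2) ℂ) (a : Spacetime) :
    lorOp (m := m) A * each (transK (lorentz A a)) = each (transK a) * lorOp A := by
  refine LinearMap.ext fun x => funext fun s => ?_
  cases s <;> simp [lorOp_phi, lorOp_f, lorOp_psi, lorOp_chib, lorK_transK]

theorem det_sl (A : Matrix.SpecialLinearGroup (Fin 2) ℂ) :
    A.1 0 0 * A.1 1 1 - A.1 0 1 * A.1 1 0 = 1 := by
  rw [← Matrix.det_fin_two]
  exact A.2

theorem det_su (u : Matrix.specialUnitaryGroup (Fin 2) ℂ) :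
    u.1 0 0 * u.1 1 1 - u.1 0 1 * u.1 1 0 = 1 := by
  rw [← Matrix.det_fin_two]
  exact (Matrix.mem_specialUnitaryGroup_iff.1 u.2).2

theorem conj_det_sl (A : Matrix.SpecialLinearGroup (Fin 2) ℂ) :
    (starRingEnd ℂ) (A.1 0 0) * (starRingEnd ℂ) (A.1 1 1)
      - (starRingEnd ℂ) (A.1 0 1) * (starRingEnd ℂ) (A.1 1 0) = 1 := by
  simp only [← map_mul, ← map_sub, det_sl, map_one]

/-- The spinor pairings are contractions with `ε` and acquire the factor `det A` or its conjugate.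
-/
theorem cForm_lorOp (A : Matrix.SpecialLinearGroup (Fin 2) ℂ) (x y : Multi m) :
    cForm (lorOp A x) (lorOp A y) = cForm x y := by
  simp only [cForm_apply, lorOp_phi, lorOp_f, lorOp_psi, lorOp_chib, map_add, map_smul,
    LinearMap.add_apply, LinearMap.smul_apply, smul_eq_mul, form_lorK]
  linear_combination (2 * I * (form (x (.psi 0)) (y (.psi 1)) - form (x (.psi 1)) (y (.psi 0))))
    * det_sl A + (2 * I * (form (x (.chib 0)) (y (.chib 1)) - form (x (.chib 1)) (y (.chib 0))))
    * conj_det_sl A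

theorem cForm_suOp (u : Matrix.specialUnitaryGroup (Fin 2) ℂ) (x y : Multi m) :
    cForm (suOp u x) (suOp u y) = cForm x y := by
  simp only [cForm_apply, suOp_phi, suOp_f, suOp_psi, suOp_chib, map_add, map_smul,
    LinearMap.add_apply, LinearMap.smul_apply, smul_eq_mul]
  linear_combination (form (x (.phi 0)) (y (.f 1)) - form (x (.phi 1)) (y (.f 0))
      - form (x (.f 0)) (y (.phi 1)) + form (x (.f 1)) (y (.phi 0))) * det_su u

theorem lorK_boxK (A : Matrix.SpecialLinearGroup (Fin 2) ℂ) (x : ShellSpace m) :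
    lorK A (boxK x) = boxK (lorK A x) := by
  obtain ⟨g, rfl⟩ := mk_surjective x
  simp only [lorK_mk, boxK_mk]
  congr 1
  refine fourierM_injective fun p => ?_
  rw [fourierM_lorentzTest, fourierM_box, fourierM_box, fourierM_lorentzTest, mink_lorentz_self]

/-- Where no `ε` occurs the sides agree at once, by `lorK_sigK` in the presence of a derivative; the
contractions with `ε` also use the determinant conditions on `A`. -/
theorem lorOp_qOp (A : Matrix.SpecialLinearGroup (Fin 2) ℂ) (j a : Fin 2) :
    lorOp (m := m) A * qOp j a = (∑ b, A.1 a b • qOp j b) * lorOp A := by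
  have h := det_sl A
  have h' := conj_det_sl A
  refine LinearMap.ext fun x => funext fun s => ?_
  cases s <;> rename_i k <;>
    simp only [Module.End.mul_apply, LinearMap.add_apply, LinearMap.smul_apply, Pi.add_apply,
      Pi.smul_apply, qOp_phi, qOp_f, qOp_psi, qOp_chib, lorOp_phi, lorOp_f, lorOp_psi,
      lorOp_chib, map_add, map_smul, lorK_sigK, Fin.sum_univ_two]
  · module
  · fin_cases a <;> simp [eps] <;> match_scalars <;> grind
  · fin_cases a <;> fin_cases k <;> simp [delta]
  · fin_cases k <;> simp [epsUp, eps] <;> match_scalars <;> grind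

theorem lorOp_qbarOp (A : Matrix.SpecialLinearGroup (Fin 2) ℂ) (j a : Fin 2) :
    lorOp (m := m) A * qbarOp j a = (∑ b, (starRingEnd ℂ) (A.1 a b) • qbarOp j b) * lorOp A := by
  have h := det_sl A
  have h' := conj_det_sl A
  refine LinearMap.ext fun x => funext fun s => ?_
  cases s <;> rename_i k <;>
    simp only [Module.End.mul_apply, LinearMap.add_apply, LinearMap.smul_apply, Pi.add_apply,
      Pi.smul_apply, qbarOp_phi, qbarOp_f, qbarOp_psi, qbarOp_chib, lorOp_phi, lorOp_f, lorOp_psi,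
      lorOp_chib, map_add, map_smul, map_neg, lorK_sigK, Fin.sum_univ_two]
  · module
  · fin_cases a <;> simp [eps] <;> match_scalars <;> grind
  · fin_cases k <;> simp [epsUp, eps] <;> match_scalars <;> grind
  · fin_cases a <;> fin_cases k <;> simp [delta]

theorem lorOp_zOp (A : Matrix.SpecialLinearGroup (Fin 2) ℂ) :
    lorOp (m := m) A * zOp = zOp * lorOp A := by
  have h := det_sl A
  have h' := conj_det_sl A
  refine LinearMap.ext fun x => funext fun s => ?_
  cases s <;> rename_i k
  · simp only [Module.End.mul_apply, zOp_phi, lorOp_phi, lorOp_f, ← boxK_apply, lorK_boxK,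
      map_smul]
  · simp only [Module.End.mul_apply, zOp_f, lorOp_phi, lorOp_f, map_smul]
  · simp only [Module.End.mul_apply, zOp_psi, lorOp_psi, lorOp_chib, map_add, map_smul, lorK_sigK,
      Fin.sum_univ_two]
    fin_cases k <;> simp [epsUp, eps] <;> match_scalars <;> grind
  · simp only [Module.End.mul_apply, zOp_chib, lorOp_psi, lorOp_chib, map_add, map_smul, lorK_sigK,
      Fin.sum_univ_two]
    fin_cases k <;> simp [epsUp, eps] <;> match_scalars <;> grind

end Multi

end Hyper

namespace Hyper

/-! ### Complex conjugation and charge conjugation -/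

namespace ShellSpace

variable {m : ℝ}

/-- Complex conjugation of test functions, as a conjugate linear map. -/
noncomputable def conjLin : Test →ₛₗ[starRingEnd ℂ] Test where
  toFun := conjTest
  map_add' := conjTest_add
  map_smul' := conjTest_smul

/-- Complex conjugation on the mass shell. -/
noncomputable def conjK : ShellSpace m →ₛₗ[starRingEnd ℂ] ShellSpace m :=
  Submodule.liftQ _ ((mk (m := m)).comp conjLin) fun _ hg =>
    LinearMap.mem_ker.2 (mk_conjTest_eq_zero (mk_eq_zero.2 (mem_ker.1 hg)))

@[simp] theorem conjK_mk (g : Test) : conjK (m := m) (mk g) = mk (conjTest g) := rfl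

theorem conjK_conjK (x : ShellSpace m) : conjK (conjK x) = x := by
  obtain ⟨g, rfl⟩ := mk_surjective x
  simp [conjTest_conjTest]

theorem form_conjK (x y : ShellSpace m) :
    form (conjK x) (conjK y) = (starRingEnd ℂ) (form x y) := by
  obtain ⟨g, rfl⟩ := mk_surjective x
  obtain ⟨h, rfl⟩ := mk_surjective y
  exact pauliJordan_conjTest m g h

theorem conjK_sigK (a b : Fin 2) (x : ShellSpace m) : conjK (sigK a b x) = sigK b a (conjK x) := by
  obtain ⟨g, rfl⟩ := mk_surjective x
  simp [sigK_mk, conjTest_sigPd]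

theorem conjK_pdK (μ : Fin 4) (x : ShellSpace m) : conjK (pdK μ x) = pdK μ (conjK x) := by
  obtain ⟨g, rfl⟩ := mk_surjective x
  simp [conjTest_pd]

theorem conjK_lorK (A : Matrix.SpecialLinearGroup (Fin 2) ℂ) (x : ShellSpace m) :
    conjK (lorK A x) = lorK A (conjK x) := by
  obtain ⟨g, rfl⟩ := mk_surjective x
  rfl

theorem conjK_transK (a : Spacetime) (x : ShellSpace m) :
    conjK (transK a x) = transK a (conjK x) := by
  obtain ⟨g, rfl⟩ := mk_surjective x
  simp only [conjK_mk, transK_mk]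
  congr 1

end ShellSpace

namespace Multi

open ShellSpace

variable {m : ℝ}

/-- The entries of a matrix of `SU(2)`. -/
theorem conj_su (u : Matrix.specialUnitaryGroup (Fin 2) ℂ) :
    (starRingEnd ℂ) (u.1 0 0) = u.1 1 1 ∧ (starRingEnd ℂ) (u.1 0 1) = -u.1 1 0 ∧
      (starRingEnd ℂ) (u.1 1 0) = -u.1 0 1 ∧ (starRingEnd ℂ) (u.1 1 1) = u.1 0 0 := by
  have h := Matrix.mem_specialUnitaryGroup_iff.1 u.2
  have h1 : u.1 * u.1.adjugate = 1 := by rw [Matrix.mul_adjugate, h.2, one_smul]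
  have h2 : star u.1 * u.1 = 1 := Unitary.star_mul_self_of_mem h.1
  have h3 : star u.1 = u.1.adjugate := left_inv_eq_right_inv h2 h1
  have e := fun i j => congrFun (congrFun h3 i) j
  have e00 := e 0 0
  have e01 := e 0 1
  have e10 := e 1 0
  have e11 := e 1 1
  simp only [Matrix.star_apply, Matrix.adjugate_fin_two, RCLike.star_def] at e00 e01 e10 e11
  exact ⟨by simpa using e00, by simpa using e10, by simpa using e01, by simpa using e11⟩

theorem suOp_qOp (u : Matrix.specialUnitaryGroup (Fin 2) ℂ) (j a : Fin 2) :
    suOp (m := m) u * qOp j a = (∑ k, u.1 j k • qOp k a) * suOp u := by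
  have h := det_su u
  refine LinearMap.ext fun x => funext fun s => ?_
  cases s <;> rename_i k <;>
    simp only [Module.End.mul_apply, LinearMap.add_apply, LinearMap.smul_apply, Pi.add_apply,
      Pi.smul_apply, qOp_phi, qOp_f, qOp_psi, qOp_chib, suOp_phi, suOp_f, suOp_psi,
      suOp_chib, map_add, map_smul, Fin.sum_univ_two]
  · fin_cases j <;> fin_cases k <;> simp [delta]
  · fin_cases j <;> fin_cases k <;> simp [delta]
  · fin_cases j <;> simp [eps] <;> match_scalars <;> grind
  · fin_cases j <;> simp [eps] <;> match_scalars <;> grind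

theorem suOp_zOp (u : Matrix.specialUnitaryGroup (Fin 2) ℂ) :
    suOp (m := m) u * zOp = zOp * suOp u := by
  refine LinearMap.ext fun x => funext fun s => ?_
  cases s <;> rename_i k <;>
    simp only [Module.End.mul_apply, zOp_phi, zOp_f, zOp_psi, zOp_chib, suOp_phi, suOp_f,
      suOp_psi, suOp_chib, map_add, map_smul] <;> module

/-! #### Charge conjugation -/

/-- The conjugation of an irreducible multiplet. -/
noncomputable def theta : Multi m →ₛₗ[starRingEnd ℂ] Multi m where
  toFun x
    | .phi k => ∑ j, eps j k • conjK (x (.phi j))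
    | .f k => ∑ j, eps j k • conjK (x (.f j))
    | .psi a => -conjK (x (.chib a))
    | .chib a => conjK (x (.psi a))
  map_add' x y := by
    ext s
    cases s <;> simp <;> module
  map_smul' c x := by
    ext s
    cases s <;> simp <;> module

section

variable (x : Multi m) (k : Fin 2)

theorem theta_phi :
    theta x (.phi k) = eps 0 k • conjK (x (.phi 0)) + eps 1 k • conjK (x (.phi 1)) := by
  simp [theta, Fin.sum_univ_two]

theorem theta_f :
    theta x (.f k) = eps 0 k • conjK (x (.f 0)) + eps 1 k • conjK (x (.f 1)) := by
  simp [theta, Fin.sum_univ_two]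

theorem theta_psi : theta x (.psi k) = -conjK (x (.chib k)) := rfl

theorem theta_chib : theta x (.chib k) = conjK (x (.psi k)) := rfl

end

theorem HasParity.theta {q : Bool} {x : Multi m} (h : HasParity q x) : HasParity q (theta x) := by
  intro s hs
  cases q <;> cases s <;> simp [Slot.isFermi] at hs
  · simp [theta_psi, h.chib]
  · simp [theta_chib, h.psi]
  · simp [theta_phi, h.phi]
  · simp [theta_f, h.f]

/-- The sign comes from the antisymmetry of `ε` on the scalars (an `SU(2)` doublet is pseudoreal)
and is matched by the sign in the spinor slots. So `theta` is no real structure, and two copies are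
needed. -/
theorem theta_theta (x : Multi m) : theta (theta x) = -x := by
  funext s
  cases s <;> rename_i k <;> fin_cases k <;>
    simp [theta_phi, theta_f, theta_psi, theta_chib, eps, conjK_conjK]

theorem cForm_theta {q : Bool} {x y : Multi m} (hx : HasParity q x) (hy : HasParity q y) :
    cForm (theta x) (theta y) = sgn q * (starRingEnd ℂ) (cForm x y) := by
  rw [cForm_apply, cForm_apply]
  cases q
  · simp [theta_phi, theta_f, theta_psi, theta_chib, hx.psi, hx.chib, eps, form_conjK,
      map_ofNat]
    ring
  · simp [theta_phi, theta_f, theta_psi, theta_chib, hx.phi, hx.f, eps, form_conjK,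
      map_ofNat]
    ring

theorem theta_qOp {q : Bool} {x : Multi m} (hx : HasParity q x) (j a : Fin 2) :
    theta (qOp j a x) = -sgn q • qbarOp j a (theta x) := by
  funext s
  cases q
  · cases s <;> rename_i k <;> simp only [Pi.smul_apply, theta_phi, theta_f, theta_psi,
      theta_chib, qOp_phi, qOp_f, qOp_psi, qOp_chib, qbarOp_phi, qbarOp_f, qbarOp_psi,
      qbarOp_chib, hx.psi, hx.chib, map_add, map_neg, map_zero, LinearMap.map_smulₛₗ, conjK_sigK,
      map_mul, conj_eps, conj_delta, map_ofNat] <;>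
    fin_cases j <;> fin_cases a <;> fin_cases k <;> simp [eps, epsUp, delta]
  · cases s <;> rename_i k <;> simp only [Pi.smul_apply, theta_phi, theta_f, theta_psi,
      theta_chib, qOp_phi, qOp_f, qOp_psi, qOp_chib, qbarOp_phi, qbarOp_f, qbarOp_psi,
      qbarOp_chib, hx.phi, hx.f, map_add, map_neg, map_zero, LinearMap.map_smulₛₗ, conjK_sigK,
      map_mul, conj_eps, conj_delta, map_ofNat] <;>
    fin_cases j <;> fin_cases a <;> fin_cases k <;> simp [eps, epsUp, delta]

/-- Obtained by applying `theta` to the relation for `qOp`, since `theta` is invertible. -/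
theorem theta_qbarOp {q : Bool} {x : Multi m} (hx : HasParity q x) (j a : Fin 2) :
    theta (qbarOp j a x) = -sgn q • qOp j a (theta x) := by
  have h := congrArg theta (theta_qOp hx.theta j a)
  rw [theta_theta, theta_theta, map_neg, smul_neg, map_neg, map_smulₛₗ] at h
  cases q <;> simpa using h.symm

theorem theta_zOp (x : Multi m) : theta (zOp x) = -zOp (theta x) := by
  have h1 := sigK_comm (m := m) 1 1 0 0
  have h2 := sigK_comm (m := m) 1 0 0 1
  funext s
  cases s <;> rename_i k <;> fin_cases k <;> simp [theta_phi, theta_f, theta_psi, theta_chib,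
    zOp_phi, zOp_f, zOp_psi, zOp_chib, eps, epsUp, conjK_sigK, h1, h2] <;> module

theorem ext_of_hasParity {f g : Module.End ℂ (Multi m)}
    (h : ∀ q x, HasParity q x → f x = g x) : f = g := by
  refine LinearMap.ext fun x => ?_
  have e : x = (fun s => if s.isFermi = false then x s else 0)
      + fun s => if s.isFermi = true then x s else 0 :=
    funext fun s => by cases hs : s.isFermi <;> simp [hs]
  rw [e, map_add, map_add, h false _ fun _ hs => if_neg hs, h true _ fun _ hs => if_neg hs]

/-- Transport of the relation for `qOp` by `theta`. A product of two charges acquires a sign,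
whatever the parity of the vector, and so does `zOp`; the coefficients are real. -/
theorem qbarOp_qbarOp (j a k b : Fin 2) :
    qbarOp (m := m) j a * qbarOp k b + qbarOp k b * qbarOp j a
      = (2 * eps a b * eps j k) • zOp := by
  have key : ∀ {q : Bool} {x : Multi m}, HasParity q x → ∀ j a k b : Fin 2,
      theta (qbarOp j a (qbarOp k b x)) = -qOp j a (qOp k b (theta x)) := by
    intro q x hx j a k b
    rw [theta_qbarOp (hx.qbarOp k b), theta_qbarOp hx, map_smul]
    cases q <;> simp
  refine ext_of_hasParity fun q x hx => ?_
  have h := LinearMap.congr_fun (qOp_qOp j a k b) (theta x)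
  simp only [LinearMap.add_apply, Module.End.mul_apply, LinearMap.smul_apply] at h ⊢
  rw [← neg_inj, ← theta_theta, ← theta_theta, map_add, key hx, key hx, map_smulₛₗ, theta_zOp,
    ← neg_add, h, smul_neg]
  simp [conj_eps, Complex.conj_ofNat]

theorem zOp_qbarOp (j a : Fin 2) : zOp (m := m) * qbarOp j a = qbarOp j a * zOp :=
  commute_of_acomm (c := 2 * eps a (1 - a) * eps j (1 - j))
    (by fin_cases j <;> fin_cases a <;> simp [eps])
    ((qbarOp_qbarOp j a j a).trans (by fin_cases a <;> simp [eps]))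
    (qbarOp_qbarOp j a (1 - j) (1 - a))

theorem theta_pOp (μ : Fin 4) (x : Multi m) : theta (pOp μ x) = -pOp μ (theta x) := by
  funext s
  cases s <;> simp [theta_phi, theta_f, theta_psi, theta_chib, pOp, conjK_pdK] <;> module

theorem theta_lorOp (A : Matrix.SpecialLinearGroup (Fin 2) ℂ) (x : Multi m) :
    theta (lorOp A x) = lorOp A (theta x) := by
  funext s
  cases s <;> simp [theta_phi, theta_f, theta_psi, theta_chib, lorOp_phi, lorOp_f, lorOp_psi,
    lorOp_chib, conjK_lorK] <;> module

theorem theta_transK (a : Spacetime) (x : Multi m) :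
    theta (each (transK a) x) = each (transK a) (theta x) := by
  funext s
  cases s <;> simp [theta_phi, theta_f, theta_psi, theta_chib, conjK_transK]

theorem theta_suOp (u : Matrix.specialUnitaryGroup (Fin 2) ℂ) (x : Multi m) :
    theta (suOp u x) = suOp u (theta x) := by
  obtain ⟨h1, h2, h3, h4⟩ := conj_su u
  funext s
  cases s <;> rename_i k <;> fin_cases k <;> simp [theta_phi, theta_f, theta_psi, theta_chib,
    suOp_phi, suOp_f, suOp_psi, suOp_chib, eps, h1, h2, h3, h4] <;> module

end Multi

end Hyper

namespace Hyper

/-! ### Two copies of the multiplet and the causal form -/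

/-- One-particle vectors: two copies of an irreducible multiplet. -/
abbrev OneParticle (m : ℝ) : Type := Fin 2 → Multi m

namespace OneParticle

open ShellSpace Multi

variable {m : ℝ}

/-- The grading by the spin. -/
noncomputable def space (m : ℝ) : SuperSpace (OneParticle m) where
  part q :=
    { carrier := {x | ∀ r, HasParity q (x r)}
      add_mem' := fun hx hy r s hs => by simp [hx r s hs, hy r s hs]
      zero_mem' := fun r s hs => rfl
      smul_mem' := fun c x hx r s hs => by simp [hx r s hs] }
  proj q :=
    { toFun := fun x r s => if s.isFermi = q then x r s else 0
      map_add' := fun x y => by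
        ext r s
        by_cases h : s.isFermi = q <;> simp [h]
      map_smul' := fun c x => by
        ext r s
        by_cases h : s.isFermi = q <;> simp [h] }
  proj_mem q x r s hs := if_neg hs
  proj_of_mem q x hx p := by
    ext r s
    by_cases hs : s.isFermi = q
    · by_cases hp : p = q
      · subst hp
        simp [hs]
      · simp [hs, hp, Ne.symm hp]
    · have h0 := hx r s hs
      by_cases hp : p = q <;> simp [hp, h0]
  proj_add x := by
    ext r s
    cases h : s.isFermi <;> simp [h]

/-- The diagonal action of an operator on the two copies. -/
noncomputable def diag : Module.End ℂ (Multi m) →ₗ[ℂ] Module.End ℂ (OneParticle m) where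
  toFun δ := δ.compLeft (Fin 2)
  map_add' _ _ := rfl
  map_smul' _ _ := rfl

@[simp] theorem diag_apply (δ : Module.End ℂ (Multi m)) (x : OneParticle m) (r : Fin 2) :
    diag δ x r = δ (x r) := rfl

theorem diag_mul (δ ε : Module.End ℂ (Multi m)) : diag (δ * ε) = diag δ * diag ε := rfl

theorem diag_one : diag (1 : Module.End ℂ (Multi m)) = 1 := rfl

theorem diag_mem_endPart {p : Bool} {δ : Module.End ℂ (Multi m)}
    (h : ∀ q x, HasParity q x → HasParity (p ^^ q) (δ x)) : diag δ ∈ (space m).endPart p :=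
  fun q _ hx r => h q _ (hx r)

/-- The form that determines the causal brackets. -/
noncomputable def bForm (α : ℂ) (β : ℝ) : OneParticle m →ₗ[ℂ] OneParticle m →ₗ[ℂ] ℂ :=
  LinearMap.mk₂ ℂ (fun x y =>
    cForm (x 0) (α • y 0 + (β : ℂ) • y 1 + zOp (y 1))
      + cForm (x 1) ((β : ℂ) • y 0 - zOp (y 0) - (starRingEnd ℂ) α • y 1))
    (fun x y z => by simp; ring) (fun c x y => by simp; ring)
    (fun x y z => by simp; ring) (fun c x y => by simp; ring)

theorem bForm_apply (α : ℂ) (β : ℝ) (x y : OneParticle m) : bForm α β x y =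
    cForm (x 0) (α • y 0 + (β : ℂ) • y 1 + zOp (y 1))
      + cForm (x 1) ((β : ℂ) • y 0 - zOp (y 0) - (starRingEnd ℂ) α • y 1) := rfl

theorem bForm_expand (α : ℂ) (β : ℝ) (x y : OneParticle m) : bForm α β x y =
    α * cForm (x 0) (y 0) + β * cForm (x 0) (y 1) + cForm (x 0) (zOp (y 1))
      + β * cForm (x 1) (y 0) - cForm (x 1) (zOp (y 0))
      - (starRingEnd ℂ) α * cForm (x 1) (y 1) := by
  rw [bForm_apply]
  simp only [map_add, map_sub, map_smul, smul_eq_mul]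
  ring

/-- The form that determines the causal brackets, with its symmetries. -/
noncomputable def causalForm (m : ℝ) (α : ℂ) (β : ℝ) : (space m).Form where
  form := bForm α β
  even q r x y hx hy h := by
    rw [bForm_expand, cForm_even (hx 0) (hy 0) h, cForm_even (hx 0) (hy 1) h,
      cForm_even (hx 1) (hy 0) h, cForm_even (hx 1) (hy 1) h,
      cForm_even (hx 0) (hy 1).zOp h, cForm_even (hx 1) (hy 0).zOp h]
    ring
  symm q x y hx hy := by
    rw [bForm_expand, bForm_expand, cForm_symm (hx 0) (hy 0), cForm_symm (hx 1) (hy 0),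
      cForm_symm (hx 0) (hy 1), cForm_symm (hx 1) (hy 1), cForm_symm (hx 1).zOp (hy 0),
      cForm_symm (hx 0).zOp (hy 1), cForm_zOp, cForm_zOp]
    ring

theorem causalForm_form (m : ℝ) (α : ℂ) (β : ℝ) : (causalForm m α β).form = bForm α β := rfl

/-- Each entry of `bForm` is `cForm` with a constant or `±zOp` inserted. Since `δ` commutes with
`zOp`, invariance of `cForm` suffices, for all values of the parameters at once. -/
theorem skew_diag (α : ℂ) (β : ℝ) {p : Bool} {δ : Module.End ℂ (Multi m)}
    (hz : zOp * δ = δ * zOp)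
    (h : ∀ q x, HasParity q x → ∀ y, cForm (δ x) y + sgn (p && q) * cForm x (δ y) = 0) :
    (causalForm m α β).Skew p (diag δ) := fun q x hx y => by
  have hz' : ∀ y, zOp (δ y) = δ (zOp y) := fun y => LinearMap.congr_fun hz y
  change bForm α β _ _ + _ * bForm α β _ _ = 0
  simp only [bForm_expand, diag_apply, hz']
  linear_combination α * h q _ (hx 0) (y 0) + β * h q _ (hx 0) (y 1) + h q _ (hx 0) (zOp (y 1))
    + β * h q _ (hx 1) (y 0) - h q _ (hx 1) (zOp (y 0))
    - (starRingEnd ℂ) α * h q _ (hx 1) (y 1)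

theorem bForm_diag_diag (α : ℂ) (β : ℝ) {u : Module.End ℂ (Multi m)} (hz : u * zOp = zOp * u)
    (h : ∀ x y, cForm (u x) (u y) = cForm x y) (x y : OneParticle m) :
    bForm α β (diag u x) (diag u y) = bForm α β x y := by
  have hz' : ∀ y, zOp (u y) = u (zOp y) := fun y => (LinearMap.congr_fun hz y).symm
  simp only [bForm_expand, diag_apply, hz', h]

/-- The conjugation of one-particle vectors. -/
noncomputable def conj : OneParticle m →ₛₗ[starRingEnd ℂ] OneParticle m where
  toFun x r := if r = 0 then -theta (x 1) else theta (x 0)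
  map_add' x y := by
    funext r
    by_cases h : r = 0
    · simp only [h, Pi.add_apply, map_add, if_true, neg_add]
    · simp only [h, Pi.add_apply, map_add, if_false]
  map_smul' c x := by
    funext r
    by_cases h : r = 0
    · simp only [h, Pi.smul_apply, LinearMap.map_smulₛₗ, if_true, smul_neg]
    · simp only [h, Pi.smul_apply, LinearMap.map_smulₛₗ, if_false]

@[simp] theorem conj_zero_apply (x : OneParticle m) : conj x 0 = -theta (x 1) := rfl

@[simp] theorem conj_one_apply (x : OneParticle m) : conj x 1 = theta (x 0) := rfl

theorem conj_conj (x : OneParticle m) : conj (conj x) = x := by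
  funext r
  fin_cases r <;> simp [theta_theta]

theorem conj_mem {q : Bool} {x : OneParticle m} (hx : x ∈ (space m).part q) :
    conj x ∈ (space m).part q := by
  intro r
  fin_cases r
  · intro s hs
    simp [(hx 1).theta s hs]
  · exact (hx 0).theta

theorem conj_diag {δ δ' : Module.End ℂ (Multi m)} {c : ℂ} {q : Bool} {x : OneParticle m}
    (hx : x ∈ (space m).part q)
    (h : ∀ x, HasParity q x → theta (δ x) = c • δ' (theta x)) :
    conj (diag δ x) = c • diag δ' (conj x) := by
  funext r
  fin_cases r
  · simp [h _ (hx 1)]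
  · simp [h _ (hx 0)]

/-- The conjugation exchanges the copies. It matches the diagonal entries `α` and `-ᾱ`, matches the
off-diagonal constants because `β` is real, and matches the terms with `zOp` because `zOp`
anticommutes with `theta`. -/
theorem bForm_conj (α : ℂ) (β : ℝ) {q : Bool} {x y : OneParticle m} (hx : x ∈ (space m).part q)
    (hy : y ∈ (space m).part q) :
    bForm α β (conj x) (conj y) = -sgn q * (starRingEnd ℂ) (bForm α β x y) := by
  have hz : ∀ x : Multi m, zOp (theta x) = -theta (zOp x) := fun x => by simp [theta_zOp]
  simp only [bForm_expand, conj_zero_apply, conj_one_apply, map_neg, LinearMap.neg_apply, hz,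
    cForm_theta (hx 0) (hy 0), cForm_theta (hx 0) (hy 1), cForm_theta (hx 1) (hy 0),
    cForm_theta (hx 1) (hy 1), cForm_theta (hx 0) (hy 1).zOp, cForm_theta (hx 1) (hy 0).zOp,
    map_add, map_sub, map_mul, conj_ofReal, Complex.conj_conj]
  ring

/-! #### The vectors of the fields -/

/-- The inclusion of a component. -/
noncomputable def single (r : Fin 2) (s : Slot) : Test →ₗ[ℂ] OneParticle m :=
  LinearMap.single ℂ (fun _ => Multi m) r ∘ₗ LinearMap.single ℂ (fun _ => ShellSpace m) s ∘ₗ mk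

theorem single_apply (r r' : Fin 2) (s s' : Slot) (g : Test) :
    single (m := m) r s g r' s' = if r' = r then if s' = s then mk g else 0 else 0 := by
  by_cases h : r' = r
  · subst h
    simp [single, Pi.single_apply]
  · simp [single, Pi.single_apply, h]

section

variable (r j a b k : Fin 2) (g : Test)

/-- The operators were defined by the slots of their values. The lemmas of this group read them by
the slots of their arguments, and this is the form of the transformation laws of the fields. -/
theorem qOp_single_phi : diag (qOp j a) (single (m := m) r (.phi k) g)
    = eps j k • single r (.psi a) g := by
  funext r' s
  by_cases hr : r' = r
  · cases s <;> rename_i l <;> fin_cases k <;> fin_cases a <;> fin_cases l <;>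
      simp [Multi.qOp_phi, Multi.qOp_f, Multi.qOp_psi, Multi.qOp_chib,
        single_apply, hr, eps, epsUp, delta]
  · cases s <;> simp [Multi.qOp_phi, Multi.qOp_f, Multi.qOp_psi, Multi.qOp_chib, single_apply, hr]

theorem qOp_single_f : diag (qOp j a) (single (m := m) r (.f k) g)
    = eps j k • ∑ b, ∑ c, epsUp b c • single r (.chib c) (sigPd a b g) := by
  funext r' s
  by_cases hr : r' = r
  · cases s <;> rename_i l <;> fin_cases k <;> fin_cases l <;>
      simp [Multi.qOp_phi, Multi.qOp_f, Multi.qOp_psi, Multi.qOp_chib,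
        single_apply, hr, eps, epsUp, delta, sigK_mk, Fin.sum_univ_two]
  · cases s <;> simp [Multi.qOp_phi, Multi.qOp_f, Multi.qOp_psi, Multi.qOp_chib, single_apply, hr]

theorem qOp_single_psi : diag (qOp j a) (single (m := m) r (.psi b) g)
    = (2 * I * eps a b) • single r (.f j) g := by
  funext r' s
  by_cases hr : r' = r
  · cases s <;> rename_i l <;> fin_cases j <;> fin_cases b <;> fin_cases l <;>
      simp [Multi.qOp_phi, Multi.qOp_f, Multi.qOp_psi, Multi.qOp_chib,
        single_apply, hr, eps, epsUp, delta, smul_smul]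
  · cases s <;> simp [Multi.qOp_phi, Multi.qOp_f, Multi.qOp_psi, Multi.qOp_chib, single_apply, hr]

theorem qOp_single_chib : diag (qOp j a) (single (m := m) r (.chib b) g)
    = (2 * I) • single r (.phi j) (sigPd a b g) := by
  funext r' s
  by_cases hr : r' = r
  · cases s <;> rename_i l <;> fin_cases j <;> fin_cases b <;> fin_cases l <;>
      simp [Multi.qOp_phi, Multi.qOp_f, Multi.qOp_psi, Multi.qOp_chib,
        single_apply, hr, eps, epsUp, delta, sigK_mk]
  · cases s <;> simp [Multi.qOp_phi, Multi.qOp_f, Multi.qOp_psi, Multi.qOp_chib, single_apply, hr]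

theorem qbarOp_single_phi : diag (qbarOp j a) (single (m := m) r (.phi k) g)
    = delta j k • single r (.chib a) g := by
  funext r' s
  by_cases hr : r' = r
  · cases s <;> rename_i l <;> fin_cases j <;> fin_cases k <;> fin_cases a <;> fin_cases l <;>
      simp [Multi.qbarOp_phi, Multi.qbarOp_f, Multi.qbarOp_psi, Multi.qbarOp_chib,
        single_apply, hr, eps, epsUp, delta]
  · cases s <;> simp [Multi.qbarOp_phi, Multi.qbarOp_f, Multi.qbarOp_psi, Multi.qbarOp_chib, single_apply, hr]

theorem qbarOp_single_f : diag (qbarOp j a) (single (m := m) r (.f k) g)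
    = -delta j k • ∑ b, ∑ c, epsUp b c • single r (.psi c) (sigPd b a g) := by
  funext r' s
  by_cases hr : r' = r
  · cases s <;> rename_i l <;> fin_cases j <;> fin_cases k <;> fin_cases l <;>
      simp [Multi.qbarOp_phi, Multi.qbarOp_f, Multi.qbarOp_psi, Multi.qbarOp_chib,
        single_apply, hr, eps, epsUp, delta, sigK_mk, Fin.sum_univ_two]
  · cases s <;> simp [Multi.qbarOp_phi, Multi.qbarOp_f, Multi.qbarOp_psi, Multi.qbarOp_chib, single_apply, hr]

theorem zOp_single_phi : diag zOp (single (m := m) r (.phi k) g) = -I • single r (.f k) g := by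
  funext r' s
  by_cases hr : r' = r
  · cases s <;> rename_i l <;> fin_cases k <;> fin_cases l <;>
      simp [Multi.zOp_phi, Multi.zOp_f, Multi.zOp_psi, Multi.zOp_chib,
        single_apply, hr, eps, epsUp, delta]
  · cases s <;> simp [Multi.zOp_phi, Multi.zOp_f, Multi.zOp_psi, Multi.zOp_chib, single_apply, hr]

theorem zOp_single_f : diag zOp (single (m := m) r (.f k) g) = -I • single r (.phi k) (box g) := by
  funext r' s
  by_cases hr : r' = r
  · cases s <;> rename_i l <;> fin_cases k <;> fin_cases l <;>
      simp [Multi.zOp_phi, Multi.zOp_f, Multi.zOp_psi, Multi.zOp_chib,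
        single_apply, hr, eps, epsUp, delta, box_eq_sigPd, sigK_mk]
  · cases s <;> simp [Multi.zOp_phi, Multi.zOp_f, Multi.zOp_psi, Multi.zOp_chib, single_apply, hr]

theorem zOp_single_psi : diag zOp (single (m := m) r (.psi a) g)
    = -I • ∑ b, ∑ c, epsUp b c • single r (.chib c) (sigPd a b g) := by
  funext r' s
  by_cases hr : r' = r
  · cases s <;> rename_i l <;> fin_cases a <;> fin_cases l <;>
      simp [Multi.zOp_phi, Multi.zOp_f, Multi.zOp_psi, Multi.zOp_chib,
        single_apply, hr, eps, epsUp, delta, sigK_mk, Fin.sum_univ_two]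
  · cases s <;> simp [Multi.zOp_phi, Multi.zOp_f, Multi.zOp_psi, Multi.zOp_chib, single_apply, hr]

end

end OneParticle

end Hyper

namespace Hyper

namespace OneParticle

open ShellSpace Multi

variable {m : ℝ}

/-- The one-particle vectors created by the fields. -/
noncomputable def vec : Comp → Test →ₗ[ℂ] OneParticle m
  | .phi j => single 0 (.phi j)
  | .phiStar j => ∑ k, eps j k • single 1 (.phi k)
  | .f j => single 0 (.f j)
  | .fStar j => ∑ k, eps j k • single 1 (.f k)
  | .psi a => I • single 0 (.psi a)
  | .psiBar a => -I • single 1 (.chib a)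
  | .chi a => I • single 1 (.psi a)
  | .chiBar a => I • single 0 (.chib a)

section

variable (j a b k : Fin 2) (g : Test)

theorem vec_phi : vec (m := m) (.phi j) g = single 0 (.phi j) g := rfl

theorem vec_phiStar : vec (m := m) (.phiStar j) g
    = eps j 0 • single 1 (.phi 0) g + eps j 1 • single 1 (.phi 1) g := by
  simp [vec, Fin.sum_univ_two]

theorem vec_f : vec (m := m) (.f j) g = single 0 (.f j) g := rfl

theorem vec_fStar : vec (m := m) (.fStar j) g
    = eps j 0 • single 1 (.f 0) g + eps j 1 • single 1 (.f 1) g := by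
  simp [vec, Fin.sum_univ_two]

theorem vec_psi : vec (m := m) (.psi a) g = I • single 0 (.psi a) g := rfl

theorem vec_psiBar : vec (m := m) (.psiBar a) g = -I • single 1 (.chib a) g := rfl

theorem vec_chi : vec (m := m) (.chi a) g = I • single 1 (.psi a) g := rfl

theorem vec_chiBar : vec (m := m) (.chiBar a) g = I • single 0 (.chib a) g := rfl

theorem vec_mem (X : Comp) : vec X g ∈ (space m).part X.isFermi := by
  have h : ∀ r s, single (m := m) r s g ∈ (space m).part s.isFermi := fun r s r' s' hs => by
    rw [single_apply]
    split_ifs with h1 h2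
    · exact absurd (by rw [h2]) hs
    · rfl
    · rfl
  cases X
  · exact h 0 (.phi _)
  · rw [vec_phiStar]
    exact add_mem (Submodule.smul_mem _ _ (h 1 (.phi 0))) (Submodule.smul_mem _ _ (h 1 (.phi 1)))
  · exact h 0 (.f _)
  · rw [vec_fStar]
    exact add_mem (Submodule.smul_mem _ _ (h 1 (.f 0))) (Submodule.smul_mem _ _ (h 1 (.f 1)))
  · exact Submodule.smul_mem _ _ (h 0 (.psi _))
  · exact Submodule.smul_mem _ _ (h 1 (.chib _))
  · exact Submodule.smul_mem _ _ (h 1 (.psi _))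
  · exact Submodule.smul_mem _ _ (h 0 (.chib _))

theorem conj_apply (x : OneParticle m) (r : Fin 2) :
    conj x r = if r = 0 then -theta (x 1) else theta (x 0) := rfl

theorem conj_single_phi : conj (single (m := m) 0 (.phi k) (conjTest g))
    = eps k 0 • single 1 (.phi 0) g + eps k 1 • single 1 (.phi 1) g := by
  funext r' s
  rw [conj_apply]
  by_cases hr : r' = 0
  · subst hr
    cases s <;> rename_i l <;> fin_cases k <;> fin_cases l <;> simp [theta_phi, theta_f, theta_psi, theta_chib,
      single_apply, conjTest_conjTest, eps]
  · obtain rfl : r' = 1 := by omega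
    cases s <;> rename_i l <;> fin_cases k <;> fin_cases l <;> simp [theta_phi, theta_f, theta_psi, theta_chib,
      single_apply, conjTest_conjTest, eps]

theorem conj_single_f : conj (single (m := m) 0 (.f k) (conjTest g))
    = eps k 0 • single 1 (.f 0) g + eps k 1 • single 1 (.f 1) g := by
  funext r' s
  rw [conj_apply]
  by_cases hr : r' = 0
  · subst hr
    cases s <;> rename_i l <;> fin_cases k <;> fin_cases l <;> simp [theta_phi, theta_f, theta_psi, theta_chib,
      single_apply, conjTest_conjTest, eps]
  · obtain rfl : r' = 1 := by omega
    cases s <;> rename_i l <;> fin_cases k <;> fin_cases l <;> simp [theta_phi, theta_f, theta_psi, theta_chib,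
      single_apply, conjTest_conjTest, eps]

theorem conj_single_zero_psi : conj (single (m := m) 0 (.psi a) (conjTest g))
    = single 1 (.chib a) g := by
  funext r' s
  rw [conj_apply]
  by_cases hr : r' = 0
  · subst hr
    cases s <;> rename_i l <;> fin_cases a <;> fin_cases l <;> simp [theta_phi, theta_f, theta_psi, theta_chib,
      single_apply, conjTest_conjTest, eps]
  · obtain rfl : r' = 1 := by omega
    cases s <;> rename_i l <;> fin_cases a <;> fin_cases l <;> simp [theta_phi, theta_f, theta_psi, theta_chib,
      single_apply, conjTest_conjTest, eps]

theorem conj_single_one_psi : conj (single (m := m) 1 (.psi a) (conjTest g))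
    = -single 0 (.chib a) g := by
  funext r' s
  rw [conj_apply]
  by_cases hr : r' = 0
  · subst hr
    cases s <;> rename_i l <;> fin_cases a <;> fin_cases l <;> simp [theta_phi, theta_f, theta_psi, theta_chib,
      single_apply, conjTest_conjTest, eps]
  · obtain rfl : r' = 1 := by omega
    cases s <;> rename_i l <;> fin_cases a <;> fin_cases l <;> simp [theta_phi, theta_f, theta_psi, theta_chib,
      single_apply, conjTest_conjTest, eps]

theorem conj_vec_phi : conj (vec (m := m) (.phi j) (conjTest g)) = vec (.phiStar j) g := by
  rw [vec_phi, vec_phiStar, conj_single_phi]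

theorem conj_vec_f : conj (vec (m := m) (.f j) (conjTest g)) = vec (.fStar j) g := by
  rw [vec_f, vec_fStar, conj_single_f]

theorem conj_vec_psi : conj (vec (m := m) (.psi a) (conjTest g)) = vec (.psiBar a) g := by
  rw [vec_psi, vec_psiBar, LinearMap.map_smulₛₗ, conj_single_zero_psi, conj_I]

theorem conj_vec_chi : conj (vec (m := m) (.chi a) (conjTest g)) = vec (.chiBar a) g := by
  rw [vec_chi, vec_chiBar, LinearMap.map_smulₛₗ, conj_single_one_psi, conj_I, smul_neg, neg_smul,
    neg_neg]

/-! ### Supersymmetry transformations of the vectors of the fields -/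

theorem I_mul_two_I : I * (2 * I) = -2 := by
  linear_combination 2 * I_sq

theorem qOp_vec_phi :
    I • diag (qOp j a) (vec (m := m) (.phi k) g) = eps j k • vec (.psi a) g := by
  rw [vec_phi, vec_psi, qOp_single_phi, smul_comm]

theorem qbarOp_vec_phi :
    I • diag (qbarOp j a) (vec (m := m) (.phi k) g) = delta j k • vec (.chiBar a) g := by
  rw [vec_phi, vec_chiBar, qbarOp_single_phi, smul_comm]

theorem qOp_vec_f : diag (qOp j a) (vec (m := m) (.f k) g)
    = (-I * eps j k) • ∑ b, ∑ c, epsUp b c • vec (.chiBar c) (sigPd a b g) := by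
  simp only [vec_f, vec_chiBar, qOp_single_f, Fin.sum_univ_two]
  match_scalars <;> linear_combination (eps j k * epsUp _ _) * I_sq

theorem qbarOp_vec_f : diag (qbarOp j a) (vec (m := m) (.f k) g)
    = (I * delta j k) • ∑ b, ∑ c, epsUp b c • vec (.psi c) (sigPd b a g) := by
  simp only [vec_f, vec_psi, qbarOp_single_f, Fin.sum_univ_two]
  match_scalars <;> linear_combination (-delta j k * epsUp _ _) * I_sq

theorem qOp_vec_psi :
    diag (qOp j a) (vec (m := m) (.psi b) g) = (-2 * eps a b) • vec (.f j) g := by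
  rw [vec_psi, vec_f, map_smul, qOp_single_psi, smul_smul]
  congr 1
  linear_combination (2 * eps a b) * I_sq

theorem qOp_vec_psiBar : diag (qOp j a) (vec (m := m) (.psiBar b) g)
    = -((2 : ℂ) • ∑ k, eps j k • vec (.phiStar k) (sigPd a b g)) := by
  simp only [vec_psiBar, vec_phiStar, map_smul, qOp_single_chib, Fin.sum_univ_two]
  fin_cases j <;> simp [eps, smul_smul, I_mul_two_I]

theorem qOp_vec_chi : diag (qOp j a) (vec (m := m) (.chi b) g)
    = (2 * eps a b) • ∑ k, eps j k • vec (.fStar k) g := by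
  simp only [vec_chi, vec_fStar, map_smul, qOp_single_psi, Fin.sum_univ_two]
  fin_cases j <;> fin_cases a <;> fin_cases b <;> simp [eps, smul_smul, I_mul_two_I]

theorem qOp_vec_chiBar : diag (qOp j a) (vec (m := m) (.chiBar b) g)
    = -((2 : ℂ) • vec (.phi j) (sigPd a b g)) := by
  simp only [vec_chiBar, vec_phi, map_smul, qOp_single_chib]
  simp [smul_smul, I_mul_two_I]

theorem zOp_vec_phi : I • diag zOp (vec (m := m) (.phi j) g) = vec (.f j) g := by
  simp [vec_phi, vec_f, zOp_single_phi, smul_smul]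

theorem zOp_vec_f : I • diag zOp (vec (m := m) (.f j) g) = vec (.phi j) (box g) := by
  simp [vec_phi, vec_f, zOp_single_f, smul_smul]

theorem zOp_vec_psi : diag zOp (vec (m := m) (.psi a) g)
    = -I • ∑ b, ∑ c, epsUp b c • vec (.chiBar c) (sigPd a b g) := by
  simp only [vec_psi, vec_chiBar, map_smul, zOp_single_psi, Fin.sum_univ_two]
  module

theorem zOp_vec_chi : diag zOp (vec (m := m) (.chi a) g)
    = I • ∑ b, ∑ c, epsUp b c • vec (.psiBar c) (sigPd a b g) := by
  simp only [vec_chi, vec_psiBar, map_smul, zOp_single_psi, Fin.sum_univ_two]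
  module

end

/-! #### The group actions on the vectors of the fields -/

theorem each_single {T : Module.End ℂ (ShellSpace m)} {T' : Test → Test}
    (hT : ∀ g, T (mk g) = mk (T' g)) (r : Fin 2) (s : Slot) (g : Test) :
    diag (each T) (single r s g) = single r s (T' g) := by
  funext r' s'
  simp only [diag_apply, each_apply, single_apply]
  split_ifs <;> simp [hT]

theorem each_vec {T : Module.End ℂ (ShellSpace m)} {T' : Test → Test}
    (hT : ∀ g, T (mk g) = mk (T' g)) (X : Comp) (g : Test) :
    diag (each T) (vec X g) = vec X (T' g) := by
  cases X <;> simp [vec, each_single hT]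

section

variable (A : Matrix.SpecialLinearGroup (Fin 2) ℂ) (u : Matrix.specialUnitaryGroup (Fin 2) ℂ)
  (r a k : Fin 2) (g : Test)

theorem lorOp_single_phi :
    diag (lorOp A) (single (m := m) r (.phi k) g) = single r (.phi k) (lorentzTest A g) := by
  funext r' s
  by_cases hr : r' = r
  · cases s <;> rename_i l <;> fin_cases k <;> fin_cases l <;>
      simp [lorOp_phi, lorOp_f, lorOp_psi, lorOp_chib, single_apply, hr]
  · cases s <;> simp [lorOp_phi, lorOp_f, lorOp_psi, lorOp_chib, single_apply, hr]

theorem lorOp_single_f :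
    diag (lorOp A) (single (m := m) r (.f k) g) = single r (.f k) (lorentzTest A g) := by
  funext r' s
  by_cases hr : r' = r
  · cases s <;> rename_i l <;> fin_cases k <;> fin_cases l <;>
      simp [lorOp_phi, lorOp_f, lorOp_psi, lorOp_chib, single_apply, hr]
  · cases s <;> simp [lorOp_phi, lorOp_f, lorOp_psi, lorOp_chib, single_apply, hr]

theorem lorOp_single_psi : diag (lorOp A) (single (m := m) r (.psi a) g)
    = ∑ b, A.1 a b • single r (.psi b) (lorentzTest A g) := by
  funext r' s
  by_cases hr : r' = r
  · cases s <;> rename_i l <;> fin_cases a <;> fin_cases l <;>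
      simp [lorOp_phi, lorOp_f, lorOp_psi, lorOp_chib, single_apply, hr]
  · cases s <;> simp [lorOp_phi, lorOp_f, lorOp_psi, lorOp_chib, single_apply, hr]

theorem suOp_single_phi : diag (suOp u) (single (m := m) r (.phi k) g)
    = ∑ l, u.1 k l • single r (.phi l) g := by
  funext r' s
  by_cases hr : r' = r
  · cases s <;> rename_i l <;> fin_cases k <;> fin_cases l <;>
      simp [suOp_phi, suOp_f, suOp_psi, suOp_chib, single_apply, hr]
  · cases s <;> simp [suOp_phi, suOp_f, suOp_psi, suOp_chib, single_apply, hr]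

theorem suOp_single_f : diag (suOp u) (single (m := m) r (.f k) g)
    = ∑ l, u.1 k l • single r (.f l) g := by
  funext r' s
  by_cases hr : r' = r
  · cases s <;> rename_i l <;> fin_cases k <;> fin_cases l <;>
      simp [suOp_phi, suOp_f, suOp_psi, suOp_chib, single_apply, hr]
  · cases s <;> simp [suOp_phi, suOp_f, suOp_psi, suOp_chib, single_apply, hr]

theorem suOp_single_psi :
    diag (suOp u) (single (m := m) r (.psi a) g) = single r (.psi a) g := by
  funext r' s
  by_cases hr : r' = r
  · cases s <;> simp [suOp_phi, suOp_f, suOp_psi, suOp_chib, single_apply, hr]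
  · cases s <;> simp [suOp_phi, suOp_f, suOp_psi, suOp_chib, single_apply, hr]

theorem lorOp_vec_phi :
    diag (lorOp A) (vec (m := m) (.phi k) g) = vec (.phi k) (lorentzTest A g) :=
  lorOp_single_phi A 0 k g

theorem lorOp_vec_f :
    diag (lorOp A) (vec (m := m) (.f k) g) = vec (.f k) (lorentzTest A g) :=
  lorOp_single_f A 0 k g

theorem lorOp_vec_psi : diag (lorOp A) (vec (m := m) (.psi a) g)
    = ∑ b, A.1 a b • vec (.psi b) (lorentzTest A g) := by
  simp only [vec_psi, map_smul, lorOp_single_psi, Finset.smul_sum, smul_comm I]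

theorem lorOp_vec_chi : diag (lorOp A) (vec (m := m) (.chi a) g)
    = ∑ b, A.1 a b • vec (.chi b) (lorentzTest A g) := by
  simp only [vec_chi, map_smul, lorOp_single_psi, Finset.smul_sum, smul_comm I]

theorem suOp_vec_phi :
    diag (suOp u) (vec (m := m) (.phi k) g) = ∑ l, u.1 k l • vec (.phi l) g :=
  suOp_single_phi u 0 k g

theorem suOp_vec_f :
    diag (suOp u) (vec (m := m) (.f k) g) = ∑ l, u.1 k l • vec (.f l) g :=
  suOp_single_f u 0 k g

theorem suOp_vec_psi : diag (suOp u) (vec (m := m) (.psi a) g) = vec (.psi a) g := by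
  rw [vec_psi, map_smul, suOp_single_psi]

theorem suOp_vec_chi : diag (suOp u) (vec (m := m) (.chi a) g) = vec (.chi a) g := by
  rw [vec_chi, map_smul, suOp_single_psi]

end

end OneParticle

end Hyper

namespace Hyper

namespace OneParticle

open ShellSpace Multi

variable {m : ℝ}

/-! #### Independence -/

/-- The place of the only nonzero component of `vec X`. -/
def place : Comp → Fin 2 × Slot
  | .phi j => (0, .phi j)
  | .phiStar j => (1, .phi (1 - j))
  | .f j => (0, .f j)
  | .fStar j => (1, .f (1 - j))
  | .psi a => (0, .psi a)
  | .psiBar a => (1, .chib a)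
  | .chi a => (1, .psi a)
  | .chiBar a => (0, .chib a)

/-- The coefficient of the only nonzero component of `vec X`. -/
noncomputable def coeff : Comp → ℂ
  | .phi _ => 1
  | .phiStar j => eps j (1 - j)
  | .f _ => 1
  | .fStar j => eps j (1 - j)
  | .psi _ => I
  | .psiBar _ => -I
  | .chi _ => I
  | .chiBar _ => I

/-- Different field components occupy different slots; this is the source of linear independence. -/
theorem place_injective : Function.Injective place := by
  intro X Y h
  cases X <;> cases Y <;> simp [place] at h ⊢ <;> exact h

theorem vec_apply (X : Comp) (g : Test) (r : Fin 2) (s : Slot) :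
    vec (m := m) X g r s = if (r, s) = place X then coeff X • mk g else 0 := by
  cases X <;> rename_i j
  case phiStar =>
    rw [vec_phiStar]
    by_cases hr : r = 1
    · cases s <;> rename_i l <;> fin_cases j <;> fin_cases l <;>
        simp [single_apply, place, coeff, hr, eps]
    · simp [single_apply, place, hr]
  case fStar =>
    rw [vec_fStar]
    by_cases hr : r = 1
    · cases s <;> rename_i l <;> fin_cases j <;> fin_cases l <;>
        simp [single_apply, place, coeff, hr, eps]
    · simp [single_apply, place, hr]
  all_goals
    simp only [vec_phi, vec_f, vec_psi, vec_psiBar, vec_chi, vec_chiBar, Pi.smul_apply,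
      single_apply, place, coeff, Prod.mk.injEq, one_smul]
    split_ifs <;> simp_all

theorem vec_eq_zero_of_sum_eq_zero {S : Finset Comp} {G : Comp → Test}
    (h : ∑ X ∈ S, vec (m := m) X (G X) = 0) : ∀ X ∈ S, vec (m := m) X (G X) = 0 := by
  intro X hX
  funext r s
  by_cases hp : (r, s) = place X
  · have h' := congrFun (congrFun h r) s
    rw [Finset.sum_apply, Finset.sum_apply, Finset.sum_eq_single_of_mem X hX] at h'
    · exact h'
    · intro Y _ hY
      rw [vec_apply, if_neg]
      rw [hp]
      exact fun e => hY (place_injective e.symm)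
  · rw [vec_apply, if_neg hp]
    rfl

/-! #### The causal brackets are derivatives of the Pauli–Jordan distribution -/

/-- Vectors that are derivatives of a test function. -/
def IsDeriv (v : Test → ShellSpace m) : Prop := ∃ p, ∀ h, v h = mk (diffOp p h)

theorem IsDeriv.add {v w : Test → ShellSpace m} (hv : IsDeriv v) (hw : IsDeriv w) :
    IsDeriv fun h => v h + w h := by
  obtain ⟨p, hp⟩ := hv
  obtain ⟨q, hq⟩ := hw
  exact ⟨p + q, fun h => by
    beta_reduce; rw [hp, hq, diffOp_add, map_add]⟩

theorem IsDeriv.smul {v : Test → ShellSpace m} (c : ℂ) (hv : IsDeriv v) :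
    IsDeriv fun h => c • v h := by
  obtain ⟨p, hp⟩ := hv
  exact ⟨MvPolynomial.C c * p, fun h => by
    beta_reduce; rw [hp, diffOp_mul, diffOp_C, map_smul]⟩

theorem IsDeriv.sub {v w : Test → ShellSpace m} (hv : IsDeriv v) (hw : IsDeriv w) :
    IsDeriv fun h => v h - w h := by
  simpa [sub_eq_add_neg] using hv.add (hw.smul (-1))

theorem IsDeriv.sigK {v : Test → ShellSpace m} (a b : Fin 2) (hv : IsDeriv v) :
    IsDeriv fun h => sigK a b (v h) := by
  obtain ⟨p, hp⟩ := hv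
  exact ⟨sigmaD a b * p, fun h => by
    beta_reduce; rw [hp, sigK_mk, diffOp_mul, diffOp_sigmaD]⟩

theorem isDeriv_mk : IsDeriv (m := m) fun h => mk h :=
  ⟨MvPolynomial.C 1, fun h => by rw [diffOp_C, one_smul]⟩

theorem isDeriv_zero : IsDeriv (m := m) fun _ => 0 := by
  simpa using isDeriv_mk.smul (m := m) 0

theorem isDeriv_vec (X : Comp) (r : Fin 2) (s : Slot) :
    IsDeriv fun h => vec (m := m) X h r s := by
  simp only [vec_apply]
  split_ifs
  · exact isDeriv_mk.smul _
  · exact isDeriv_zero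

theorem isDeriv_zOp {w : Test → Multi m} (hw : ∀ s, IsDeriv fun h => w h s) (s : Slot) :
    IsDeriv fun h => zOp (w h) s := by
  cases s
  · exact ((((hw _).sigK 1 1).sigK 0 0).sub (((hw _).sigK 1 0).sigK 0 1)).smul _
  · exact (hw _).smul _
  · simp only [zOp_psi]
    exact (((((hw _).sigK 0 0).smul _).add (((hw _).sigK 1 0).smul _)).add
      ((((hw _).sigK 0 1).smul _).add (((hw _).sigK 1 1).smul _))).smul _
  · simp only [zOp_chib]
    exact (((((hw _).sigK 0 0).smul _).add (((hw _).sigK 0 1).smul _)).add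
      ((((hw _).sigK 1 0).smul _).add (((hw _).sigK 1 1).smul _))).smul _

/-- Brackets that are derivatives of the Pauli–Jordan distribution. -/
def IsCausal (m : ℝ) (b : Test → Test → ℂ) : Prop :=
  ∃ p, ∀ g h, b g h = -I * pauliJordanD m p g h

theorem IsCausal.add {b c : Test → Test → ℂ} (hb : IsCausal m b) (hc : IsCausal m c) :
    IsCausal m fun g h => b g h + c g h := by
  obtain ⟨p, hp⟩ := hb
  obtain ⟨q, hq⟩ := hc
  refine ⟨p + q, fun g h => ?_⟩
  have := (pjForm m g).map_add (diffOp p h) (diffOp q h)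
  simp only [pjForm_apply] at this
  beta_reduce
  rw [hp, hq, pauliJordanD, pauliJordanD, pauliJordanD, diffOp_add, this,
    mul_add]

theorem IsCausal.smul {b : Test → Test → ℂ} (c : ℂ) (hb : IsCausal m b) :
    IsCausal m fun g h => c * b g h := by
  obtain ⟨p, hp⟩ := hb
  refine ⟨MvPolynomial.C c * p, fun g h => ?_⟩
  beta_reduce
  rw [hp, pauliJordanD, pauliJordanD, diffOp_mul, diffOp_C, pauliJordan_smul_right]
  ring

theorem IsCausal.sub {b c : Test → Test → ℂ} (hb : IsCausal m b) (hc : IsCausal m c) :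
    IsCausal m fun g h => b g h - c g h := by
  simpa [sub_eq_add_neg] using hb.add (hc.smul (-1))

theorem isCausal_form {v w : Test → ShellSpace m} {c : ℂ} (hv : ∀ g, v g = c • mk g)
    (hw : IsDeriv w) : IsCausal m fun g h => form (v g) (w h) := by
  obtain ⟨p, hp⟩ := hw
  refine ⟨MvPolynomial.C (I * c) * p, fun g h => ?_⟩
  beta_reduce
  rw [hv, hp, pauliJordanD, diffOp_mul, diffOp_C, pauliJordan_smul_right, map_smul,
    LinearMap.smul_apply, form_mk, smul_eq_mul]
  linear_combination (c * pauliJordan m g (diffOp p h)) * I_sq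

theorem isCausal_cForm (X : Comp) (r : Fin 2) {w : Test → Multi m}
    (hw : ∀ s, IsDeriv fun h => w h s) : IsCausal m fun g h => cForm (vec X g r) (w h) := by
  have key : ∀ s t, IsCausal m fun g h => form (vec X g r s) (w h t) := fun s t =>
    isCausal_form (c := if (r, s) = place X then coeff X else 0)
      (fun g => by rw [vec_apply]; split_ifs <;> simp) (hw t)
  simp only [cForm_apply]
  exact ((((key _ _).sub (key _ _)).sub (key _ _)).add (key _ _)).add
    (((((key _ _).sub (key _ _)).add (key _ _)).sub (key _ _)).smul _)

/-- Both `cForm` and `zOp` are built from constants and the operators `σ^μ ∂_μ`, so every derivative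
can be collected on the second test function. -/
theorem isCausal_bForm (α : ℂ) (β : ℝ) (X Y : Comp) :
    IsCausal m fun g h => bForm (m := m) α β (vec X g) (vec Y h) := by
  have h1 := fun r r' => isCausal_cForm (m := m) X r (isDeriv_vec Y r')
  have h2 := fun r r' => isCausal_cForm (m := m) X r (isDeriv_zOp (isDeriv_vec Y r'))
  simp only [bForm_expand]
  exact (((((((h1 0 0).smul _).add ((h1 0 1).smul _)).add (h2 0 1)).add ((h1 1 0).smul _)).sub
    (h2 1 0)).sub ((h1 1 1).smul _))

/-! #### The table of causal brackets -/

section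

variable (α : ℂ) (β : ℝ) (j k a b : Fin 2) (g h : Test)

theorem bForm_phi_phi : bForm (m := m) α β (vec (.phi j) g) (vec (.phi k) h) = 0 := by
  simp [bForm_expand, cForm_apply, vec_phi, single_apply, zOp_phi, zOp_f, zOp_psi, zOp_chib]

/-- The parameters drop out, because `cForm` pairs scalar slots `φ` only with `f`. The entry `zOp`
between the copies maps `φ` to `f` with the factor `-I` and gives the canonical bracket. -/
theorem bForm_phi_phiStar : bForm (m := m) α β (vec (.phi j) g) (vec (.phiStar k) h)
    = -I * delta j k * pauliJordan m g h := by
  fin_cases j <;> fin_cases k <;> simp [bForm_expand, cForm_apply, vec_phi, vec_phiStar,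
    single_apply, Multi.zOp_phi, Multi.zOp_f, Multi.zOp_psi, Multi.zOp_chib, eps, delta]

theorem bForm_f_fStar : bForm (m := m) α β (vec (.f j) g) (vec (.fStar k) h)
    = -I * (m : ℂ) ^ 2 * delta j k * pauliJordan m g h := by
  have e : ∀ x : ShellSpace m, sigK 0 0 (sigK 1 1 x) - sigK 0 1 (sigK 1 0 x)
      = -((m : ℂ) ^ 2) • x := fun x => by
    obtain ⟨g, rfl⟩ := mk_surjective x
    rw [← boxK_apply, boxK_mk, mk_box]
  fin_cases j <;> fin_cases k <;> simp [bForm_expand, cForm_apply, vec_f, vec_fStar,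
    single_apply, Multi.zOp_phi, Multi.zOp_f, Multi.zOp_psi, Multi.zOp_chib, eps, delta, e,
    mul_assoc]

theorem bForm_phi_f : bForm (m := m) α β (vec (.phi j) g) (vec (.f k) h)
    = α * eps j k * pauliJordan m g h := by
  fin_cases j <;> fin_cases k <;> simp [bForm_expand, cForm_apply, vec_f, vec_phi,
    single_apply, Multi.zOp_phi, Multi.zOp_f, Multi.zOp_psi, Multi.zOp_chib, eps]

theorem bForm_phi_fStar : bForm (m := m) α β (vec (.phi j) g) (vec (.fStar k) h)
    = β * delta j k * pauliJordan m g h := by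
  fin_cases j <;> fin_cases k <;> simp [bForm_expand, cForm_apply, vec_phi, vec_fStar,
    single_apply, Multi.zOp_phi, Multi.zOp_f, Multi.zOp_psi, Multi.zOp_chib, eps, delta]

theorem bForm_psi_psi : bForm (m := m) α β (vec (.psi a) g) (vec (.psi b) h)
    = -2 * I * α * eps a b * pauliJordan m g h := by
  fin_cases a <;> fin_cases b <;> simp [bForm_expand, cForm_apply, vec_psi,
    single_apply, Multi.zOp_phi, Multi.zOp_f, Multi.zOp_psi, Multi.zOp_chib, eps] <;>
    ring_nf <;> simp [I_pow_three, I_pow_four]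

/-- Only the entry `zOp` contributes: it sends the slot of `χ̄` to that of `ψ` by a first-order
operator. -/
theorem bForm_psi_psiBar : bForm (m := m) α β (vec (.psi a) g) (vec (.psiBar b) h)
    = 2 * pauliJordan m g (sigPd a b h) := by
  fin_cases a <;> fin_cases b <;> simp [bForm_expand, cForm_apply, vec_psi, vec_psiBar,
    single_apply, Multi.zOp_phi, Multi.zOp_f, Multi.zOp_psi, Multi.zOp_chib, eps, epsUp,
    sigK_mk] <;>
    ring_nf <;> simp [I_pow_three, I_pow_four]

theorem bForm_chi_chi : bForm (m := m) α β (vec (.chi a) g) (vec (.chi b) h)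
    = 2 * I * (starRingEnd ℂ) α * eps a b * pauliJordan m g h := by
  fin_cases a <;> fin_cases b <;> simp [bForm_expand, cForm_apply, vec_chi,
    single_apply, Multi.zOp_phi, Multi.zOp_f, Multi.zOp_psi, Multi.zOp_chib, eps] <;>
    ring_nf <;> simp [I_pow_three, I_pow_four]

theorem bForm_chi_chiBar : bForm (m := m) α β (vec (.chi a) g) (vec (.chiBar b) h)
    = 2 * pauliJordan m g (sigPd a b h) := by
  fin_cases a <;> fin_cases b <;> simp [bForm_expand, cForm_apply, vec_chi, vec_chiBar,
    single_apply, Multi.zOp_phi, Multi.zOp_f, Multi.zOp_psi, Multi.zOp_chib, eps, epsUp,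
    sigK_mk] <;>
    ring_nf <;> simp [I_pow_three, I_pow_four]

theorem bForm_psi_chi : bForm (m := m) α β (vec (.psi a) g) (vec (.chi b) h)
    = -2 * I * β * eps a b * pauliJordan m g h := by
  fin_cases a <;> fin_cases b <;> simp [bForm_expand, cForm_apply, vec_psi, vec_chi,
    single_apply, Multi.zOp_phi, Multi.zOp_f, Multi.zOp_psi, Multi.zOp_chib, eps] <;>
    ring_nf <;> simp [I_pow_three, I_pow_four]

theorem bForm_f_f : bForm (m := m) α β (vec (.f j) g) (vec (.f k) h) = 0 := by
  simp [bForm_expand, cForm_apply, vec_f, single_apply, Multi.zOp_phi, Multi.zOp_f,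
    Multi.zOp_psi, Multi.zOp_chib]

theorem bForm_psi_chiBar : bForm (m := m) α β (vec (.psi a) g) (vec (.chiBar b) h) = 0 := by
  simp [bForm_expand, cForm_apply, vec_psi, vec_chiBar, single_apply, Multi.zOp_phi,
    Multi.zOp_f, Multi.zOp_psi, Multi.zOp_chib]

end

end OneParticle

end Hyper

namespace Hyper

/-! ### Doubling an algebra to obtain a `*`-algebra -/

/-- The product of an algebra and its opposite, with the exchange of the factors as involution. -/
def Double (A : Type) : Type := A × Aᵐᵒᵖ

namespace Double

variable {A : Type}

/-- The first component. -/
def left (x : Double A) : A := x.1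

/-- The second component. -/
def right (x : Double A) : A := x.2.unop

/-- The element with given components. -/
def pair (a b : A) : Double A := (a, MulOpposite.op b)

@[simp] theorem left_pair (a b : A) : (pair a b).left = a := rfl

@[simp] theorem right_pair (a b : A) : (pair a b).right = b := rfl

theorem ext {x y : Double A} (h : x.left = y.left) (h' : x.right = y.right) : x = y :=
  Prod.ext h (MulOpposite.unop_injective h')

variable [Ring A]

instance : Ring (Double A) := inferInstanceAs (Ring (A × Aᵐᵒᵖ))

instance [Nontrivial A] : Nontrivial (Double A) := inferInstanceAs (Nontrivial (A × Aᵐᵒᵖ))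

@[simp] theorem left_one : (1 : Double A).left = 1 := rfl

@[simp] theorem right_one : (1 : Double A).right = 1 := rfl

@[simp] theorem left_zero : (0 : Double A).left = 0 := rfl

@[simp] theorem right_zero : (0 : Double A).right = 0 := rfl

@[simp] theorem left_add (x y : Double A) : (x + y).left = x.left + y.left := rfl

@[simp] theorem right_add (x y : Double A) : (x + y).right = x.right + y.right := rfl

@[simp] theorem left_sub (x y : Double A) : (x - y).left = x.left - y.left := rfl

@[simp] theorem right_sub (x y : Double A) : (x - y).right = x.right - y.right := rfl

@[simp] theorem left_mul (x y : Double A) : (x * y).left = x.left * y.left := rfl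

@[simp] theorem right_mul (x y : Double A) : (x * y).right = y.right * x.right := rfl

/-- The exchange reverses products because the second factor carries the opposite multiplication. It
replaces the adjoint with respect to an inner product of states, so no positivity is needed. -/
instance : StarRing (Double A) where
  star x := pair x.right x.left
  star_involutive _ := rfl
  star_mul _ _ := rfl
  star_add _ _ := rfl

@[simp] theorem left_star (x : Double A) : (star x).left = x.right := rfl

@[simp] theorem right_star (x : Double A) : (star x).right = x.left := rfl

section

variable [Algebra ℂ A]

/-- Scalars act on the second component through complex conjugation. -/
noncomputable def scalar : ℂ →+* Double A :=
  (algebraMap ℂ A).prod ((algebraMap ℂ Aᵐᵒᵖ).comp (starRingEnd ℂ))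

theorem left_scalar (c : ℂ) : (scalar c : Double A).left = algebraMap ℂ A c := rfl

theorem right_scalar (c : ℂ) :
    (scalar c : Double A).right = algebraMap ℂ A ((starRingEnd ℂ) c) := rfl

/-- The conjugate scalars on the second factor make the involution conjugate linear. -/
noncomputable instance : Algebra ℂ (Double A) :=
  scalar.toAlgebra' fun c x => ext (by simp [left_scalar, Algebra.commutes])
    (by simp [right_scalar, Algebra.commutes])

@[simp] theorem left_smul (c : ℂ) (x : Double A) : (c • x).left = c • x.left := by
  rw [Algebra.smul_def, left_mul, Algebra.smul_def]
  rfl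

@[simp] theorem right_smul (c : ℂ) (x : Double A) :
    (c • x).right = (starRingEnd ℂ) c • x.right := by
  rw [Algebra.smul_def, right_mul, Algebra.smul_def, Algebra.commutes]
  rfl

instance : StarModule ℂ (Double A) where
  star_smul c x := ext (by simp) (by simp)

end

end Double

theorem conj_sgn (b : Bool) : (starRingEnd ℂ) (sgn b) = sgn b := by cases b <;> simp

theorem sub_sgn_smul {A : Type} [AddCommGroup A] [Module ℂ A] (b : Bool) (x y : A) :
    x - sgn b • y = -sgn b • (y - sgn b • x) := by
  cases b <;> simp [add_comm]

namespace OneParticle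

open Multi ShellSpace Double

variable {m : ℝ}

/-! ### The operators of the multiplet -/

/-- The `*`-algebra in which the fields take their values. -/
abbrev Ops (m : ℝ) : Type := Double (Module.End ℂ (space m).Sym)

section

variable (α : ℂ) (β : ℝ)

/-- The field operator of a one-particle vector. -/
noncomputable def fieldOp : OneParticle m →ₗ[ℂ] Ops m where
  toFun x := pair ((causalForm m α β).op x) ((causalForm m α β).op (conj x))
  map_add' x y := Double.ext (by simp) (by simp)
  map_smul' c x := Double.ext (by simp) (by simp [map_smulₛₗ])

@[simp] theorem left_fieldOp (x : OneParticle m) :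
    (fieldOp α β x).left = (causalForm m α β).op x := rfl

@[simp] theorem right_fieldOp (x : OneParticle m) :
    (fieldOp α β x).right = (causalForm m α β).op (conj x) := rfl

theorem star_fieldOp (x : OneParticle m) : star (fieldOp α β x) = fieldOp α β (conj x) :=
  Double.ext (by simp) (by simp [conj_conj])

/-- The first component applied to the vacuum returns the generator, and the inclusion of the
generators is injective. -/
theorem fieldOp_injective : Function.Injective (fieldOp (m := m) α β) := fun x y h => by
  have h' := LinearMap.congr_fun (congrArg left h) 1
  rw [left_fieldOp, left_fieldOp, SuperSpace.Form.op_apply_one, SuperSpace.Form.op_apply_one] at h'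
  exact (space m).gen_injective h'

/-- In the second component the factors are reversed and the vectors conjugated. Graded antisymmetry
and `bForm_conj` together turn the form into its complex conjugate, which is the action of the
scalar there. -/
theorem fieldOp_bracket {q r : Bool} {x y : OneParticle m} (hx : x ∈ (space m).part q)
    (hy : y ∈ (space m).part r) :
    fieldOp α β x * fieldOp α β y - sgn (q && r) • (fieldOp α β y * fieldOp α β x)
      = bForm α β x y • 1 := by
  refine Double.ext ?_ ?_
  · have h := (causalForm m α β).op_bracket hx hy
    simp only [left_sub, left_mul, left_smul, left_one, left_fieldOp, h, causalForm_form]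
  · have h := (causalForm m α β).op_bracket (conj_mem hy) (conj_mem hx)
    rw [Bool.and_comm] at h
    simp only [right_sub, right_mul, right_smul, right_one, right_fieldOp, conj_sgn, h]
    congr 1
    by_cases hqr : q = r
    · subst hqr
      rw [(causalForm m α β).symm q _ _ (conj_mem hx) (conj_mem hy)]
      rw [causalForm_form, bForm_conj α β hx hy]
      linear_combination (starRingEnd ℂ) (bForm α β x y) * sgn_mul_self q
    · rw [(causalForm m α β).even r q _ _ (conj_mem hy) (conj_mem hx) (Ne.symm hqr)]
      have := (causalForm m α β).even q r _ _ hx hy hqr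
      rw [causalForm_form] at this
      rw [this, map_zero]

end

/-- The second quantization of a pair of operators of parity `p`. -/
noncomputable def charge (p : Bool) (δ δ' : Module.End ℂ (Multi m)) : Ops m :=
  pair ((space m).secondQuant p (diag δ)) ((space m).secondQuant p (diag δ'))

@[simp] theorem left_charge (p : Bool) (δ δ' : Module.End ℂ (Multi m)) :
    (charge p δ δ').left = (space m).secondQuant p (diag δ) := rfl

@[simp] theorem right_charge (p : Bool) (δ δ' : Module.End ℂ (Multi m)) :
    (charge p δ δ').right = (space m).secondQuant p (diag δ') := rfl

theorem star_charge (p : Bool) (δ δ' : Module.End ℂ (Multi m)) :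
    star (charge p δ δ') = charge p δ' δ := Double.ext (by simp) (by simp)

/-- Operators of parity `p`. -/
def endParity (m : ℝ) (p : Bool) : Submodule ℂ (Module.End ℂ (Multi m)) where
  carrier := {δ | ∀ q x, HasParity q x → HasParity (p ^^ q) (δ x)}
  zero_mem' q x _ := fun s _ => rfl
  add_mem' hδ hε q x hx := fun s hs => by
    simp [hδ q x hx s hs, hε q x hx s hs]
  smul_mem' c δ hδ q x hx := fun s hs => by
    simp [hδ q x hx s hs]

theorem diag_mem {p : Bool} {δ : Module.End ℂ (Multi m)} (h : δ ∈ endParity m p) :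
    diag δ ∈ (space m).endPart p := diag_mem_endPart h

/-- Infinitesimal symmetries of the causal form. -/
structure IsCharge (p : Bool) (δ : Module.End ℂ (Multi m)) : Prop where
  parity : δ ∈ endParity m p
  zOp : zOp * δ = δ * zOp
  skew : ∀ q x, HasParity q x → ∀ y, cForm (δ x) y + sgn (p && q) * cForm x (δ y) = 0

theorem isCharge_qOp (j a : Fin 2) : IsCharge (m := m) true (qOp j a) where
  parity q x hx := by simpa using hx.qOp j a
  zOp := zOp_qOp j a
  skew q x hx y := by simpa using cForm_qOp hx j a y

theorem isCharge_qbarOp (j a : Fin 2) : IsCharge (m := m) true (qbarOp j a) where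
  parity q x hx := by simpa using hx.qbarOp j a
  zOp := zOp_qbarOp j a
  skew q x hx y := by simpa using cForm_qbarOp hx j a y

theorem isCharge_zOp : IsCharge (m := m) false zOp where
  parity q x hx := by simpa using hx.zOp
  zOp := rfl
  skew q x hx y := by simp [cForm_zOp]

theorem isCharge_pOp (μ : Fin 4) : IsCharge (m := m) false (pOp μ) where
  parity q x hx := by simpa [pOp] using hx.each _
  zOp := (pOp_zOp μ).symm
  skew q x hx y := by
    rw [pOp, cForm_each]
    · simp
    · intro x y
      simp [form_pdK]

/-- The relation of the two components of a charge. -/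
def IsConj (p : Bool) (δ δ' : Module.End ℂ (Multi m)) : Prop :=
  ∀ q x, HasParity q x → theta (δ x) = -sgn (p && q) • δ' (theta x)

theorem isConj_qOp (j a : Fin 2) : IsConj (m := m) true (qOp j a) (qbarOp j a) :=
  fun q x hx => by simpa using theta_qOp hx j a

theorem isConj_qbarOp (j a : Fin 2) : IsConj (m := m) true (qbarOp j a) (qOp j a) :=
  fun q x hx => by simpa using theta_qbarOp hx j a

theorem isConj_zOp : IsConj (m := m) false zOp zOp :=
  fun q x _ => by simpa using theta_zOp x

theorem isConj_pOp (μ : Fin 4) : IsConj (m := m) false (pOp μ) (pOp μ) :=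
  fun q x _ => by simpa using theta_pOp μ x

/-- Reversing the product in the second component multiplies a graded commutator by `-sgn (p && q)`,
which is the sign in `IsConj`. -/
theorem charge_fieldOp (α : ℂ) (β : ℝ) {p q : Bool} {δ δ' : Module.End ℂ (Multi m)}
    (hδ : IsCharge p δ) (hδ' : IsCharge p δ') (h : IsConj p δ δ') {x : OneParticle m}
    (hx : x ∈ (space m).part q) :
    charge p δ δ' * fieldOp α β x - sgn (p && q) • (fieldOp α β x * charge p δ δ')
      = fieldOp α β (diag δ x) := by
  refine Double.ext ?_ ?_
  · simpa using SuperSpace.Form.secondQuant_op (B := causalForm m α β) (diag_mem hδ.parity)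
      (skew_diag α β hδ.zOp hδ.skew) hx
  · have e := SuperSpace.Form.secondQuant_op (B := causalForm m α β) (diag_mem hδ'.parity)
      (skew_diag α β hδ'.zOp hδ'.skew) (conj_mem hx)
    simp only [right_sub, right_mul, right_smul, right_fieldOp, right_charge, conj_sgn]
    rw [conj_diag hx (h q), map_smul, ← e]
    exact sub_sgn_smul _ _ _

/-- The hypothesis `h'` has its factors in the reverse order because the second component is
multiplied in the opposite algebra. -/
theorem charge_charge {p r : Bool} {δ δ' ε ε' η η' : Module.End ℂ (Multi m)}
    (hδ : IsCharge p δ) (hδ' : IsCharge p δ') (hε : IsCharge r ε) (hε' : IsCharge r ε')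
    (hη : η ∈ endParity m (p ^^ r)) (hη' : η' ∈ endParity m (p ^^ r))
    (h : δ * ε - sgn (p && r) • (ε * δ) = η) (h' : ε' * δ' - sgn (p && r) • (δ' * ε') = η') :
    charge p δ δ' * charge r ε ε' - sgn (p && r) • (charge r ε ε' * charge p δ δ')
      = charge (p ^^ r) η η' := by
  refine Double.ext ?_ ?_
  · simp only [left_sub, left_mul, left_smul, left_charge]
    refine SuperSpace.secondQuant_bracket _ (diag_mem hδ.parity) (diag_mem hε.parity)
      (diag_mem hη) ?_
    rw [← h, map_sub, map_smul, diag_mul, diag_mul]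
  · simp only [right_sub, right_mul, right_smul, right_charge, conj_sgn]
    rw [Bool.and_comm, Bool.xor_comm]
    rw [Bool.and_comm] at h'
    rw [Bool.xor_comm] at hη'
    refine SuperSpace.secondQuant_bracket _ (diag_mem hε'.parity) (diag_mem hδ'.parity)
      (diag_mem hη') ?_
    rw [← h', map_sub, map_smul, diag_mul, diag_mul]

theorem charge_add {p : Bool} {δ δ' ε ε' : Module.End ℂ (Multi m)} (hδ : δ ∈ endParity m p)
    (hδ' : δ' ∈ endParity m p) (hε : ε ∈ endParity m p) (hε' : ε' ∈ endParity m p) :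
    charge p (δ + ε) (δ' + ε') = charge p δ δ' + charge p ε ε' := by
  refine Double.ext ?_ ?_
  · simp [SuperSpace.secondQuant_add _ (diag_mem hδ) (diag_mem hε)]
  · simp [SuperSpace.secondQuant_add _ (diag_mem hδ') (diag_mem hε')]

theorem charge_smul {p : Bool} (c : ℂ) {δ δ' : Module.End ℂ (Multi m)} (hδ : δ ∈ endParity m p)
    (hδ' : δ' ∈ endParity m p) :
    charge p (c • δ) ((starRingEnd ℂ) c • δ') = c • charge p δ δ' := by
  refine Double.ext ?_ ?_
  · simp [SuperSpace.secondQuant_smul _ c (diag_mem hδ)]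
  · simp [SuperSpace.secondQuant_smul _ _ (diag_mem hδ')]

theorem charge_zero (p : Bool) : charge (m := m) p 0 0 = 0 :=
  Double.ext (by simp [SuperSpace.secondQuant_zero]) (by simp [SuperSpace.secondQuant_zero])

theorem charge_sum {ι : Type} {p : Bool} (s : Finset ι) (c : ι → ℂ)
    {δ δ' : ι → Module.End ℂ (Multi m)} (hδ : ∀ i, δ i ∈ endParity m p)
    (hδ' : ∀ i, δ' i ∈ endParity m p) :
    charge p (∑ i ∈ s, c i • δ i) (∑ i ∈ s, (starRingEnd ℂ) (c i) • δ' i)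
      = ∑ i ∈ s, c i • charge p (δ i) (δ' i) := by
  classical
  induction s using Finset.induction_on with
  | empty => simpa using charge_zero p
  | insert i s hi ih =>
    rw [Finset.sum_insert hi, Finset.sum_insert hi, Finset.sum_insert hi, ← ih,
      ← charge_smul _ (hδ i) (hδ' i), charge_add]
    · exact Submodule.smul_mem _ _ (hδ i)
    · exact Submodule.smul_mem _ _ (hδ' i)
    · exact Submodule.sum_mem _ fun k _ => Submodule.smul_mem _ _ (hδ k)
    · exact Submodule.sum_mem _ fun k _ => Submodule.smul_mem _ _ (hδ' k)

/-! ### Unitary representations -/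

/-- A group acting on one-particle vectors by symmetries; the action is from the right. -/
structure Action (m : ℝ) (G : Type) [Group G] where
  act : G → Module.End ℂ (Multi m)
  act_one : act 1 = 1
  act_mul : ∀ g h, act g * act h = act (h * g)
  parity : ∀ g, act g ∈ endParity m false
  zOp : ∀ g, act g * zOp = zOp * act g
  cForm : ∀ g x y, cForm (act g x) (act g y) = cForm x y
  theta : ∀ g x, theta (act g x) = act g (theta x)

namespace Action

variable {G H : Type} [Group G] [Group H] (S : Action m G) (S' : Action m H)

/-- The second quantization of the action. -/
noncomputable def sym (g : G) : Module.End ℂ (space m).Sym :=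
  ((space m).map (diag (S.act g)) (diag_mem (S.parity g))).toLinearMap

theorem sym_one : S.sym 1 = 1 := by
  refine LinearMap.ext fun x => ?_
  have h1 : (1 : Module.End ℂ (OneParticle m)) ∈ (space m).endPart false := by
    rw [← diag_one, ← S.act_one]
    exact diag_mem (S.parity 1)
  have := DFunLike.congr_fun ((space m).map_one h1) x
  simpa [sym, S.act_one, diag_one] using this

theorem sym_mul_sym {g : G} {h : H} {T : Module.End ℂ (Multi m)} (hT : T ∈ endParity m false)
    (e : S.act g * S'.act h = T) :
    S.sym g * S'.sym h = ((space m).map (diag T) (diag_mem hT)).toLinearMap := by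
  subst e
  have h1 := diag_mem hT
  rw [diag_mul] at h1
  refine LinearMap.ext fun x => ?_
  have := DFunLike.congr_fun ((space m).map_comp (diag (S.act g)) (diag (S'.act h))
    (diag_mem (S.parity g)) (diag_mem (S'.parity h)) h1) x
  simpa [sym, diag_mul] using this

theorem sym_mul (g h : G) : S.sym g * S.sym h = S.sym (h * g) :=
  S.sym_mul_sym S (S.parity _) (S.act_mul g h)

theorem sym_inv_mul (g : G) : S.sym g⁻¹ * S.sym g = 1 := by
  rw [sym_mul, mul_inv_cancel, sym_one]

theorem sym_mul_inv (g : G) : S.sym g * S.sym g⁻¹ = 1 := by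
  rw [sym_mul, inv_mul_cancel, sym_one]

/-- The unitary representation on the space of states. -/
noncomputable def rep : G →* unitary (Ops m) where
  -- As `star` exchanges the components, unitarity means that they are inverse to each other. The
  -- right action `sym` becomes a homomorphism through the inverse in the first component and the
  -- opposite product in the second.
  toFun g := ⟨pair (S.sym g⁻¹) (S.sym g), by
    rw [Unitary.mem_iff]
    exact ⟨Double.ext (S.sym_mul_inv g) (S.sym_mul_inv g),
      Double.ext (S.sym_inv_mul g) (S.sym_inv_mul g)⟩⟩
  map_one' := Subtype.ext (Double.ext (by simp [sym_one]) (by simp [sym_one]))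
  map_mul' g h := Subtype.ext (Double.ext (by simp [sym_mul]) (by simp [sym_mul]))

@[simp] theorem left_rep (g : G) : (S.rep g : Ops m).left = S.sym g⁻¹ := rfl

@[simp] theorem right_rep (g : G) : (S.rep g : Ops m).right = S.sym g := rfl

theorem star_rep_mul_mul_rep {g : G} {x y : Ops m} (h : S.sym g * x.left = y.left * S.sym g)
    (h' : S.sym g * x.right = y.right * S.sym g) :
    star (S.rep g : Ops m) * x * S.rep g = y := by
  refine Double.ext ?_ ?_
  · simp only [left_mul, left_star, right_rep, left_rep, h]
    rw [mul_assoc, sym_mul_inv, mul_one]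
  · simp only [right_mul, right_star, right_rep, left_rep]
    rw [← mul_assoc, h', mul_assoc, sym_mul_inv, mul_one]

theorem rep_fieldOp (α : ℂ) (β : ℝ) (g : G) (x : OneParticle m) :
    star (S.rep g : Ops m) * fieldOp α β x * S.rep g = fieldOp α β (diag (S.act g) x) := by
  have hB : ∀ x y, (causalForm m α β).form (diag (S.act g) x) (diag (S.act g) y)
      = (causalForm m α β).form x y := by
    rw [causalForm_form]
    exact bForm_diag_diag α β (S.zOp g) (S.cForm g)
  have hop := SuperSpace.Form.map_op (causalForm m α β) (diag_mem (S.parity g)) hB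
  have e : conj (diag (S.act g) x) = diag (S.act g) (conj x) := by
    refine funext fun r => ?_
    fin_cases r <;> simp [S.theta]
  refine S.star_rep_mul_mul_rep ?_ ?_
  · rw [left_fieldOp, left_fieldOp, sym, hop]
  · rw [right_fieldOp, right_fieldOp, e, sym, hop]

theorem rep_charge {g : G} {p : Bool} {δ δ' ε ε' : Module.End ℂ (Multi m)}
    (hδ : δ ∈ endParity m p) (hδ' : δ' ∈ endParity m p) (hε : ε ∈ endParity m p)
    (hε' : ε' ∈ endParity m p) (h : S.act g * δ = ε * S.act g)
    (h' : S.act g * δ' = ε' * S.act g) :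
    star (S.rep g : Ops m) * charge p δ δ' * S.rep g = charge p ε ε' := by
  refine S.star_rep_mul_mul_rep ?_ ?_
  · exact SuperSpace.map_secondQuant (diag_mem (S.parity g)) (diag_mem hδ) (diag_mem hε)
      (by rw [← diag_mul, h, diag_mul])
  · exact SuperSpace.map_secondQuant (diag_mem (S.parity g)) (diag_mem hδ') (diag_mem hε')
      (by rw [← diag_mul, h', diag_mul])

theorem rep_mul_rep {g : G} {h h' : H} (e : S.act g * S'.act h' = S'.act h * S.act g) :
    S.rep g * S'.rep h = S'.rep h' * S.rep g := by
  have par : S'.act h * S.act g ∈ endParity m false := fun q x hx => by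
    simpa using S'.parity h _ _ (S.parity g _ _ hx)
  have e1 : S.sym g * S'.sym h' = S'.sym h * S.sym g :=
    (S.sym_mul_sym S' par e).trans (S'.sym_mul_sym S par rfl).symm
  refine Subtype.ext (Double.ext ?_ e1.symm)
  change S.sym g⁻¹ * S'.sym h⁻¹ = S'.sym h'⁻¹ * S.sym g⁻¹
  -- Both sides are inverse to the common value in `e1`, so the relation of the second components
  -- gives that of the first.
  refine left_inv_eq_right_inv (a := S'.sym h * S.sym g) ?_ ?_
  · rw [mul_assoc, ← mul_assoc (S'.sym h⁻¹), sym_inv_mul, one_mul, sym_inv_mul]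
  · rw [← e1, mul_assoc, ← mul_assoc (S'.sym h'), sym_mul_inv, one_mul, sym_mul_inv]

end Action

/-- The action of the translations. -/
noncomputable def translations (m : ℝ) : Action m (Multiplicative Spacetime) where
  act a := each (transK a.toAdd)
  act_one := LinearMap.ext fun x => funext fun s => transK_zero _
  act_mul a b := LinearMap.ext fun x => funext fun s => by
    rw [mul_comm b a]
    exact transK_transK _ _ _
  parity a q x hx := by simpa using hx.each _
  zOp a := each_zOp fun b c x => transK_sigK _ b c x
  cForm a := cForm_each_each (form_transK _)
  theta a := theta_transK _

/-- The action of `SL(2, ℂ)`. -/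
noncomputable def lorentzAction (m : ℝ) :
    Action m (Matrix.SpecialLinearGroup (Fin 2) ℂ) where
  act := lorOp
  act_one := lorOp_one
  act_mul := lorOp_mul
  parity A q x hx := by simpa using hx.lorOp A
  zOp := lorOp_zOp
  cForm := cForm_lorOp
  theta := theta_lorOp

/-- The action of `SU(2)`. -/
noncomputable def internalAction (m : ℝ) :
    Action m (Matrix.specialUnitaryGroup (Fin 2) ℂ) where
  act := suOp
  act_one := suOp_one
  act_mul := suOp_mul
  parity u q x hx := by simpa using hx.suOp u
  zOp := suOp_zOp
  cForm := cForm_suOp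
  theta := theta_suOp

end OneParticle

end Hyper

namespace Hyper

theorem delta_symm (a b : Fin 2) : delta a b = delta b a := by
  fin_cases a <;> fin_cases b <;> simp [delta]

theorem sub_sgn_true_smul {A : Type*} [Ring A] [Algebra ℂ A] (x y : A) :
    x - sgn true • y = x + y := by simp

theorem sub_sgn_false_smul {A : Type*} [Ring A] [Algebra ℂ A] (x y : A) :
    x - sgn false • y = x - y := by simp

theorem neg_smul_eq_smul_neg {A : Type*} [Ring A] [Algebra ℂ A] (c : ℂ) (x : A) :
    -c • x = c • -x := by simp

theorem neg_smul_sum_smul {A : Type*} [Ring A] [Algebra ℂ A] (c : ℂ) (d : Fin 2 → ℂ)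
    (x : Fin 2 → A) : -(c • ∑ k, d k • x k) = c • ∑ k, d k • -x k := by simp

theorem zero_smul_eq_zero {A : Type*} [Ring A] [Algebra ℂ A] {c : ℂ} (hc : c = 0) (x : A) :
    c • x = 0 := by simp [hc]

theorem diracDotted_apply {𝒜 : Type*} [Ring 𝒜] [Algebra ℂ 𝒜] (ξ : Fin 2 → (Test →ₗ[ℂ] 𝒜))
    (a : Fin 2) (g : Test) :
    diracDotted ξ a g = -∑ b, ∑ c, epsUp b c • ξ c (sigPd a b g) := by
  simp only [diracDotted, fieldD, sigPd_apply, LinearMap.sum_apply, LinearMap.smul_apply,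
    LinearMap.neg_apply, LinearMap.comp_apply, map_sum, map_smul, Finset.smul_sum, smul_neg,
    Finset.sum_neg_distrib, smul_smul]
  rw [Finset.sum_comm]
  congr 1
  refine Finset.sum_congr rfl fun b _ => ?_
  rw [Finset.sum_comm]
  simp only [mul_comm]

theorem diracUndotted_apply {𝒜 : Type*} [Ring 𝒜] [Algebra ℂ 𝒜] (ξ : Fin 2 → (Test →ₗ[ℂ] 𝒜))
    (a : Fin 2) (g : Test) :
    diracUndotted ξ a g = -∑ b, ∑ c, epsUp b c • ξ c (sigPd b a g) := by
  simp only [diracUndotted, fieldD, sigPd_apply, LinearMap.sum_apply, LinearMap.smul_apply,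
    LinearMap.neg_apply, LinearMap.comp_apply, map_sum, map_smul, Finset.smul_sum, smul_neg,
    Finset.sum_neg_distrib, smul_smul]
  rw [Finset.sum_comm]
  congr 1
  refine Finset.sum_congr rfl fun b _ => ?_
  rw [Finset.sum_comm]
  simp only [mul_comm]

/-! ### Assembly of the hyper-multiplet for given parameters -/

namespace OneParticle

open Multi ShellSpace

variable {m : ℝ}

theorem suOp_qbarOp (u : Matrix.specialUnitaryGroup (Fin 2) ℂ) (j a : Fin 2) :
    suOp (m := m) u * qbarOp j a = (∑ k, (starRingEnd ℂ) (u.1 j k) • qbarOp k a) * suOp u := by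
  have h := det_su u
  obtain ⟨h1, h2, h3, h4⟩ := conj_su u
  refine LinearMap.ext fun x => funext fun s => ?_
  cases s <;> rename_i k <;>
    simp only [Module.End.mul_apply, LinearMap.add_apply, LinearMap.smul_apply, Pi.add_apply,
      Pi.smul_apply, qbarOp_phi, qbarOp_f, qbarOp_psi, qbarOp_chib, suOp_phi, suOp_f, suOp_psi,
      suOp_chib, map_add, map_smul, Fin.sum_univ_two]
  · fin_cases j <;> fin_cases k <;> simp [eps, h1, h2, h3, h4]
  · fin_cases j <;> fin_cases k <;> simp [eps, h1, h2, h3, h4]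
  · fin_cases j <;> simp [h1, h2, h3, h4] <;> match_scalars <;> grind
  · fin_cases j <;> simp [h1, h2, h3, h4] <;> match_scalars <;> grind

/-- The supercharges. -/
noncomputable def supercharge (m : ℝ) (j a : Fin 2) : Ops m := charge true (qOp j a) (qbarOp j a)

/-- The central charge. -/
noncomputable def centralCharge (m : ℝ) : Ops m := charge false zOp zOp

/-- The generators of the translations. -/
noncomputable def momentum (m : ℝ) (μ : Fin 4) : Ops m := charge false (pOp μ) (pOp μ)

theorem star_supercharge (j a : Fin 2) :
    star (supercharge m j a) = charge true (qbarOp j a) (qOp j a) := star_charge _ _ _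

theorem supercharge_supercharge (j k a b : Fin 2) :
    acomm (supercharge m j a) (supercharge m k b)
      = (2 * eps a b * eps j k) • centralCharge m := by
  have h := charge_charge (isCharge_qOp (m := m) j a) (isCharge_qbarOp j a) (isCharge_qOp k b)
    (isCharge_qbarOp k b) (η := (2 * eps a b * eps j k) • zOp)
    (η' := (2 * eps a b * eps j k) • zOp) (Submodule.smul_mem _ _ isCharge_zOp.parity)
    (Submodule.smul_mem _ _ isCharge_zOp.parity)
    ((sub_sgn_true_smul _ _).trans (qOp_qOp j a k b))
    ((sub_sgn_true_smul _ _).trans ((add_comm _ _).trans (qbarOp_qbarOp j a k b)))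
  have h' := charge_smul (m := m) (2 * eps a b * eps j k) isCharge_zOp.parity isCharge_zOp.parity
  rw [show (starRingEnd ℂ) (2 * eps a b * eps j k) = 2 * eps a b * eps j k by
    simp [conj_eps, Complex.conj_ofNat]] at h'
  exact ((sub_sgn_true_smul _ _).symm.trans h).trans h'

theorem supercharge_star (j k a b : Fin 2) :
    acomm (supercharge m j a) (star (supercharge m k b))
      = (2 * delta j k) • ∑ μ, pauli μ a b • momentum m μ := by
  -- On one-particle vectors `σ^μ P_μ` is `I σ^μ ∂_μ`. The second component has transposed indices,
  -- consistent with the hermiticity of the Pauli matrices.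
  have hp : ∀ c d : Fin 2, I • each (sigK (m := m) c d) ∈ endParity m false := fun c d => by
    rw [← sum_pOp]
    exact Submodule.sum_mem _ fun μ _ => Submodule.smul_mem _ _ (isCharge_pOp μ).parity
  have h := charge_charge (isCharge_qOp (m := m) j a) (isCharge_qbarOp j a)
    (isCharge_qbarOp k b) (isCharge_qOp k b)
    (η := (2 * delta j k) • I • each (sigK a b)) (η' := (2 * delta j k) • I • each (sigK b a))
    (Submodule.smul_mem _ _ (hp a b)) (Submodule.smul_mem _ _ (hp b a))
    ((sub_sgn_true_smul _ _).trans ((qOp_qbarOp j a k b).trans (by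
      rw [smul_smul, mul_right_comm])))
    ((sub_sgn_true_smul _ _).trans ((qOp_qbarOp k b j a).trans (by
      rw [smul_smul, mul_right_comm, delta_symm])))
  have h' := charge_smul (2 * delta j k) (hp a b) (hp b a)
  rw [show (starRingEnd ℂ) (2 * delta j k) = 2 * delta j k by simp [conj_delta, Complex.conj_ofNat]] at h'
  have h'' := charge_sum (m := m) Finset.univ (fun μ => pauli μ a b)
    (fun μ => (isCharge_pOp μ).parity) (fun μ => (isCharge_pOp μ).parity)
  simp only [conj_pauli, sum_pOp] at h''
  rw [star_supercharge]
  exact ((sub_sgn_true_smul _ _).symm.trans h).trans (h'.trans (congrArg _ h''))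

theorem comm_supercharge_momentum (j a : Fin 2) (μ : Fin 4) :
    comm (supercharge m j a) (momentum m μ) = 0 := by
  have h := charge_charge (isCharge_qOp (m := m) j a) (isCharge_qbarOp j a) (isCharge_pOp μ)
    (isCharge_pOp μ) (Submodule.zero_mem _) (Submodule.zero_mem _)
    ((sub_sgn_false_smul _ _).trans (sub_eq_zero.2 (pOp_qOp μ j a).symm))
    ((sub_sgn_false_smul _ _).trans (sub_eq_zero.2 (pOp_qbarOp μ j a)))
  exact ((sub_sgn_false_smul _ _).symm.trans h).trans (charge_zero _)

theorem comm_centralCharge_supercharge (j a : Fin 2) :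
    comm (centralCharge m) (supercharge m j a) = 0 := by
  have h := charge_charge isCharge_zOp isCharge_zOp (isCharge_qOp (m := m) j a)
    (isCharge_qbarOp j a) (Submodule.zero_mem _) (Submodule.zero_mem _)
    ((sub_sgn_false_smul _ _).trans (sub_eq_zero.2 (zOp_qOp j a)))
    ((sub_sgn_false_smul _ _).trans (sub_eq_zero.2 (zOp_qbarOp j a).symm))
  exact ((sub_sgn_false_smul _ _).symm.trans h).trans (charge_zero _)

theorem lorentz_supercharge (A : Matrix.SpecialLinearGroup (Fin 2) ℂ) (j a : Fin 2) :
    star ((lorentzAction m).rep A : Ops m) * supercharge m j a * ((lorentzAction m).rep A : Ops m)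
      = ∑ b, A.1 a b • supercharge m j b := by
  have h := charge_sum (m := m) Finset.univ (fun b => A.1 a b)
    (fun b => (isCharge_qOp j b).parity) (fun b => (isCharge_qbarOp j b).parity)
  refine ((lorentzAction m).rep_charge (isCharge_qOp j a).parity (isCharge_qbarOp j a).parity
    ?_ ?_ (lorOp_qOp A j a) (lorOp_qbarOp A j a)).trans h
  · exact Submodule.sum_mem _ fun b _ => Submodule.smul_mem _ _ (isCharge_qOp j b).parity
  · exact Submodule.sum_mem _ fun b _ => Submodule.smul_mem _ _ (isCharge_qbarOp j b).parity

theorem internal_supercharge (u : Matrix.specialUnitaryGroup (Fin 2) ℂ) (j a : Fin 2) :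
    star ((internalAction m).rep u : Ops m) * supercharge m j a * ((internalAction m).rep u : Ops m)
      = ∑ k, u.1 j k • supercharge m k a := by
  have h := charge_sum (m := m) Finset.univ (fun k => u.1 j k)
    (fun k => (isCharge_qOp k a).parity) (fun k => (isCharge_qbarOp k a).parity)
  refine ((internalAction m).rep_charge (isCharge_qOp j a).parity (isCharge_qbarOp j a).parity
    ?_ ?_ (suOp_qOp u j a) (suOp_qbarOp u j a)).trans h
  · exact Submodule.sum_mem _ fun b _ => Submodule.smul_mem _ _ (isCharge_qOp b a).parity
  · exact Submodule.sum_mem _ fun b _ => Submodule.smul_mem _ _ (isCharge_qbarOp b a).parity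

section

variable (α : ℂ) (β : ℝ)

/-- The fields of the multiplet. -/
noncomputable def fieldMap (X : Comp) : Test →ₗ[ℂ] Ops m := fieldOp α β ∘ₗ vec X

theorem fieldMap_apply (X : Comp) (g : Test) :
    fieldMap (m := m) α β X g = fieldOp α β (vec X g) := rfl

theorem fieldOp_sum_sum (c : Fin 2 → Fin 2 → ℂ) (X : Fin 2 → Comp) (G : Fin 2 → Test) :
    fieldOp α β (∑ b, ∑ d, c b d • vec (m := m) (X d) (G b))
      = ∑ b, ∑ d, c b d • fieldMap α β (X d) (G b) := by
  simp only [map_sum, map_smul, fieldMap_apply]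

theorem fieldOp_sum (c : Fin 2 → ℂ) (X : Fin 2 → Comp) (g : Test) :
    fieldOp α β (∑ k, c k • vec (m := m) (X k) g) = ∑ k, c k • fieldMap α β (X k) g := by
  simp only [map_sum, map_smul, fieldMap_apply]

theorem adj_fieldMap_phi (j : Fin 2) :
    adj (fieldMap (m := m) α β (.phi j)) = fieldMap α β (.phiStar j) :=
  LinearMap.ext fun g => by
    rw [adj_apply, fieldMap_apply, star_fieldOp, conj_vec_phi, fieldMap_apply]

theorem adj_fieldMap_f (j : Fin 2) :
    adj (fieldMap (m := m) α β (.f j)) = fieldMap α β (.fStar j) :=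
  LinearMap.ext fun g => by
    rw [adj_apply, fieldMap_apply, star_fieldOp, conj_vec_f, fieldMap_apply]

theorem adj_fieldMap_psi (a : Fin 2) :
    adj (fieldMap (m := m) α β (.psi a)) = fieldMap α β (.psiBar a) :=
  LinearMap.ext fun g => by
    rw [adj_apply, fieldMap_apply, star_fieldOp, conj_vec_psi, fieldMap_apply]

theorem adj_fieldMap_chi (a : Fin 2) :
    adj (fieldMap (m := m) α β (.chi a)) = fieldMap α β (.chiBar a) :=
  LinearMap.ext fun g => by
    rw [adj_apply, fieldMap_apply, star_fieldOp, conj_vec_chi, fieldMap_apply]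

theorem comm_charge_fieldMap {p : Bool} {δ δ' : Module.End ℂ (Multi m)} (hδ : IsCharge p δ)
    (hδ' : IsCharge p δ') (h : IsConj p δ δ') {X : Comp} (hX : (p && X.isFermi) = false)
    (g : Test) :
    comm (charge p δ δ') (fieldMap α β X g) = fieldOp α β (diag δ (vec X g)) := by
  have := charge_fieldOp α β hδ hδ' h (vec_mem g X)
  rw [hX, sub_sgn_false_smul] at this
  rw [fieldMap_apply, comm, this]

theorem acomm_charge_fieldMap {p : Bool} {δ δ' : Module.End ℂ (Multi m)} (hδ : IsCharge p δ)
    (hδ' : IsCharge p δ') (h : IsConj p δ δ') {X : Comp} (hX : (p && X.isFermi) = true)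
    (g : Test) :
    acomm (charge p δ δ') (fieldMap α β X g) = fieldOp α β (diag δ (vec X g)) := by
  have := charge_fieldOp α β hδ hδ' h (vec_mem g X)
  rw [hX, sub_sgn_true_smul] at this
  rw [fieldMap_apply, acomm, this]

theorem comm_supercharge (j a : Fin 2) {X : Comp} (hX : X.isFermi = false) (g : Test) :
    comm (supercharge m j a) (fieldMap α β X g) = fieldOp α β (diag (qOp j a) (vec X g)) :=
  comm_charge_fieldMap α β (isCharge_qOp j a) (isCharge_qbarOp j a) (isConj_qOp j a) (by simp [hX]) g

theorem comm_star_supercharge (j a : Fin 2) {X : Comp} (hX : X.isFermi = false) (g : Test) :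
    comm (star (supercharge m j a)) (fieldMap α β X g)
      = fieldOp α β (diag (qbarOp j a) (vec X g)) := by
  rw [star_supercharge]
  exact comm_charge_fieldMap α β (isCharge_qbarOp j a) (isCharge_qOp j a) (isConj_qbarOp j a)
    (by simp [hX]) g

theorem acomm_supercharge (j a : Fin 2) {X : Comp} (hX : X.isFermi = true) (g : Test) :
    acomm (supercharge m j a) (fieldMap α β X g) = fieldOp α β (diag (qOp j a) (vec X g)) :=
  acomm_charge_fieldMap α β (isCharge_qOp j a) (isCharge_qbarOp j a) (isConj_qOp j a)
    (by simp [hX]) g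

theorem comm_centralCharge (X : Comp) (g : Test) :
    comm (centralCharge m) (fieldMap α β X g) = fieldOp α β (diag zOp (vec X g)) :=
  comm_charge_fieldMap α β isCharge_zOp isCharge_zOp isConj_zOp rfl g

theorem comm_momentum (μ : Fin 4) (X : Comp) (g : Test) :
    comm (momentum m μ) (fieldMap α β X g) = -I • fieldD μ (fieldMap α β X) g := by
  refine (comm_charge_fieldMap α β (isCharge_pOp μ) (isCharge_pOp μ) (isConj_pOp μ) rfl g).trans ?_
  rw [pOp, each_vec (T' := fun g => I • pd μ g) fun g => by simp]
  simp [fieldD, fieldMap]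

theorem translations_fieldMap (a : Spacetime) (X : Comp) (g : Test) :
    star ((translations m).rep (Multiplicative.ofAdd a) : Ops m) * fieldMap α β X g
      * ((translations m).rep (Multiplicative.ofAdd a) : Ops m) = fieldMap α β X (translateTest a g) :=
  ((translations m).rep_fieldOp α β _ _).trans
    (congrArg (fieldOp α β) (each_vec (T' := translateTest a) (transK_mk a) X g))

theorem lorentz_fieldMap (A : Matrix.SpecialLinearGroup (Fin 2) ℂ) (X : Comp) (g : Test) :
    star ((lorentzAction m).rep A : Ops m) * fieldMap α β X g * ((lorentzAction m).rep A : Ops m)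
      = fieldOp α β (diag (lorOp A) (vec X g)) :=
  (lorentzAction m).rep_fieldOp α β _ _

theorem internal_fieldMap (u : Matrix.specialUnitaryGroup (Fin 2) ℂ) (X : Comp) (g : Test) :
    star ((internalAction m).rep u : Ops m) * fieldMap α β X g * ((internalAction m).rep u : Ops m)
      = fieldOp α β (diag (suOp u) (vec X g)) :=
  (internalAction m).rep_fieldOp α β _ _

end

theorem lorentz_translations (A : Matrix.SpecialLinearGroup (Fin 2) ℂ) (a : Spacetime) :
    (lorentzAction m).rep A * (translations m).rep (Multiplicative.ofAdd a)
      = (translations m).rep (Multiplicative.ofAdd (lorentz A a)) * (lorentzAction m).rep A :=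
  Action.rep_mul_rep _ _ (lorOp_transK A a)

theorem internal_translations (u : Matrix.specialUnitaryGroup (Fin 2) ℂ)
    (a : Multiplicative Spacetime) :
    (internalAction m).rep u * (translations m).rep a
      = (translations m).rep a * (internalAction m).rep u :=
  Action.rep_mul_rep _ _ (suOp_each u _)

theorem internal_lorentz (u : Matrix.specialUnitaryGroup (Fin 2) ℂ)
    (A : Matrix.SpecialLinearGroup (Fin 2) ℂ) :
    (internalAction m).rep u * (lorentzAction m).rep A
      = (lorentzAction m).rep A * (internalAction m).rep u :=
  Action.rep_mul_rep _ _ (suOp_lorOp u A)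

section

variable (α : ℂ) (β : ℝ)

theorem lorentz_fieldMap_phi (A : Matrix.SpecialLinearGroup (Fin 2) ℂ) (j : Fin 2) (g : Test) :
    star ((lorentzAction m).rep A : Ops m) * fieldMap α β (.phi j) g * ((lorentzAction m).rep A : Ops m)
      = fieldMap α β (.phi j) (lorentzTest A g) := by
  rw [lorentz_fieldMap, lorOp_vec_phi, fieldMap_apply]

theorem internal_fieldMap_phi (u : Matrix.specialUnitaryGroup (Fin 2) ℂ) (j : Fin 2) (g : Test) :
    star ((internalAction m).rep u : Ops m) * fieldMap α β (.phi j) g * ((internalAction m).rep u : Ops m)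
      = ∑ k, u.1 j k • fieldMap α β (.phi k) g := by
  rw [internal_fieldMap, suOp_vec_phi, fieldOp_sum α β (u.1 j) .phi]

theorem lorentz_fieldMap_f (A : Matrix.SpecialLinearGroup (Fin 2) ℂ) (j : Fin 2) (g : Test) :
    star ((lorentzAction m).rep A : Ops m) * fieldMap α β (.f j) g * ((lorentzAction m).rep A : Ops m)
      = fieldMap α β (.f j) (lorentzTest A g) := by
  rw [lorentz_fieldMap, lorOp_vec_f, fieldMap_apply]

theorem internal_fieldMap_f (u : Matrix.specialUnitaryGroup (Fin 2) ℂ) (j : Fin 2) (g : Test) :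
    star ((internalAction m).rep u : Ops m) * fieldMap α β (.f j) g * ((internalAction m).rep u : Ops m)
      = ∑ k, u.1 j k • fieldMap α β (.f k) g := by
  rw [internal_fieldMap, suOp_vec_f, fieldOp_sum α β (u.1 j) .f]

theorem lorentz_fieldMap_psi (A : Matrix.SpecialLinearGroup (Fin 2) ℂ) (a : Fin 2) (g : Test) :
    star ((lorentzAction m).rep A : Ops m) * fieldMap α β (.psi a) g * ((lorentzAction m).rep A : Ops m)
      = ∑ b, A.1 a b • fieldMap α β (.psi b) (lorentzTest A g) := by
  rw [lorentz_fieldMap, lorOp_vec_psi, fieldOp_sum α β (A.1 a) .psi]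

theorem internal_fieldMap_psi (u : Matrix.specialUnitaryGroup (Fin 2) ℂ) (a : Fin 2) (g : Test) :
    star ((internalAction m).rep u : Ops m) * fieldMap α β (.psi a) g * ((internalAction m).rep u : Ops m)
      = fieldMap α β (.psi a) g := by
  rw [internal_fieldMap, suOp_vec_psi, fieldMap_apply]

theorem lorentz_fieldMap_chi (A : Matrix.SpecialLinearGroup (Fin 2) ℂ) (a : Fin 2) (g : Test) :
    star ((lorentzAction m).rep A : Ops m) * fieldMap α β (.chi a) g * ((lorentzAction m).rep A : Ops m)
      = ∑ b, A.1 a b • fieldMap α β (.chi b) (lorentzTest A g) := by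
  rw [lorentz_fieldMap, lorOp_vec_chi, fieldOp_sum α β (A.1 a) .chi]

theorem internal_fieldMap_chi (u : Matrix.specialUnitaryGroup (Fin 2) ℂ) (a : Fin 2) (g : Test) :
    star ((internalAction m).rep u : Ops m) * fieldMap α β (.chi a) g * ((internalAction m).rep u : Ops m)
      = fieldMap α β (.chi a) g := by
  rw [internal_fieldMap, suOp_vec_chi, fieldMap_apply]

variable (j a b k : Fin 2) (g : Test)

theorem comm_supercharge_phi : I • comm (supercharge m j a) (fieldMap α β (.phi k) g)
    = eps j k • fieldMap α β (.psi a) g := by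
  rw [comm_supercharge α β j a rfl, ← map_smul, qOp_vec_phi, map_smul, fieldMap_apply]

theorem comm_star_supercharge_phi :
    I • comm (star (supercharge m j a)) (fieldMap α β (.phi k) g)
      = delta j k • adj (fieldMap α β (.chi a)) g := by
  rw [comm_star_supercharge α β j a rfl, ← map_smul, qbarOp_vec_phi, map_smul,
    adj_fieldMap_chi, fieldMap_apply]

theorem comm_supercharge_f : comm (supercharge m j a) (fieldMap α β (.f k) g)
    = (I * eps j k) • diracDotted (fun b => adj (fieldMap α β (.chi b))) a g := by
  rw [comm_supercharge α β j a rfl, qOp_vec_f, diracDotted_apply, map_smul,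
    fieldOp_sum_sum α β (fun b c => epsUp b c) .chiBar, neg_mul, neg_smul_eq_smul_neg]
  simp only [adj_fieldMap_chi]

theorem comm_star_supercharge_f : comm (star (supercharge m j a)) (fieldMap α β (.f k) g)
    = (-I * delta j k) • diracUndotted (fun b => fieldMap α β (.psi b)) a g := by
  rw [comm_star_supercharge α β j a rfl, qbarOp_vec_f, diracUndotted_apply, map_smul,
    fieldOp_sum_sum α β (fun b c => epsUp b c) .psi fun b => sigPd b a g, neg_mul,
    neg_smul_eq_smul_neg, neg_neg]

theorem acomm_supercharge_psi : acomm (supercharge m j a) (fieldMap α β (.psi b) g)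
    = (-2 * eps a b) • fieldMap α β (.f j) g := by
  rw [acomm_supercharge α β j a rfl, qOp_vec_psi, map_smul, fieldMap_apply]

theorem acomm_supercharge_psiBar :
    acomm (supercharge m j a) (adj (fieldMap α β (.psi b)) g)
      = (2 : ℂ) • ∑ k, eps j k • sigmaField (adj (fieldMap α β (.phi k))) a b g := by
  rw [adj_fieldMap_psi, acomm_supercharge α β j a rfl, qOp_vec_psiBar, map_neg, map_smul,
    fieldOp_sum α β (eps j) .phiStar, neg_smul_sum_smul]
  simp only [adj_fieldMap_phi, sigmaField_apply]

theorem acomm_supercharge_chi : acomm (supercharge m j a) (fieldMap α β (.chi b) g)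
    = (2 * eps a b) • ∑ k, eps j k • adj (fieldMap α β (.f k)) g := by
  rw [acomm_supercharge α β j a rfl, qOp_vec_chi, map_smul, fieldOp_sum α β (eps j) .fStar]
  simp only [adj_fieldMap_f]

theorem acomm_supercharge_chiBar :
    acomm (supercharge m j a) (adj (fieldMap α β (.chi b)) g)
      = (2 : ℂ) • sigmaField (fieldMap α β (.phi j)) a b g := by
  rw [adj_fieldMap_chi, acomm_supercharge α β j a rfl, qOp_vec_chiBar, map_neg, map_smul,
    sigmaField_apply, smul_neg, fieldMap_apply]

theorem comm_centralCharge_phi :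
    I • comm (centralCharge m) (fieldMap α β (.phi j) g) = fieldMap α β (.f j) g := by
  rw [comm_centralCharge, ← map_smul, zOp_vec_phi, fieldMap_apply]

theorem comm_centralCharge_f :
    I • comm (centralCharge m) (fieldMap α β (.f j) g) = fieldMap α β (.phi j) (box g) := by
  rw [comm_centralCharge, ← map_smul, zOp_vec_f, fieldMap_apply]

theorem comm_centralCharge_psi : comm (centralCharge m) (fieldMap α β (.psi a) g)
    = I • diracDotted (fun b => adj (fieldMap α β (.chi b))) a g := by
  rw [comm_centralCharge, zOp_vec_psi, diracDotted_apply, map_smul,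
    fieldOp_sum_sum α β (fun b c => epsUp b c) .chiBar, neg_smul_eq_smul_neg]
  simp only [adj_fieldMap_chi]

theorem comm_centralCharge_chi : comm (centralCharge m) (fieldMap α β (.chi a) g)
    = -I • diracDotted (fun b => adj (fieldMap α β (.psi b))) a g := by
  rw [comm_centralCharge, zOp_vec_chi, diracDotted_apply, map_smul,
    fieldOp_sum_sum α β (fun b c => epsUp b c) .psiBar, neg_smul_eq_smul_neg, neg_neg]
  simp only [adj_fieldMap_psi]

end

/-- The hyper-multiplet with parameters `α` and `β`. -/
noncomputable def multiplet (m : ℝ) (α : ℂ) (β : ℝ) : Multiplet (Ops m) where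
  T := (translations m).rep
  L := (lorentzAction m).rep
  V := (internalAction m).rep
  P := momentum m
  Q := supercharge m
  Z := centralCharge m
  φ j := fieldMap α β (.phi j)
  f j := fieldMap α β (.f j)
  ψ a := fieldMap α β (.psi a)
  χ a := fieldMap α β (.chi a)
  L_T := lorentz_translations
  V_T := internal_translations
  V_L := internal_lorentz
  T_φ a _ g := translations_fieldMap α β a _ g
  T_f a _ g := translations_fieldMap α β a _ g
  T_ψ a _ g := translations_fieldMap α β a _ g
  T_χ a _ g := translations_fieldMap α β a _ g
  L_φ := lorentz_fieldMap_phi α β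
  L_f := lorentz_fieldMap_f α β
  L_ψ := lorentz_fieldMap_psi α β
  L_χ := lorentz_fieldMap_chi α β
  V_φ := internal_fieldMap_phi α β
  V_f := internal_fieldMap_f α β
  V_ψ := internal_fieldMap_psi α β
  V_χ := internal_fieldMap_chi α β
  P_star _ := star_charge _ _ _
  P_φ μ _ g := comm_momentum α β μ _ g
  P_f μ _ g := comm_momentum α β μ _ g
  P_ψ μ _ g := comm_momentum α β μ _ g
  P_χ μ _ g := comm_momentum α β μ _ g
  Z_star := star_charge _ _ _
  Q_P := comm_supercharge_momentum
  L_Q := lorentz_supercharge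
  V_Q := internal_supercharge
  Q_Q := supercharge_supercharge
  Q_Qbar := supercharge_star
  Z_Q := comm_centralCharge_supercharge
  Q_φ := comm_supercharge_phi α β
  Qbar_φ := comm_star_supercharge_phi α β
  Q_f := comm_supercharge_f α β
  Qbar_f := comm_star_supercharge_f α β
  Q_ψ := acomm_supercharge_psi α β
  Q_ψbar := acomm_supercharge_psiBar α β
  Q_χ := acomm_supercharge_chi α β
  Q_χbar := acomm_supercharge_chiBar α β
  Z_φ := comm_centralCharge_phi α β
  Z_f := comm_centralCharge_f α β
  Z_ψ := comm_centralCharge_psi α β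
  Z_χ := comm_centralCharge_chi α β

/-! ### Independence and causal brackets of the constructed multiplet -/

variable (α : ℂ) (β : ℝ)

theorem multiplet_field (X : Comp) : (multiplet m α β).field X = fieldMap α β X := by
  cases X
  · rfl
  · exact adj_fieldMap_phi α β _
  · rfl
  · exact adj_fieldMap_f α β _
  · rfl
  · exact adj_fieldMap_psi α β _
  · rfl
  · exact adj_fieldMap_chi α β _

theorem comm_fieldMap {X Y : Comp} (h : (X.isFermi && Y.isFermi) = false) (g g' : Test) :
    comm (fieldMap (m := m) α β X g) (fieldMap α β Y g')
      = bForm (m := m) α β (vec X g) (vec Y g') • (1 : Ops m) := by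
  have := fieldOp_bracket α β (vec_mem (m := m) g X) (vec_mem g' Y)
  rw [h, sub_sgn_false_smul] at this
  rw [fieldMap_apply, fieldMap_apply, comm, this]

theorem acomm_fieldMap {X Y : Comp} (h : (X.isFermi && Y.isFermi) = true) (g g' : Test) :
    acomm (fieldMap (m := m) α β X g) (fieldMap α β Y g')
      = bForm (m := m) α β (vec X g) (vec Y g') • (1 : Ops m) := by
  have := fieldOp_bracket α β (vec_mem (m := m) g X) (vec_mem g' Y)
  rw [h, sub_sgn_true_smul] at this
  rw [fieldMap_apply, fieldMap_apply, acomm, this]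

theorem multiplet_causal (X Y : Comp) (g h : Test) :
    (multiplet m α β).causal X Y g h
      = bForm (m := m) α β (vec X g) (vec Y h) • (1 : Ops m) := by
  rw [Multiplet.causal, multiplet_field, multiplet_field]
  split_ifs with hXY
  · exact acomm_fieldMap α β hXY g h
  · exact comm_fieldMap α β (by simpa using hXY) g h

/-- Injectivity of `fieldOp` turns a relation of fields into one of one-particle vectors, whose
terms lie in different slots and so vanish one by one. -/
theorem multiplet_independent : (multiplet m α β).Independent := by
  intro S p h X hX g
  have h0 : ∑ Y ∈ S, vec (m := m) Y (diffOp (p Y) g) = 0 := by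
    refine fieldOp_injective α β ?_
    rw [map_sum, map_zero, ← h g]
    exact Finset.sum_congr rfl fun Y _ => by rw [multiplet_field, fieldMap_apply]
  rw [multiplet_field, fieldMap_apply,
    vec_eq_zero_of_sum_eq_zero (G := fun Y => diffOp (p Y) g) h0 X hX, map_zero]

theorem multiplet_hasCausalBrackets : (multiplet m α β).HasCausalBrackets m := by
  intro X Y
  obtain ⟨p, hp⟩ := isCausal_bForm (m := m) α β X Y
  exact ⟨p, fun g h => by rw [multiplet_causal, ← hp]⟩

theorem multiplet_freeScalars : (multiplet m α β).FreeScalars m where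
  kleinGordon j g := by
    change fieldOp α β (vec (.phi j) _) = 0
    have : vec (m := m) (.phi j) (box g + ((m : ℂ) ^ 2) • g) = 0 := by
      refine funext fun r => funext fun s => ?_
      rw [vec_apply, map_add, mk_box, map_smul]
      simp
    rw [this, map_zero]
  phi_phi j k g h := (comm_fieldMap α β rfl g h).trans 
    (zero_smul_eq_zero (bForm_phi_phi α β j k g h) _)
  phi_phiStar j k g h := by
    change comm (fieldMap α β (.phi j) g) (adj (fieldMap α β (.phi k)) h) = _
    rw [adj_fieldMap_phi, comm_fieldMap α β rfl, bForm_phi_phiStar]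

theorem multiplet_causalRelations : (multiplet m α β).CausalRelations m α β where
  f_fStar j k g h := by
    change comm (fieldMap α β (.f j) g) (adj (fieldMap α β (.f k)) h) = _
    rw [adj_fieldMap_f, comm_fieldMap α β rfl, bForm_f_fStar]
  phi_f j k g h := (comm_fieldMap α β rfl g h).trans (by rw [bForm_phi_f])
  phi_fStar j k g h := by
    change comm (fieldMap α β (.phi j) g) (adj (fieldMap α β (.f k)) h) = _
    rw [adj_fieldMap_f, comm_fieldMap α β rfl, bForm_phi_fStar]
  psi_psi a b g h := (acomm_fieldMap α β rfl g h).trans (by rw [bForm_psi_psi])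
  psi_psiBar a b g h := by
    change acomm (fieldMap α β (.psi a) g) (adj (fieldMap α β (.psi b)) h) = _
    rw [adj_fieldMap_psi, acomm_fieldMap α β rfl, bForm_psi_psiBar, pauliJordanD, diffOp_sigmaD]
  chi_chi a b g h := (acomm_fieldMap α β rfl g h).trans (by rw [bForm_chi_chi])
  chi_chiBar a b g h := by
    change acomm (fieldMap α β (.chi a) g) (adj (fieldMap α β (.chi b)) h) = _
    rw [adj_fieldMap_chi, acomm_fieldMap α β rfl, bForm_chi_chiBar, pauliJordanD, diffOp_sigmaD]
  psi_chi a b g h := (acomm_fieldMap α β rfl g h).trans (by rw [bForm_psi_chi])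
  f_f j k g h := (comm_fieldMap α β rfl g h).trans 
    (zero_smul_eq_zero (bForm_f_f α β j k g h) _)
  psi_chiBar a b g h := by
    change acomm (fieldMap α β (.psi a) g) (adj (fieldMap α β (.chi b)) h) = _
    rw [adj_fieldMap_chi, acomm_fieldMap α β rfl]
    exact zero_smul_eq_zero (bForm_psi_chiBar α β a b g h) _
  bose_fermi X Y hX hY g h := by
    have e := multiplet_causal (m := m) α β X Y g h
    rw [Multiplet.causal, if_neg (by simp [hX])] at e
    exact e.trans (zero_smul_eq_zero ((causalForm m α β).even X.isFermi Y.isFermi _ _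
      (vec_mem g X) (vec_mem h Y) (by simp [hX, hY])) _)

end OneParticle

end Hyper

/-- For the hyper-multiplet whose `φ_j` are free complex scalar fields of mass `m ≥ 0`, all causal
(anti)commutators are those of the list, for unique parameters `α ∈ ℂ` and `β ∈ ℝ`; and the
parameters are free: every pair of values is realized. -/
theorem mainTheorem7 (m : ℝ) (hm : 0 ≤ m) :
    (∀ (𝒜 : Type*) [Ring 𝒜] [StarRing 𝒜] [Algebra ℂ 𝒜] [StarModule ℂ 𝒜] [Nontrivial 𝒜]
      (M : Hyper.Multiplet 𝒜), M.HasCausalBrackets m → M.FreeScalars m →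
        ∃! p : ℂ × ℝ, M.CausalRelations m p.1 p.2) ∧
    (∀ (α : ℂ) (β : ℝ), ∃ (𝒜 : Type) (_ : Ring 𝒜) (_ : StarRing 𝒜) (_ : Algebra ℂ 𝒜)
      (_ : StarModule ℂ 𝒜) (_ : Nontrivial 𝒜) (M : Hyper.Multiplet 𝒜),
        M.Independent ∧ M.HasCausalBrackets m ∧ M.FreeScalars m ∧ M.CausalRelations m α β) := by
  refine ⟨fun 𝒜 _ _ _ _ _ M hM hF => Hyper.Multiplet.existsUnique_causalRelations hM hF,
    fun α β => ?_⟩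
  exact ⟨Hyper.OneParticle.Ops m, inferInstance, inferInstance, inferInstance, inferInstance,
    inferInstance, Hyper.OneParticle.multiplet m α β, Hyper.OneParticle.multiplet_independent α β,
    Hyper.OneParticle.multiplet_hasCausalBrackets α β, Hyper.OneParticle.multiplet_freeScalars α β,
    Hyper.OneParticle.multiplet_causalRelations α β⟩
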